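/- Let $c<0$ and let $\mathbb{C}H^n(c)$ be the complex hyperbolic space of complex dimension $n$ and constant holomorphic sectional curvature $c$, with metric $\langle\cdot,\cdot\rangle$, complex structure $J$ and Levi-Civita connection $\bar\nabla$. Let $M$ be a connected (immersed, smooth) real hypersurface of $\mathbb{C}H^n(c)$ with a globally defined smooth unit normal field $\xi$ and shape operator $SX=-\bar\nabla_X\xi$. Assume that $M$ has constant principal curvatures, $g$ of them distinct, and denote by $T_\lambda(p)=\ker(S_p-\lambda\,\mathrm{Id})$ the principal curvature spaces. Assume that at every point $p\in M$ the Hopf vector $J\xi_p$ has nonzero orthogonal projection onto exactly $h=2$ of the principal curvature spaces at $p$. Then $g\in\{3,4\}$. Moreover, after replacing $\xi$ by $-\xi$ if necessary, the principal curvatures can be labelled $\lambda_1,\dots,\lambda_g$ so that $\lambda_1<\lambda_2$, $\lambda_3\ge 0$, and at every point $J\xi=b_1U_1+b_2U_2$ with unit vectors $U_i\in T_{\lambda_i}$ and $b_i>0$ ($i=1,2$), while the unit vector $A$ determined by $JA=b_2U_1-b_1U_2$ belongs to $T_{\lambda_3}$. For every such choice of the sign of $\xi$ and of the labelling the following holds: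 (i) If $g=3$ and $\dim T_{\lambda_2}>1$, then $\lambda_1=0$, $\lambda_2=\frac{\sqrt{-3c}}{2}$ and $\lambda_3=\frac{\sqrt{-c}}{2\sqrt3}$. (ii) If $g=4$, then $\dim T_{\lambda_2}=1$, $0\neq\lambda_3\neq\frac{\sqrt{-c}}{2\sqrt3}$ and $\lambda_4=-\frac{c}{4\lambda_3}$. -/

import Mathlib

open scoped Manifold ContDiff

namespace CHn

/-- The coordinate space `ℂⁿ`. Its complex structure `J` is multiplication by `Complex.I`. -/
abbrev Coord (n : ℕ) : Type := EuclideanSpace ℂ (Fin n)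

/-- `1 + (c/4) ‖z‖²`. -/
noncomputable def rho {n : ℕ} (c : ℝ) (z : Coord n) : ℝ := 1 + c / 4 * ‖z‖ ^ 2

/-- The underlying set of the complex hyperbolic space `ℂHⁿ(c)`, `c < 0`, in the ball model:
the open ball of radius `2 / √(-c)` in `ℂⁿ`. -/
def space (n : ℕ) (c : ℝ) : Set (Coord n) := {z | 0 < rho c z}

/-- The Bergman metric of constant holomorphic sectional curvature `c` at the point `z`, as a real
bilinear form on `T_z ℂHⁿ(c) = ℂⁿ`. -/
noncomputable def metric {n : ℕ} (c : ℝ) (z v w : Coord n) : ℝ :=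
  ((rho c z : ℂ) * inner ℂ v w - (c / 4 : ℝ) * (inner ℂ v z * inner ℂ z w)).re / rho c z ^ 2

/-- The Christoffel symbols of the Levi-Civita connection of the Bergman metric: the connection is
`∇̄_v W = D_v W + christoffel c z v W`. It is torsion-free by `christoffel_comm` and metric
by `hasDerivAt_metric`, and these two properties determine it. -/
noncomputable def christoffel {n : ℕ} (c : ℝ) (z v w : Coord n) : Coord n :=
  (((-(c / 4) / rho c z : ℝ) : ℂ) * inner ℂ z v) • w +
    (((-(c / 4) / rho c z : ℝ) : ℂ) * inner ℂ z w) • v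

theorem christoffel_comm {n : ℕ} (c : ℝ) (z v w : Coord n) :
    christoffel c z v w = christoffel c z w v := by
  simp only [christoffel]; abel

theorem christoffel_add_left {n : ℕ} (c : ℝ) (z v v' w : Coord n) :
    christoffel c z (v + v') w = christoffel c z v w + christoffel c z v' w := by
  simp only [christoffel, inner_add_right, mul_add, add_smul, smul_add]; abel

theorem christoffel_smul_left {n : ℕ} (c : ℝ) (z v w : Coord n) (t : ℝ) :
    christoffel c z (t • v) w = t • christoffel c z v w := by
  ext i
  simp only [christoffel, ← Complex.coe_smul t, inner_smul_right, PiLp.add_apply,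
    PiLp.smul_apply, smul_eq_mul]
  ring

theorem hasDerivAt_rho {n : ℕ} (c : ℝ) (z v : Coord n) :
    HasDerivAt (fun t : ℝ => rho c (z + t • v)) (c / 4 * (2 * (inner ℂ z v).re)) 0 := by
  have e : (fun t : ℝ => rho c (z + t • v)) = fun t : ℝ =>
      1 + c / 4 * (‖z‖ ^ 2 + 2 * (t * (inner ℂ z v).re) + t ^ 2 * ‖v‖ ^ 2) := by
    funext t
    rw [rho, ← Complex.coe_smul t v, @norm_add_sq ℂ, inner_smul_right, norm_smul]
    simp [mul_pow]
  rw [e]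
  have h1 : HasDerivAt (fun t : ℝ => t) 1 0 := hasDerivAt_id 0
  have h := (((((h1.mul_const (inner ℂ z v).re).const_mul 2).const_add (‖z‖ ^ 2)).add
    ((h1.pow 2).mul_const (‖v‖ ^ 2))).const_mul (c / 4)).const_add 1
  refine h.congr_deriv ?_
  simp

/-- The connection is compatible with the metric. -/
theorem hasDerivAt_metric {n : ℕ} (c : ℝ) (z v w u : Coord n) (hz : rho c z ≠ 0) :
    HasDerivAt (fun t : ℝ => metric c (z + t • v) w u)
      (metric c z (christoffel c z v w) u + metric c z w (christoffel c z v u)) 0 := by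
  have hr := hasDerivAt_rho c z v
  have e : (fun t : ℝ => metric c (z + t • v) w u) = fun t : ℝ =>
      (rho c (z + t • v) * (inner ℂ w u).re - c / 4 *
        (((inner ℂ w z).re + t * (inner ℂ w v).re) * ((inner ℂ z u).re + t * (inner ℂ v u).re) -
         ((inner ℂ w z).im + t * (inner ℂ w v).im) * ((inner ℂ z u).im + t * (inner ℂ v u).im)))
        / rho c (z + t • v) ^ 2 := by
    funext t
    simp only [metric, ← Complex.coe_smul t v, inner_add_left, inner_add_right, inner_smul_left,
      inner_smul_right]
    simp [Complex.mul_re, Complex.mul_im]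
  rw [e]
  have h1 : HasDerivAt (fun t : ℝ => t) 1 0 := hasDerivAt_id 0
  have hz0 : rho c (z + (0 : ℝ) • v) = rho c z := by simp
  have lin : ∀ a b : ℝ, HasDerivAt (fun t : ℝ => a + t * b) b 0 := fun a b => by
    simpa using (h1.mul_const b).const_add a
  have h := ((hr.mul_const (inner ℂ w u).re).sub
    ((((lin (inner ℂ w z).re (inner ℂ w v).re).mul (lin (inner ℂ z u).re (inner ℂ v u).re)).sub
    ((lin (inner ℂ w z).im (inner ℂ w v).im).mul
      (lin (inner ℂ z u).im (inner ℂ v u).im))).const_mul (c / 4))).div (hr.pow 2)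
    (by simpa using hz)
  refine h.congr_deriv ?_
  have c1 : (inner ℂ v z : ℂ) = starRingEnd ℂ (inner ℂ z v) := (inner_conj_symm v z).symm
  have c2 : (inner ℂ w z : ℂ) = starRingEnd ℂ (inner ℂ z w) := (inner_conj_symm w z).symm
  have hr' : rho c z = 1 + c / 4 * ‖z‖ ^ 2 := rfl
  simp only [metric, christoffel, inner_add_left, inner_add_right, inner_smul_left,
    inner_smul_right, map_mul, Complex.conj_ofReal, c1, c2, hz0, Pi.sub_apply, Pi.mul_apply, Pi.pow_apply]
  clear h hr e lin h1 hz0 c1 c2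
  generalize inner ℂ z v = a₁, inner ℂ z w = a₂, inner ℂ z u = a₃, inner ℂ w v = a₄,
    inner ℂ w u = a₅, inner ℂ v u = a₆, ‖z‖ ^ 2 = N, rho c z = r, c / 4 = k at *
  simp [Complex.mul_re, Complex.mul_im]
  field_simp
  rw [hr']
  ring

section Hypersurface

variable {n : ℕ} {M : Type*} [TopologicalSpace M]
  [ChartedSpace (EuclideanSpace ℝ (Fin (2 * n - 1))) M]

/-- The differential at `p` of a `ℂⁿ`-valued map on `M`. -/
noncomputable def diff (f : M → Coord n) (p : M) :
    TangentSpace (𝓡 (2 * n - 1)) p →L[ℝ] Coord n :=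
  mfderiv (𝓡 (2 * n - 1)) 𝓘(ℝ, Coord n) f p

/-- `f : M → ℂHⁿ(c)` is a smooth immersion of the `(2n-1)`-dimensional manifold `M`, that is, a
real hypersurface, and `ξ` is a smooth unit normal vector field along it. -/
structure IsRealHypersurface (c : ℝ) (f ξ : M → Coord n) : Prop where
  mem_space : ∀ p, f p ∈ space n c
  contMDiff : ContMDiff (𝓡 (2 * n - 1)) 𝓘(ℝ, Coord n) ∞ f
  immersion : ∀ p, Function.Injective (diff f p)
  contMDiff_normal : ContMDiff (𝓡 (2 * n - 1)) 𝓘(ℝ, Coord n) ∞ ξ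
  unit : ∀ p, metric c (f p) (ξ p) (ξ p) = 1
  normal : ∀ p X, metric c (f p) (diff f p X) (ξ p) = 0

/-- The Levi-Civita covariant derivative `∇̄_X V` of a vector field `V` along `f`. -/
noncomputable def covDeriv (c : ℝ) (f V : M → Coord n) (p : M)
    (X : TangentSpace (𝓡 (2 * n - 1)) p) : Coord n :=
  diff V p X + christoffel c (f p) (diff f p X) (V p)

/-- The space `T_ν(p)` of all `X ∈ T_p M` with `S X = ν X`, where `S` is the shape operator. As `ξ`
is a unit field, `∇̄_X ξ` is tangent to `M`, and `S` is given by `S X = -∇̄_X ξ` (where `T_p M` is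
identified with its image under the differential of `f`). -/
noncomputable def principalSpace (c : ℝ) (f ξ : M → Coord n) (p : M) (ν : ℝ) :
    Submodule ℝ (TangentSpace (𝓡 (2 * n - 1)) p) where
  carrier := {X | -covDeriv c f ξ p X = ν • diff f p X}
  add_mem' := by
    intro X Y hX hY
    simp only [Set.mem_ofPred_eq, covDeriv, map_add, christoffel_add_left, smul_add] at *
    rw [← hX, ← hY]; abel
  zero_mem' := by
    have h := christoffel_smul_left c (f p) 0 (ξ p) 0
    simp only [zero_smul] at h
    simp [covDeriv, h]
  smul_mem' := by
    intro t X hX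
    simp only [Set.mem_ofPred_eq, covDeriv, map_smul, christoffel_smul_left] at *
    rw [smul_comm ν t, ← hX, ← smul_add, smul_neg]

/-- The set of principal curvatures of `M` at `p`. -/
def principalCurvatures (c : ℝ) (f ξ : M → Coord n) (p : M) : Set ℝ :=
  {ν | principalSpace c f ξ p ν ≠ ⊥}

/-- `M` has exactly `g` distinct constant principal curvatures, namely `lam 1, …, lam g`. -/
structure HasConstantPrincipalCurvatures (c : ℝ) (f ξ : M → Coord n) (g : ℕ) (lam : ℕ → ℝ) :
    Prop where
  injOn : Set.InjOn lam (Set.Icc 1 g)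
  eq_image : ∀ p, principalCurvatures c f ξ p = lam '' Set.Icc 1 g

/-- The number `h(p)` of principal curvature spaces at `p` onto which the Hopf vector `J ξ_p` has
nonzero orthogonal projection, i.e. to which it is not orthogonal. -/
noncomputable def hopfNumber (c : ℝ) (f ξ : M → Coord n) (p : M) : ℕ :=
  {ν : ℝ | ∃ X ∈ principalSpace c f ξ p ν,
    metric c (f p) (Complex.I • ξ p) (diff f p X) ≠ 0}.ncard

/-- The labelling `lam 1, …, lam g` of the principal curvatures and the unit normal `ξ` are such
that `J ξ = b₁ U₁ + b₂ U₂` with unit vectors `Uᵢ ∈ T_{lam i}` and positive `bᵢ`, the unit vector `A`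
with `J A = b₂ U₁ - b₁ U₂` lies in `T_{lam 3}`, and `lam 1 < lam 2`, `0 ≤ lam 3`. -/
structure IsAdaptedLabelling (c : ℝ) (f ξ : M → Coord n) (g : ℕ) (lam : ℕ → ℝ) : Prop
    extends HasConstantPrincipalCurvatures c f ξ g lam where
  three_le : 3 ≤ g
  lt : lam 1 < lam 2
  nonneg : 0 ≤ lam 3
  frame : ∀ p, ∃ U₁ ∈ principalSpace c f ξ p (lam 1), ∃ U₂ ∈ principalSpace c f ξ p (lam 2),
    ∃ A ∈ principalSpace c f ξ p (lam 3), ∃ b₁ b₂ : ℝ, 0 < b₁ ∧ 0 < b₂ ∧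
      metric c (f p) (diff f p U₁) (diff f p U₁) = 1 ∧
      metric c (f p) (diff f p U₂) (diff f p U₂) = 1 ∧
      metric c (f p) (diff f p A) (diff f p A) = 1 ∧
      Complex.I • ξ p = b₁ • diff f p U₁ + b₂ • diff f p U₂ ∧
      Complex.I • diff f p A = b₂ • diff f p U₁ - b₁ • diff f p U₂

end Hypersurface

end CHn

set_option linter.unusedSectionVars false

namespace CHn

/-! In a chart the hypersurface is its metric, connection, shape operator S and the tangential part
φ of J, bound by the Gauss and Codazzi equations with γ = c/4. Split the Hopf field as u = U + V
with U in T_{l₁} and V in T_{l₂}; put b = |U|² and A = φU. Because ∇S vanishes on each principal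
space (`dS_block`), Codazzi makes A orthogonal to T_{l₁} and T_{l₂}, makes b stationary along both,
and yields for each z in T_κ not orthogonal to A an equation in κ that is linear in b
(`curvature_relation`). Its b-coefficient vanishes only for 2κ = l₁ + l₂. Otherwise b is locally
constant, and then at most one κ is possible (`curvature_unique`). Hence A is locally an eigenfield
with a constant eigenvalue l₃ (`exists_S_A_nhds`). In the exceptional case 2l₃ = l₁ + l₂, b is still
constant because [U, V] is a multiple of A (`fderiv_b_eq_zero`).

With b constant, ∇ is explicit on the span of U, V, A, and the Gauss equation for A and U collapses
to l₁ + l₂ = 3l₃ (`sum_eq`). Writing p = l₁ - l₃ and q = l₂ - l₃, this gives γ = pq - l₃² and pq <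
0.

It remains to treat principal vectors w in T_μ, μ ≠ l₃, orthogonal to U, V, A. Expanding ⟨φ∇_w A,
φw⟩ = 0 (`sum_φ`) and the Gauss equation for A and w (`sum_nabA`) expresses the same factor -pq -
l₃(μ - l₃) through sums of squares weighted by (ν - l₃)/(ν - μ), once with a positive and once with
a negative constant. If 1/(μ - l₃) is extremal, all nonzero weights have the same sign, so the
factor vanishes (`eq_of_extremal`). The minimum and the maximum satisfy the same equation, so μ is
unique and l₃μ = -γ (`mul_eq_of_perpSpec`). Therefore at most one curvature besides l₁, l₂, l₃
exists, and it is -c/(4l₃). If T_{l₂} is more than a line, l₂ itself satisfies l₃l₂ = -γ, which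
forces l₁ = 0 and l₂ = 3l₃.

Globally, the pair {l₁, l₂} is locally constant, hence constant on the connected M. Replacing ξ by
-ξ negates the curvatures, so l₃ = (l₁ + l₂)/3 can be made nonnegative. -/

theorem two_le_infty : (2 : WithTop ℕ∞) ≤ ∞ := WithTop.coe_le_coe.2 (le_top : (2 : ℕ∞) ≤ ⊤)

/-! ### Covariant calculus of a hypersurface in a chart. -/

/-- The intrinsic data of a real hypersurface of a complex space form of constant holomorphic
sectional curvature `4 γ`, read in a chart domain `Ω ⊆ E`: the metric `G`, its Levi-Civita
connection `Γ`, the shape operator `S`, the tangential part `φ` of the complex structure and the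
Hopf vector field `u`, together with the structure equations relating them. -/
structure HypersurfaceChart {E : Type*} [NormedAddCommGroup E] [NormedSpace ℝ E]
    (γ : ℝ) (Ω : Set E) where
  G : E → E →L[ℝ] E →L[ℝ] ℝ
  Γ : E → E →L[ℝ] E →L[ℝ] E
  S : E → E →L[ℝ] E
  φ : E → E →L[ℝ] E
  u : E → E
  isOpen : IsOpen Ω
  contDiffOn_G : ContDiffOn ℝ ∞ G Ω
  contDiffOn_Γ : ContDiffOn ℝ ∞ Γ Ω
  contDiffOn_S : ContDiffOn ℝ ∞ S Ω
  contDiffOn_φ : ContDiffOn ℝ ∞ φ Ω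
  contDiffOn_u : ContDiffOn ℝ ∞ u Ω
  G_comm : ∀ x ∈ Ω, ∀ X Y, G x X Y = G x Y X
  G_pos : ∀ x ∈ Ω, ∀ X, X ≠ 0 → 0 < G x X X
  fderiv_G : ∀ x ∈ Ω, ∀ X Y Z, fderiv ℝ G x X Y Z = G x (Γ x X Y) Z + G x Y (Γ x X Z)
  Γ_comm : ∀ x ∈ Ω, ∀ X Y, Γ x X Y = Γ x Y X
  S_symm : ∀ x ∈ Ω, ∀ X Y, G x (S x X) Y = G x X (S x Y)
  φ_skew : ∀ x ∈ Ω, ∀ X Y, G x (φ x X) Y = - G x X (φ x Y)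
  φ_φ : ∀ x ∈ Ω, ∀ X, φ x (φ x X) = - X + G x (u x) X • u x
  φ_u : ∀ x ∈ Ω, φ x (u x) = 0
  G_u_u : ∀ x ∈ Ω, G x (u x) (u x) = 1
  nabla_u : ∀ x ∈ Ω, ∀ X, fderiv ℝ u x X + Γ x X (u x) = - φ x (S x X)
  nabla_φ : ∀ x ∈ Ω, ∀ X Y, fderiv ℝ φ x X Y + Γ x X (φ x Y) - φ x (Γ x X Y) =
    G x (S x X) Y • u x - G x (u x) Y • S x X
  codazzi : ∀ x ∈ Ω, ∀ X Y,
    (fderiv ℝ S x X Y + Γ x X (S x Y) - S x (Γ x X Y)) -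
    (fderiv ℝ S x Y X + Γ x Y (S x X) - S x (Γ x Y X)) =
    γ • (G x (u x) Y • φ x X - G x (u x) X • φ x Y + (2 * G x (φ x X) Y) • u x)
  gauss : ∀ x ∈ Ω, ∀ X Y Z,
    (fderiv ℝ Γ x X Y Z + Γ x X (Γ x Y Z)) - (fderiv ℝ Γ x Y X Z + Γ x Y (Γ x X Z)) =
    γ • (G x Y Z • X - G x X Z • Y + G x (φ x Y) Z • φ x X - G x (φ x X) Z • φ x Y
      - (2 * G x (φ x X) Y) • φ x Z) + G x (S x Y) Z • S x X - G x (S x X) Z • S x Y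

namespace HypersurfaceChart

variable {E : Type*} [NormedAddCommGroup E] [NormedSpace ℝ E] {γ : ℝ} {Ω : Set E}

/-- The same data on a smaller open set. -/
def restrict (H : HypersurfaceChart γ Ω) {Ω' : Set E} (h : IsOpen Ω') (hs : Ω' ⊆ Ω) :
    HypersurfaceChart γ Ω' where
  G := H.G
  Γ := H.Γ
  S := H.S
  φ := H.φ
  u := H.u
  isOpen := h
  contDiffOn_G := H.contDiffOn_G.mono hs
  contDiffOn_Γ := H.contDiffOn_Γ.mono hs
  contDiffOn_S := H.contDiffOn_S.mono hs
  contDiffOn_φ := H.contDiffOn_φ.mono hs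
  contDiffOn_u := H.contDiffOn_u.mono hs
  G_comm x hx := H.G_comm x (hs hx)
  G_pos x hx := H.G_pos x (hs hx)
  fderiv_G x hx := H.fderiv_G x (hs hx)
  Γ_comm x hx := H.Γ_comm x (hs hx)
  S_symm x hx := H.S_symm x (hs hx)
  φ_skew x hx := H.φ_skew x (hs hx)
  φ_φ x hx := H.φ_φ x (hs hx)
  φ_u x hx := H.φ_u x (hs hx)
  G_u_u x hx := H.G_u_u x (hs hx)
  nabla_u x hx := H.nabla_u x (hs hx)
  nabla_φ x hx := H.nabla_φ x (hs hx)
  codazzi x hx := H.codazzi x (hs hx)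
  gauss x hx := H.gauss x (hs hx)

variable (H : HypersurfaceChart γ Ω)

/-- The covariant derivative `∇_X Y` at `x`. -/
noncomputable def nab (Y : E → E) (x X : E) : E := fderiv ℝ Y x X + H.Γ x X (Y x)

/-- The covariant derivative `(∇_X S) Y` of the shape operator at `x`. -/
noncomputable def dS (x X Y : E) : E :=
  fderiv ℝ H.S x X Y + H.Γ x X (H.S x Y) - H.S x (H.Γ x X Y)

/-- The obstruction to the symmetry of `∇ S` in the Codazzi equation. -/
noncomputable def rho (x X Y : E) : E :=
  γ • (H.G x (H.u x) Y • H.φ x X - H.G x (H.u x) X • H.φ x Y + (2 * H.G x (H.φ x X) Y) • H.u x)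

variable {H}

theorem differentiableAt_of_mem {F : Type*} [NormedAddCommGroup F] [NormedSpace ℝ F] {f : E → F}
    (H : HypersurfaceChart γ Ω) (hf : ContDiffOn ℝ ∞ f Ω) {x : E} (hx : x ∈ Ω) :
    DifferentiableAt ℝ f x :=
  (hf.contDiffAt (H.isOpen.mem_nhds hx)).differentiableAt (by simp)

theorem fderiv_congr_of_mem {F : Type*} [NormedAddCommGroup F] [NormedSpace ℝ F] {f g : E → F}
    (H : HypersurfaceChart γ Ω) (hfg : ∀ y ∈ Ω, f y = g y) {x : E} (hx : x ∈ Ω) :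
    fderiv ℝ f x = fderiv ℝ g x :=
  Filter.EventuallyEq.fderiv_eq (Filter.eventuallyEq_of_mem (H.isOpen.mem_nhds hx) hfg)

section Bilinear

@[simp] theorem nab_add_right (Y : E → E) (x X X' : E) :
    H.nab Y x (X + X') = H.nab Y x X + H.nab Y x X' := by
  simp only [nab, map_add, add_apply]; abel

@[simp] theorem nab_smul_right (Y : E → E) (x X : E) (t : ℝ) :
    H.nab Y x (t • X) = t • H.nab Y x X := by
  simp [nab]

@[simp] theorem nab_neg_right (Y : E → E) (x X : E) :
    H.nab Y x (-X) = - H.nab Y x X := by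
  simpa using nab_smul_right (H := H) Y x X (-1)

@[simp] theorem nab_sub_right (Y : E → E) (x X X' : E) :
    H.nab Y x (X - X') = H.nab Y x X - H.nab Y x X' := by
  simp [sub_eq_add_neg]

@[simp] theorem nab_zero_right (Y : E → E) (x : E) : H.nab Y x 0 = 0 := by
  simp [nab]

end Bilinear

theorem codazzi' {x : E} (hx : x ∈ Ω) (X Y : E) : H.dS x X Y = H.dS x Y X + H.rho x X Y := by
  rw [rho, ← H.codazzi x hx X Y]; simp only [dS]; abel

theorem nab_congr {Y Z : E → E} (h : ∀ y ∈ Ω, Y y = Z y) {x : E} (hx : x ∈ Ω) (X : E) :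
    H.nab Y x X = H.nab Z x X := by
  simp only [nab, H.fderiv_congr_of_mem h hx, h x hx]

theorem nab_add {Y Z : E → E} {x : E} (hY : DifferentiableAt ℝ Y x) (hZ : DifferentiableAt ℝ Z x)
    (X : E) : H.nab (fun y => Y y + Z y) x X = H.nab Y x X + H.nab Z x X := by
  simp only [nab, fderiv_fun_add hY hZ, map_add, add_apply]; abel

theorem nab_smul {f : E → ℝ} {Y : E → E} {x : E} (hf : DifferentiableAt ℝ f x)
    (hY : DifferentiableAt ℝ Y x) (X : E) :
    H.nab (fun y => f y • Y y) x X = fderiv ℝ f x X • Y x + f x • H.nab Y x X := by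
  simp only [nab, fderiv_fun_smul hf hY, map_smul, add_apply, smul_apply,
    ContinuousLinearMap.smulRight_apply, smul_add]; abel

theorem nab_const_smul {Y : E → E} {x : E} (t : ℝ)
    (hY : DifferentiableAt ℝ Y x) (X : E) :
    H.nab (fun y => t • Y y) x X = t • H.nab Y x X := by
  simp [nab, fderiv_fun_const_smul hY]

theorem nab_neg (Y : E → E) (x X : E) : H.nab (fun y => - Y y) x X = - H.nab Y x X := by
  simp [nab, fderiv_fun_neg]; abel

theorem nab_sub {Y Z : E → E} {x : E} (hY : DifferentiableAt ℝ Y x) (hZ : DifferentiableAt ℝ Z x)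
    (X : E) : H.nab (fun y => Y y - Z y) x X = H.nab Y x X - H.nab Z x X := by
  simp only [nab, fderiv_fun_sub hY hZ, map_sub, sub_apply]; abel

theorem fderiv_G_apply {Y Z : E → E} {x : E} (hx : x ∈ Ω) (hY : DifferentiableAt ℝ Y x)
    (hZ : DifferentiableAt ℝ Z x) (X : E) :
    fderiv ℝ (fun y => H.G y (Y y) (Z y)) x X =
      H.G x (H.nab Y x X) (Z x) + H.G x (Y x) (H.nab Z x X) := by
  have hG := H.differentiableAt_of_mem H.contDiffOn_G hx
  rw [fderiv_clm_apply (hG.clm_apply hY) hZ, fderiv_clm_apply hG hY]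
  simp [nab, H.fderiv_G x hx]; ring

theorem nab_S {Y : E → E} {x : E} (hx : x ∈ Ω) (hY : DifferentiableAt ℝ Y x) (X : E) :
    H.nab (fun y => H.S y (Y y)) x X = H.dS x X (Y x) + H.S x (H.nab Y x X) := by
  have hS := H.differentiableAt_of_mem H.contDiffOn_S hx
  simp only [nab, dS, fderiv_clm_apply hS hY]
  simp; abel

theorem nab_φ {Y : E → E} {x : E} (hx : x ∈ Ω) (hY : DifferentiableAt ℝ Y x) (X : E) :
    H.nab (fun y => H.φ y (Y y)) x X = H.φ x (H.nab Y x X) + H.G x (H.S x X) (Y x) • H.u x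
      - H.G x (H.u x) (Y x) • H.S x X := by
  have hφ := H.differentiableAt_of_mem H.contDiffOn_φ hx
  have := H.nabla_φ x hx X (Y x)
  rw [add_sub_assoc, ← this]
  simp only [nab, fderiv_clm_apply hφ hY]
  simp; abel

theorem nab_u {x : E} (hx : x ∈ Ω) (X : E) : H.nab H.u x X = - H.φ x (H.S x X) :=
  H.nabla_u x hx X

/-- `∇ S` at an eigenfield. -/
theorem dS_eigenfield {Y : E → E} {ν : ℝ} (hν : ∀ y ∈ Ω, H.S y (Y y) = ν • Y y) {x : E}
    (hx : x ∈ Ω) (hY : DifferentiableAt ℝ Y x) (X : E) :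
    H.dS x X (Y x) = ν • H.nab Y x X - H.S x (H.nab Y x X) := by
  rw [eq_sub_iff_add_eq, ← nab_S hx hY, nab_congr hν hx, nab_const_smul _ hY]

theorem nab_const (Y x X : E) : H.nab (fun _ => Y) x X = H.Γ x X Y := by
  simp [nab]

/-- `∇_X S` is self-adjoint. -/
theorem dS_symm {x : E} (hx : x ∈ Ω) (X Y Z : E) :
    H.G x (H.dS x X Y) Z = H.G x (H.dS x X Z) Y := by
  have hS := H.differentiableAt_of_mem H.contDiffOn_S hx
  have dS' : ∀ Y : E, DifferentiableAt ℝ (fun y => H.S y Y) x :=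
    fun Y => hS.clm_apply (differentiableAt_const Y)
  have key : fderiv ℝ (fun y => H.G y (H.S y Y) Z) x X = fderiv ℝ (fun y => H.G y (H.S y Z) Y) x X
    := by
    rw [H.fderiv_congr_of_mem (fun y hy => ?_) hx]
    rw [H.S_symm y hy, H.G_comm y hy]
  rw [fderiv_G_apply hx (dS' Y) (differentiableAt_const Z),
    fderiv_G_apply hx (dS' Z) (differentiableAt_const Y),
    nab_S hx (differentiableAt_const _), nab_S hx (differentiableAt_const _)] at key
  simp only [nab_const, map_add, add_apply, H.S_symm x hx] at key
  rw [H.G_comm x hx _ (H.S x Z), H.G_comm x hx _ (H.S x Y), H.S_symm x hx, H.S_symm x hx,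
    H.G_comm x hx _ (H.S x _), H.G_comm x hx _ (H.S x _), H.S_symm x hx, H.S_symm x hx] at key
  linarith

/-- Torsion-freeness: the second derivatives of a function commute. -/
theorem fderiv_bracket {f : E → ℝ} (hf : ContDiffOn ℝ ∞ f Ω) {X Y : E → E} {x : E} (hx : x ∈ Ω)
    (hX : DifferentiableAt ℝ X x) (hY : DifferentiableAt ℝ Y x) :
    fderiv ℝ f x (H.nab Y x (X x) - H.nab X x (Y x)) =
      fderiv ℝ (fun y => fderiv ℝ f y (Y y)) x (X x) -
      fderiv ℝ (fun y => fderiv ℝ f y (X y)) x (Y x) := by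
  have hfx := hf.contDiffAt (H.isOpen.mem_nhds hx)
  have hd : DifferentiableAt ℝ (fderiv ℝ f) x :=
    H.differentiableAt_of_mem (hf.fderiv_of_isOpen H.isOpen (m := ∞) (by simp)) hx
  have hs : IsSymmSndFDerivAt ℝ f x := hfx.isSymmSndFDerivAt (by simpa using two_le_infty)
  rw [fderiv_clm_apply hd hY, fderiv_clm_apply hd hX]
  simp [nab, H.Γ_comm x hx (X x) (Y x), hs.eq (X x) (Y x)]

/-- The curvature of `∇`, evaluated on vector fields. -/
theorem ricci_identity {X Y Z : E → E} (hX : ContDiffOn ℝ ∞ X Ω) (hY : ContDiffOn ℝ ∞ Y Ω)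
    (hZ : ContDiffOn ℝ ∞ Z Ω) {x : E} (hx : x ∈ Ω) :
    H.nab (fun y => H.nab Z y (Y y)) x (X x) - H.nab (fun y => H.nab Z y (X y)) x (Y x)
      - H.nab Z x (H.nab Y x (X x) - H.nab X x (Y x)) =
    γ • (H.G x (Y x) (Z x) • X x - H.G x (X x) (Z x) • Y x
      + H.G x (H.φ x (Y x)) (Z x) • H.φ x (X x) - H.G x (H.φ x (X x)) (Z x) • H.φ x (Y x)
      - (2 * H.G x (H.φ x (X x)) (Y x)) • H.φ x (Z x))
      + H.G x (H.S x (Y x)) (Z x) • H.S x (X x) - H.G x (H.S x (X x)) (Z x) • H.S x (Y x) := by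
  have hZx := hZ.contDiffAt (H.isOpen.mem_nhds hx)
  have hd : DifferentiableAt ℝ (fderiv ℝ Z) x :=
    H.differentiableAt_of_mem (hZ.fderiv_of_isOpen H.isOpen (m := ∞) (by simp)) hx
  have hs : IsSymmSndFDerivAt ℝ Z x := hZx.isSymmSndFDerivAt (by simpa using two_le_infty)
  have dX := H.differentiableAt_of_mem hX hx
  have dY := H.differentiableAt_of_mem hY hx
  have dZ := H.differentiableAt_of_mem hZ hx
  have dΓ := H.differentiableAt_of_mem H.contDiffOn_Γ hx
  rw [← H.gauss x hx]
  simp only [nab]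
  rw [fderiv_fun_add (hd.clm_apply dY) ((dΓ.clm_apply dY).clm_apply dZ),
    fderiv_fun_add (hd.clm_apply dX) ((dΓ.clm_apply dX).clm_apply dZ),
    fderiv_clm_apply hd dY, fderiv_clm_apply hd dX, fderiv_clm_apply (dΓ.clm_apply dY) dZ,
    fderiv_clm_apply (dΓ.clm_apply dX) dZ, fderiv_clm_apply dΓ dY, fderiv_clm_apply dΓ dX]
  simp [hs.eq (X x) (Y x), H.Γ_comm x hx (X x) (Y x)]
  abel

theorem contDiffOn_nab {X Y : E → E} (hX : ContDiffOn ℝ ∞ X Ω) (hY : ContDiffOn ℝ ∞ Y Ω) :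
    ContDiffOn ℝ ∞ (fun y => H.nab Y y (X y)) Ω := by
  have h1 : ContDiffOn ℝ ∞ (fderiv ℝ Y) Ω := hY.fderiv_of_isOpen H.isOpen (by simp)
  exact (h1.clm_apply hX).add ((H.contDiffOn_Γ.clm_apply hX).clm_apply hY)

end HypersurfaceChart
end CHn

/-! ### Spectral projections of the shape operator. -/

namespace CHn

open Polynomial in
theorem aeval_apply_of_eigenvector {E : Type*} [NormedAddCommGroup E] [NormedSpace ℝ E]
    {T : E →L[ℝ] E} {v : E} {ν : ℝ} (h : T v = ν • v) (p : ℝ[X]) :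
    aeval T p v = p.eval ν • v := by
  induction p using Polynomial.induction_on' with
  | add p q hp hq => simp [hp, hq, add_smul]
  | monomial n a =>
    have : ∀ n : ℕ, (T ^ n) v = ν ^ n • v := by
      intro n
      induction n with
      | zero => simp
      | succ n ih => rw [pow_succ', mul_apply_eq_comp, ih, map_smul, h, smul_smul,
          pow_succ]
    simp [aeval_monomial, this, Algebra.algebraMap_eq_smul_one, smul_smul]

/-- The eigenspaces of an operator that is self-adjoint for a positive definite form span. -/
theorem iSup_eigenspace_of_form {E : Type*} [AddCommGroup E] [Module ℝ E] [FiniteDimensional ℝ E]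
    (B : E → E → ℝ) (hadd : ∀ X Y Z, B (X + Y) Z = B X Z + B Y Z)
    (hsmul : ∀ (t : ℝ) X Y, B (t • X) Y = t * B X Y) (hcomm : ∀ X Y, B X Y = B Y X)
    (hpos : ∀ X, X ≠ 0 → 0 < B X X) (T : E →ₗ[ℝ] E) (hT : ∀ X Y, B (T X) Y = B X (T Y)) :
    ⨆ ν, Module.End.eigenspace T ν = ⊤ := by
  have h0 : ∀ X, B 0 X = 0 := fun X => by simpa using hsmul 0 0 X
  let cd : InnerProductSpace.Core ℝ E :=
    { inner := B
      conj_inner_symm := fun x y => by simp [hcomm y x]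
      re_inner_nonneg := fun x => by
        rcases eq_or_ne x 0 with rfl | hx
        · simp [h0]
        · simpa using (hpos x hx).le
      add_left := hadd
      smul_left := fun x y r => by simp [hsmul]
      definite := fun x hx => by
        by_contra hne
        exact (hpos x hne).ne' hx }
  -- The norm comes from `B` itself; `E` is assumed to be only a real vector space so that no other
  -- norm competes with it.
  let _ : NormedAddCommGroup E := cd.toNormedAddCommGroup
  let _ : InnerProductSpace ℝ E := InnerProductSpace.ofCore cd.toCore
  have hs : T.IsSymmetric := hT
  have := hs.orthogonalComplement_iSup_eigenspaces_eq_bot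
  rwa [Submodule.orthogonal_eq_bot_iff] at this

namespace HypersurfaceChart

variable {E : Type*} [NormedAddCommGroup E] [NormedSpace ℝ E] {γ : ℝ}
  {Ω : Set E} {H : HypersurfaceChart γ Ω} {Λ : Finset ℝ}

/-- All principal curvatures belong to the finite set `Λ`. -/
def SpectrumIn (H : HypersurfaceChart γ Ω) (Λ : Finset ℝ) : Prop :=
  ∀ x ∈ Ω, ∀ v ≠ 0, ∀ ν : ℝ, H.S x v = ν • v → ν ∈ Λ

/-- The projection onto the principal curvature space of `ν`, as a polynomial in `S`. -/
noncomputable def proj (H : HypersurfaceChart γ Ω) (Λ : Finset ℝ) (ν : ℝ) (x : E) : E →L[ℝ] E :=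
  Polynomial.aeval (H.S x) (Lagrange.basis Λ id ν)

/-- The nodes `Λ` do not depend on the point, so the projection is one fixed polynomial in `S` and
inherits its smoothness. This is how constancy of the principal curvatures produces smooth
eigenfields. -/
theorem contDiffOn_proj (ν : ℝ) : ContDiffOn ℝ ∞ (H.proj Λ ν) Ω := by
  have hpow : ∀ n : ℕ, ContDiffOn ℝ ∞ (fun x => H.S x ^ n) Ω := by
    intro n
    induction n with
    | zero => simpa using contDiffOn_const
    | succ n ih =>
      simp only [pow_succ]
      exact ih.clm_comp H.contDiffOn_S
  unfold proj
  simp only [Polynomial.aeval_eq_sum_range]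
  exact ContDiffOn.sum fun i _ => (hpow i).const_smul _

theorem proj_of_eigen {ν : ℝ} (hν : ν ∈ Λ) {x v : E} (h : H.S x v = ν • v) :
    H.proj Λ ν x v = v := by
  rw [proj, aeval_apply_of_eigenvector h]
  have := Lagrange.eval_basis_self (s := Λ) (v := id) (i := ν) (Set.injOn_id _) hν
  simp only [id] at this
  rw [this, one_smul]

theorem proj_of_eigen_ne {ν κ : ℝ} (hκ : κ ∈ Λ) (hne : ν ≠ κ) {x v : E}
    (h : H.S x v = κ • v) : H.proj Λ ν x v = 0 := by
  rw [proj, aeval_apply_of_eigenvector h]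
  have := Lagrange.eval_basis_of_ne (s := Λ) (v := id) (i := ν) (j := κ) hne hκ
  simp only [id] at this
  rw [this, zero_smul]

theorem G_smul_left (x X Y : E) (t : ℝ) : H.G x (t • X) Y = t * H.G x X Y := by simp

theorem G_eigen_ne {ν κ : ℝ} (hne : ν ≠ κ) {x : E} (hx : x ∈ Ω) {v w : E}
    (hv : H.S x v = ν • v) (hw : H.S x w = κ • w) : H.G x v w = 0 := by
  have h := H.S_symm x hx v w
  rw [hv, hw] at h
  simp only [map_smul, smul_apply, smul_eq_mul] at h
  have : (ν - κ) * H.G x v w = 0 := by linear_combination h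
  exact (mul_eq_zero.1 this).resolve_left (sub_ne_zero.2 hne)

/-- On an eigenfield, (∇_X S)Y = (ν - S)∇_X Y. This turns each instance of Codazzi on eigenvectors
into a linear equation for components of ∇. -/
theorem G_dS_eigenfield {Y : E → E} {ν κ : ℝ} (hν : ∀ y ∈ Ω, H.S y (Y y) = ν • Y y) {x : E}
    (hx : x ∈ Ω) (hY : DifferentiableAt ℝ Y x) (X : E) {z : E} (hz : H.S x z = κ • z) :
    H.G x (H.dS x X (Y x)) z = (ν - κ) * H.G x (H.nab Y x X) z := by
  rw [dS_eigenfield hν hx hY, map_sub, sub_apply, H.S_symm x hx, hz]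
  simp; ring

theorem G_codazzi (H : HypersurfaceChart γ Ω) {x : E} (hx : x ∈ Ω) (X Y Z : E) :
    H.G x (H.dS x X Y) Z = H.G x (H.dS x Y X) Z +
    γ * (H.G x (H.u x) Y * H.G x (H.φ x X) Z - H.G x (H.u x) X * H.G x (H.φ x Y) Z
      + 2 * H.G x (H.φ x X) Y * H.G x (H.u x) Z) := by
  rw [codazzi' hx X Y, map_add, add_apply]
  simp [rho]; ring

variable [FiniteDimensional ℝ E]

theorem eigen_induction {x : E} (hx : x ∈ Ω) {p : E → Prop}
    (hv : ∀ (ν : ℝ) (v : E), H.S x v = ν • v → p v) (hadd : ∀ v w, p v → p w → p (v + w)) (v : E) :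
    p v := by
  have htop := iSup_eigenspace_of_form (fun X Y => H.G x X Y) (by simp) (by simp)
    (H.G_comm x hx) (H.G_pos x hx) (H.S x : E →ₗ[ℝ] E) (H.S_symm x hx)
  have hm : v ∈ ⨆ ν, Module.End.eigenspace (H.S x : E →ₗ[ℝ] E) ν := htop ▸ Submodule.mem_top
  refine Submodule.iSup_induction (motive := p) _ hm ?_ (hv 0 0 (by simp)) hadd
  intro ν w hw
  exact hv ν w (Module.End.mem_eigenspace_iff.1 hw)

theorem eq_zero_of_forall_eigen {x : E} (hx : x ∈ Ω) {v : E}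
    (h : ∀ (ν : ℝ) (z : E), H.S x z = ν • z → H.G x v z = 0) : v = 0 := by
  by_contra hne
  have : ∀ w, H.G x v w = 0 :=
    eigen_induction hx h fun v w hv hw => by rw [map_add, hv, hw, add_zero]
  exact (H.G_pos x hx v hne).ne' (this v)

theorem eq_of_forall_eigen {x : E} (hx : x ∈ Ω) {v w : E}
    (h : ∀ (ν : ℝ) (z : E), H.S x z = ν • z → H.G x v z = H.G x w z) : v = w := by
  refine sub_eq_zero.1 (eq_zero_of_forall_eigen (H := H) hx fun ν z hz => ?_)
  rw [map_sub, sub_apply, h ν z hz, sub_self]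

theorem S_proj (hΛ : H.SpectrumIn Λ) {x : E} (hx : x ∈ Ω) (ν : ℝ) (v : E) :
    H.S x (H.proj Λ ν x v) = ν • H.proj Λ ν x v := by
  refine eigen_induction (H := H) hx (p := fun v => H.S x (H.proj Λ ν x v) = ν • H.proj Λ ν x v) ?_ ?_ v
  · intro κ v hv
    rcases eq_or_ne v 0 with rfl | h0
    · simp
    have hκ := hΛ x hx v h0 κ hv
    rcases eq_or_ne ν κ with rfl | hne
    · rw [proj_of_eigen hκ hv, hv]
    · rw [proj_of_eigen_ne hκ hne hv, map_zero, smul_zero]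
  · intro v w hv hw
    simp only [map_add, hv, hw, smul_add]

theorem sum_proj (hΛ : H.SpectrumIn Λ) {x : E} (hx : x ∈ Ω) (v : E) :
    ∑ ν ∈ Λ, H.proj Λ ν x v = v := by
  refine eigen_induction (H := H) hx (p := fun v => ∑ ν ∈ Λ, H.proj Λ ν x v = v) ?_ ?_ v
  · intro κ v hv
    rcases eq_or_ne v 0 with rfl | h0
    · simp
    have hκ := hΛ x hx v h0 κ hv
    rw [Finset.sum_eq_single_of_mem κ hκ fun ν _ hne => proj_of_eigen_ne hκ hne hv,
      proj_of_eigen hκ hv]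
  · intro v w hv hw
    simp only [map_add, Finset.sum_add_distrib, hv, hw]

theorem G_eq_sum_proj (hΛ : H.SpectrumIn Λ) {x : E} (hx : x ∈ Ω) (v w : E) :
    H.G x v w = ∑ ν ∈ Λ, H.G x v (H.proj Λ ν x w) := by
  rw [← map_sum, sum_proj hΛ hx]

theorem G_proj_of_eigen (hΛ : H.SpectrumIn Λ) {x : E} (hx : x ∈ Ω) {ν : ℝ} (hν : ν ∈ Λ) {z : E}
    (hz : H.S x z = ν • z) (v : E) : H.G x v z = H.G x (H.proj Λ ν x v) z := by
  conv_lhs => rw [← sum_proj hΛ hx v]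
  rw [map_sum, sum_apply, Finset.sum_eq_single_of_mem ν hν]
  intro κ hκ hne
  exact G_eigen_ne hne hx (S_proj hΛ hx κ v) hz

/-- `∇ S` vanishes on each principal curvature space. -/
theorem dS_block (hΛ : H.SpectrumIn Λ) {x : E} (hx : x ∈ Ω) {ν : ℝ} {v w : E}
    (hv : H.S x v = ν • v) (hw : H.S x w = ν • w) (X : E) : H.G x (H.dS x X v) w = 0 := by
  rcases eq_or_ne v 0 with rfl | h0
  · rw [dS_symm hx]; simp
  have hν := hΛ x hx v h0 ν hv
  -- The projection extends the single vector `v` to an eigenfield for the same constant eigenvalue.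
  have hd : DifferentiableAt ℝ (fun y => H.proj Λ ν y v) x :=
    H.differentiableAt_of_mem ((contDiffOn_proj ν).clm_apply contDiffOn_const) hx
  have := dS_eigenfield (H := H) (Y := fun y => H.proj Λ ν y v)
    (fun y hy => S_proj hΛ hy ν v) hx hd X
  rw [proj_of_eigen hν hv] at this
  rw [this, map_sub, sub_apply, H.S_symm x hx, hw]
  simp

end HypersurfaceChart
end CHn

/-! ### Splitting the Hopf field: first consequences of Codazzi. -/

namespace CHn
namespace HypersurfaceChart

variable {E : Type*} [NormedAddCommGroup E] [NormedSpace ℝ E]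
  {γ : ℝ} {Ω : Set E} {H : HypersurfaceChart γ Ω} {Λ : Finset ℝ} {l₁ l₂ : ℝ} {U V : E → E}

theorem G_φ_self {x : E} (hx : x ∈ Ω) (z : E) : H.G x (H.φ x z) z = 0 := by
  have := H.φ_skew x hx z z
  rw [H.G_comm x hx z] at this
  linarith

theorem G_φ_comm {x : E} (hx : x ∈ Ω) (z w : E) : H.G x (H.φ x z) w = - H.G x (H.φ x w) z := by
  rw [H.φ_skew x hx, H.G_comm x hx z]

/-- The Hopf vector field is the sum `U + V` of two nonzero eigenfields of the shape operator. -/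
structure IsHopfSplit (H : HypersurfaceChart γ Ω) (Λ : Finset ℝ) (l₁ l₂ : ℝ) (U V : E → E) :
    Prop where
  spec : H.SpectrumIn Λ
  neg : γ < 0
  ne : l₁ ≠ l₂
  smooth_U : ContDiffOn ℝ ∞ U Ω
  smooth_V : ContDiffOn ℝ ∞ V Ω
  S_U : ∀ x ∈ Ω, H.S x (U x) = l₁ • U x
  S_V : ∀ x ∈ Ω, H.S x (V x) = l₂ • V x
  add : ∀ x ∈ Ω, U x + V x = H.u x
  U_ne : ∀ x ∈ Ω, U x ≠ 0
  V_ne : ∀ x ∈ Ω, V x ≠ 0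

namespace IsHopfSplit

/-- The two summands play symmetric roles, so each result for `U` yields one for `V`. Under the
exchange b becomes 1 - b and φU becomes φV = -φU. -/
theorem swap (h : H.IsHopfSplit Λ l₁ l₂ U V) : H.IsHopfSplit Λ l₂ l₁ V U where
  spec := h.spec
  neg := h.neg
  ne := h.ne.symm
  smooth_U := h.smooth_V
  smooth_V := h.smooth_U
  S_U := h.S_V
  S_V := h.S_U
  add x hx := by rw [add_comm, h.add x hx]
  U_ne := h.V_ne
  V_ne := h.U_ne

theorem restrict (h : H.IsHopfSplit Λ l₁ l₂ U V) {Ω' : Set E} (ho : IsOpen Ω') (hs : Ω' ⊆ Ω) :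
    (H.restrict ho hs).IsHopfSplit Λ l₁ l₂ U V where
  spec x hx := h.spec x (hs hx)
  neg := h.neg
  ne := h.ne
  smooth_U := h.smooth_U.mono hs
  smooth_V := h.smooth_V.mono hs
  S_U x hx := h.S_U x (hs hx)
  S_V x hx := h.S_V x (hs hx)
  add x hx := h.add x (hs hx)
  U_ne x hx := h.U_ne x (hs hx)
  V_ne x hx := h.V_ne x (hs hx)

variable (h : H.IsHopfSplit Λ l₁ l₂ U V) {x : E} (hx : x ∈ Ω)
include h hx

theorem dU : DifferentiableAt ℝ U x := H.differentiableAt_of_mem h.smooth_U hx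

theorem dV : DifferentiableAt ℝ V x := H.differentiableAt_of_mem h.smooth_V hx

theorem G_U_V : H.G x (U x) (V x) = 0 := G_eigen_ne h.ne hx (h.S_U x hx) (h.S_V x hx)

theorem G_V_U : H.G x (V x) (U x) = 0 := G_eigen_ne h.ne.symm hx (h.S_V x hx) (h.S_U x hx)

theorem G_u_U : H.G x (H.u x) (U x) = H.G x (U x) (U x) := by
  rw [← h.add x hx]; simp [h.G_V_U hx]

theorem G_u_V : H.G x (H.u x) (V x) = H.G x (V x) (V x) := by
  rw [← h.add x hx]; simp [h.G_U_V hx]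

theorem G_V_V : H.G x (V x) (V x) = 1 - H.G x (U x) (U x) := by
  have := H.G_u_u x hx
  rw [← h.add x hx] at this
  simp [h.G_U_V hx, h.G_V_U hx] at this
  linarith

theorem b_pos : 0 < H.G x (U x) (U x) := H.G_pos x hx _ (h.U_ne x hx)

theorem b_lt_one : H.G x (U x) (U x) < 1 := by
  have := h.G_V_V hx
  have := H.G_pos x hx _ (h.V_ne x hx)
  linarith

theorem φ_V : H.φ x (V x) = - H.φ x (U x) := by
  have := H.φ_u x hx
  rw [← h.add x hx, map_add] at this
  exact eq_neg_of_add_eq_zero_right this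

theorem φ_φ_U : H.φ x (H.φ x (U x)) =
    H.G x (U x) (U x) • V x - (1 - H.G x (U x) (U x)) • U x := by
  rw [H.φ_φ x hx, h.G_u_U hx, ← h.add x hx]; module

theorem G_u_of_eigen {κ : ℝ} (h1 : κ ≠ l₁) (h2 : κ ≠ l₂) {z : E} (hz : H.S x z = κ • z) :
    H.G x (H.u x) z = 0 := by
  rw [← h.add x hx, map_add, add_apply, G_eigen_ne h1.symm hx (h.S_U x hx) hz,
    G_eigen_ne h2.symm hx (h.S_V x hx) hz, add_zero]

theorem G_u_of_eigen_left {z : E} (hz : H.S x z = l₁ • z) :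
    H.G x (H.u x) z = H.G x (U x) z := by
  rw [← h.add x hx, map_add, add_apply, G_eigen_ne h.ne.symm hx (h.S_V x hx) hz, add_zero]

theorem nab_add' (X : E) : H.nab U x X + H.nab V x X = - H.φ x (H.S x X) := by
  rw [← nab_add (h.dU hx) (h.dV hx), nab_congr h.add hx, nab_u hx]

theorem G_nab_add (X Z : E) : H.G x (H.nab U x X) Z + H.G x (H.nab V x X) Z =
    - H.G x (H.φ x (H.S x X)) Z := by
  rw [← add_apply, ← map_add, h.nab_add' hx]; simp

theorem G_nab_V_U (X : E) : H.G x (H.nab V x X) (U x) = - H.G x (H.nab U x X) (V x) := by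
  have := fderiv_G_apply (H := H) hx (h.dU hx) (h.dV hx) X
  rw [H.fderiv_congr_of_mem (g := fun _ => (0 : ℝ)) (fun y hy => h.G_U_V hy) hx] at this
  simp at this
  rw [H.G_comm x hx (U x)] at this
  linarith

theorem fderiv_b (X : E) : fderiv ℝ (fun y => H.G y (U y) (U y)) x X =
    2 * H.G x (H.nab U x X) (U x) := by
  rw [fderiv_G_apply hx (h.dU hx) (h.dU hx), H.G_comm x hx (U x)]; ring

theorem G_dS_U (X : E) {κ : ℝ} {z : E} (hz : H.S x z = κ • z) :
    H.G x (H.dS x X (U x)) z = (l₁ - κ) * H.G x (H.nab U x X) z :=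
  G_dS_eigenfield h.S_U hx (h.dU hx) X hz

variable [FiniteDimensional ℝ E]

/-- In the Codazzi equation for X and U tested on U, both derivative terms lie in the block of l₁
and vanish; the curvature term left over is a nonzero multiple of ⟨φU, X⟩. -/
theorem G_φ_U_left {X : E} (hX : H.S x X = l₁ • X) : H.G x (H.φ x (U x)) X = 0 := by
  have e := G_codazzi H hx X (U x) (U x)
  rw [dS_block h.spec hx (h.S_U x hx) (h.S_U x hx), G_φ_self hx, h.G_u_U hx,
    dS_block h.spec hx hX (h.S_U x hx), G_φ_comm hx X] at e
  have hb := h.b_pos hx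
  have hγ := h.neg.ne
  have : γ * (3 * H.G x (U x) (U x)) * H.G x (H.φ x (U x)) X = 0 := by linear_combination e
  have h3 : γ * (3 * H.G x (U x) (U x)) ≠ 0 := by positivity
  exact (mul_eq_zero.1 this).resolve_left h3

theorem G_φ_U_right {X : E} (hX : H.S x X = l₂ • X) : H.G x (H.φ x (U x)) X = 0 := by
  have := h.swap.G_φ_U_left hx hX
  rw [h.φ_V hx] at this
  simpa using this

/-- Codazzi for X and V tested on U: the block property and `G_φ_U_left` remove everything except
(l₁ - l₂)⟨∇_X U, V⟩. -/
theorem G_nab_U_V_left {X : E} (hX : H.S x X = l₁ • X) : H.G x (H.nab U x X) (V x) = 0 := by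
  have e1 := h.G_dS_U hx X (h.S_V x hx)
  rw [dS_symm hx, G_codazzi H hx X (V x) (U x),
    dS_block h.spec hx hX (h.S_U x hx), G_φ_comm hx X (U x), h.G_φ_U_left hx hX,
    h.φ_V hx, G_φ_comm hx X (V x), h.φ_V hx] at e1
  simp only [map_neg, neg_apply, G_φ_self hx, h.G_φ_U_left hx hX] at e1
  have : (l₁ - l₂) * H.G x (H.nab U x X) (V x) = 0 := by linear_combination -e1
  exact (mul_eq_zero.1 this).resolve_left (sub_ne_zero.2 h.ne)

/-- Pairing ∇_X U + ∇_X V = -φSX with U transfers the vanishing of the V-component; the result is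
half the derivative of |U|² along X. -/
theorem G_nab_U_U_left {X : E} (hX : H.S x X = l₁ • X) : H.G x (H.nab U x X) (U x) = 0 := by
  have e := h.G_nab_add hx X (U x)
  rw [h.G_nab_V_U hx, h.G_nab_U_V_left hx hX, hX, map_smul, G_smul_left, G_φ_comm hx,
    h.G_φ_U_left hx hX] at e
  simpa using e

theorem G_nab_U_V_right {X : E} (hX : H.S x X = l₂ • X) : H.G x (H.nab U x X) (V x) = 0 := by
  have e := h.swap.G_nab_U_V_left hx hX
  rw [h.G_nab_V_U hx] at e
  linarith

theorem G_nab_U_U_right {X : E} (hX : H.S x X = l₂ • X) : H.G x (H.nab U x X) (U x) = 0 := by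
  have e := h.G_nab_add hx X (U x)
  rw [h.G_nab_V_U hx, h.G_nab_U_V_right hx hX, hX, map_smul, G_smul_left, G_φ_comm hx,
    h.G_φ_U_right hx hX] at e
  simpa using e

theorem fderiv_b_left {X : E} (hX : H.S x X = l₁ • X) :
    fderiv ℝ (fun y => H.G y (U y) (U y)) x X = 0 := by
  rw [h.fderiv_b hx, h.G_nab_U_U_left hx hX, mul_zero]

theorem fderiv_b_right {X : E} (hX : H.S x X = l₂ • X) :
    fderiv ℝ (fun y => H.G y (U y) (U y)) x X = 0 := by
  rw [h.fderiv_b hx, h.G_nab_U_U_right hx hX, mul_zero]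

theorem G_nab_V_U_left {X : E} (hX : H.S x X = l₁ • X) : H.G x (H.nab V x (U x)) X = 0 := by
  have e1 := h.swap.G_dS_U hx (U x) hX
  rw [dS_symm hx, G_codazzi H hx (U x) X (V x), dS_symm hx, h.swap.G_dS_U hx X (h.S_U x hx),
    h.G_nab_V_U hx, h.G_nab_U_V_left hx hX, h.G_φ_U_left hx hX, G_φ_comm hx X (V x), h.φ_V hx,
    G_φ_comm hx, h.φ_V hx] at e1
  simp only [map_neg, neg_apply, G_φ_self hx, h.G_φ_U_left hx hX] at e1
  have : (l₂ - l₁) * H.G x (H.nab V x (U x)) X = 0 := by linear_combination -e1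
  exact (mul_eq_zero.1 this).resolve_left (sub_ne_zero.2 h.ne.symm)

theorem G_nab_U_U_left' {X : E} (hX : H.S x X = l₁ • X) : H.G x (H.nab U x (U x)) X = 0 := by
  have e := h.G_nab_add hx (U x) X
  rw [h.G_nab_V_U_left hx hX, h.S_U x hx, map_smul, G_smul_left, h.G_φ_U_left hx hX] at e
  linarith

theorem G_nab_U_U_right' {X : E} (hX : H.S x X = l₂ • X) : H.G x (H.nab U x (U x)) X = 0 := by
  have e1 := h.G_dS_U hx (U x) hX
  rw [dS_symm hx, G_codazzi H hx (U x) X (U x), dS_block h.spec hx (h.S_U x hx) (h.S_U x hx),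
    h.G_φ_U_right hx hX, G_φ_comm hx X (U x), h.G_φ_U_right hx hX, G_φ_self hx] at e1
  have : (l₁ - l₂) * H.G x (H.nab U x (U x)) X = 0 := by linear_combination -e1
  exact (mul_eq_zero.1 this).resolve_left (sub_ne_zero.2 h.ne)

section Coefficients

variable {κ : ℝ} (h1 : κ ≠ l₁) (h2 : κ ≠ l₂) {z : E} (hz : H.S x z = κ • z)
include h1 h2 hz

theorem G_nab_U_U : (l₁ - κ) * H.G x (H.nab U x (U x)) z =
    3 * γ * H.G x (U x) (U x) * H.G x (H.φ x (U x)) z := by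
  rw [← h.G_dS_U hx _ hz, dS_symm hx, G_codazzi H hx, dS_block h.spec hx (h.S_U x hx) (h.S_U x hx),
    h.G_u_of_eigen hx h1 h2 hz, h.G_u_U hx, G_φ_comm hx z]
  ring

theorem G_nab_V_V : (l₂ - κ) * H.G x (H.nab V x (V x)) z =
    -3 * γ * (1 - H.G x (U x) (U x)) * H.G x (H.φ x (U x)) z := by
  rw [h.swap.G_nab_U_U hx h2 h1 hz, h.G_V_V hx, h.φ_V hx]
  simp

omit h1 h2 hz in
theorem G_nab_V_U_eq : H.G x (H.nab V x (U x)) z =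
    - l₁ * H.G x (H.φ x (U x)) z - H.G x (H.nab U x (U x)) z := by
  have := h.G_nab_add hx (U x) z
  rw [h.S_U x hx, map_smul, G_smul_left] at this
  linarith

omit h1 h2 hz in
theorem G_nab_U_V_eq : H.G x (H.nab U x (V x)) z =
    l₂ * H.G x (H.φ x (U x)) z - H.G x (H.nab V x (V x)) z := by
  have := h.G_nab_add hx (V x) z
  rw [h.S_V x hx, map_smul, G_smul_left, h.φ_V hx] at this
  simp at this
  linarith

/-- Codazzi for z and U tested on V. Together with its mirror image `codazzi_z_V_U` it gives two
equations sharing the unknown ⟨∇_z U, V⟩. -/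
theorem codazzi_z_U_V : (l₁ - l₂) * H.G x (H.nab U x z) (V x) -
    (l₂ - κ) * H.G x (H.nab V x (U x)) z =
    -γ * H.G x (H.φ x (U x)) z * (2 - 3 * H.G x (U x) (U x)) := by
  rw [← h.G_dS_U hx _ (h.S_V x hx), ← h.swap.G_dS_U hx _ hz, dS_symm hx (U x),
    G_codazzi H hx z, h.G_u_U hx, h.G_u_of_eigen hx h1 h2 hz, G_φ_comm hx z, G_φ_comm hx z, h.φ_V hx,
    h.G_u_V hx, h.G_V_V hx]
  simp; ring

theorem codazzi_z_V_U : (l₁ - l₂) * H.G x (H.nab U x z) (V x) -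
    (l₁ - κ) * H.G x (H.nab U x (V x)) z =
    -γ * H.G x (H.φ x (U x)) z * (1 - 3 * H.G x (U x) (U x)) := by
  have e := h.swap.codazzi_z_U_V hx h2 h1 hz
  rw [h.G_nab_V_U hx, h.φ_V hx, h.G_V_V hx] at e
  simp at e
  linear_combination e

omit h1 h2 in
theorem G_nab_z_U : H.G x (H.nab U x z) (U x) =
    H.G x (H.nab U x z) (V x) + κ * H.G x (H.φ x (U x)) z := by
  have e := h.G_nab_add hx z (U x)
  rw [h.G_nab_V_U hx, hz, map_smul, G_smul_left, G_φ_comm hx] at e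
  linarith

/-- The relation between the principal curvature `κ` of a vector that is not orthogonal to `φ U`
and the length of `U`. -/
theorem curvature_relation (ha : H.G x (H.φ x (U x)) z ≠ 0) :
    (l₁ - κ) * (l₂ - κ) * (γ + (l₂ - κ) * l₁ + (l₁ - κ) * l₂) +
      3 * γ * (H.G x (U x) (U x) * (l₂ - κ) ^ 2 + (1 - H.G x (U x) (U x)) * (l₁ - κ) ^ 2) = 0 := by
  have e1 := h.G_nab_U_U hx h1 h2 hz
  have e2 := h.G_nab_V_V hx h1 h2 hz
  have e3 := h.G_nab_V_U_eq hx (z := z)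
  have e4 := h.G_nab_U_V_eq hx (z := z)
  have e5 := h.codazzi_z_U_V hx h1 h2 hz
  have e6 := h.codazzi_z_V_U hx h1 h2 hz
  -- The difference `e5 - e6` eliminates ⟨∇_z U, V⟩; the remaining components are known multiples of
  -- ⟨φU, z⟩ after clearing the denominators l₁ - κ and l₂ - κ.
  refine (mul_eq_zero.1 (?_ : H.G x (H.φ x (U x)) z * _ = 0)).resolve_left ha
  rw [e3] at e5
  rw [e4] at e6
  linear_combination (l₁ - κ) * (l₂ - κ) * (e5 - e6) - (l₂ - κ) ^ 2 * e1 + (l₁ - κ) ^ 2 * e2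

/-- The two linear relations that hold where the length of `U` is stationary. -/
theorem curvature_relations_of_fderiv (ha : H.G x (H.φ x (U x)) z ≠ 0)
    (hb : fderiv ℝ (fun y => H.G y (U y) (U y)) x z = 0) :
    (l₁ - κ) * (l₂ - κ) = κ * (l₁ - κ + (l₂ - κ)) + γ ∧
    γ * H.G x (U x) (U x) * (l₂ - l₁) = (l₁ - κ) ^ 2 * (κ - (l₂ - κ)) := by
  have e1 := h.G_nab_U_U hx h1 h2 hz
  have e2 := h.G_nab_V_V hx h1 h2 hz
  have e3 := h.G_nab_V_U_eq hx (z := z)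
  have e4 := h.G_nab_U_V_eq hx (z := z)
  have e5 := h.codazzi_z_U_V hx h1 h2 hz
  have e6 := h.codazzi_z_V_U hx h1 h2 hz
  have e7 := h.G_nab_z_U hx hz
  rw [h.fderiv_b hx] at hb
  rw [e3] at e5
  rw [e4] at e6
  -- Since b is stationary along z, ⟨∇_z U, V⟩ equals -κ⟨φU, z⟩, so `e5` and `e6` each give a
  -- relation of their own.
  have k1 : (l₁ - κ) * ((l₁ - l₂) * κ - (l₂ - κ) * l₁ - γ * (2 - 3 * H.G x (U x) (U x))) =
      (l₂ - κ) * (3 * γ * H.G x (U x) (U x)) := by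
    refine mul_left_cancel₀ ha ?_
    linear_combination (-(l₁ - κ)) * e5 + (l₂ - κ) * e1 + (l₁ - κ) * (l₁ - l₂) * (hb / 2 - e7)
  have k2 : (l₂ - κ) * ((l₁ - l₂) * κ + (l₁ - κ) * l₂ - γ * (1 - 3 * H.G x (U x) (U x))) =
      - (l₁ - κ) * (3 * γ * (1 - H.G x (U x) (U x))) := by
    refine mul_left_cancel₀ ha ?_
    linear_combination (-(l₂ - κ)) * e6 + (l₁ - κ) * e2 + (l₂ - κ) * (l₁ - l₂) * (hb / 2 - e7)
  have F : (l₁ - κ) * (l₂ - κ) = κ * (l₁ - κ + (l₂ - κ)) + γ := by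
    refine mul_left_cancel₀ (sub_ne_zero.2 h.ne) ?_
    linear_combination -k1 - k2
  refine ⟨F, ?_⟩
  linear_combination (-1 / 3 : ℝ) * k1 + (2 / 3 : ℝ) * (l₁ - κ) * F

/-- A vector that is not orthogonal to `φ U` lies in at most one principal curvature space where
the length of `U` is stationary. -/
theorem curvature_unique {κ' : ℝ} (h1' : κ' ≠ l₁) (h2' : κ' ≠ l₂) {z' : E}
    (hz' : H.S x z' = κ' • z') (ha : H.G x (H.φ x (U x)) z ≠ 0)
    (ha' : H.G x (H.φ x (U x)) z' ≠ 0)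
    (hb : ∀ X, fderiv ℝ (fun y => H.G y (U y) (U y)) x X = 0) : κ = κ' := by
  obtain ⟨F, B⟩ := h.curvature_relations_of_fderiv hx h1 h2 hz ha (hb z)
  obtain ⟨F', B'⟩ := h.curvature_relations_of_fderiv hx h1' h2' hz' ha' (hb z')
  by_contra hne
  have hd := sub_ne_zero.2 hne
  -- By `F` and `F'` both values are roots of 3t² - 2(l₁ + l₂)t + l₁l₂ - γ, which fixes their sum;
  -- the difference of the cubic relations `B` and `B'` then forces the roots to coincide.
  have hs : 3 * (κ + κ') = 2 * (l₁ + l₂) := by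
    refine mul_left_cancel₀ hd ?_
    linear_combination F - F'
  have hκ' : κ' = 2 / 3 * (l₁ + l₂) - κ := by linarith
  have hq : 2 * (κ ^ 2 + κ * κ' + κ' ^ 2) - (4 * l₁ + l₂) * (κ + κ') + 2 * l₁ ^ 2 + 2 * l₁ * l₂ = 0
      := by
    refine mul_left_cancel₀ hd ?_
    linear_combination B' - B
  have : (κ - κ') ^ 2 = 0 := by
    rw [hκ'] at hq ⊢
    linear_combination 2 * hq
  exact hd (pow_eq_zero_iff two_ne_zero |>.1 this)

end Coefficients

end IsHopfSplit
end HypersurfaceChart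
end CHn

/-! ### φU is an eigenfield, and |U| is constant. -/

namespace CHn
namespace HypersurfaceChart

variable {E : Type*} [NormedAddCommGroup E] [NormedSpace ℝ E] [FiniteDimensional ℝ E]
  {γ : ℝ} {Ω : Set E} {H : HypersurfaceChart γ Ω} {Λ : Finset ℝ} {l₁ l₂ : ℝ} {U V : E → E}

theorem contDiffOn_G_apply {X Y : E → E} (hX : ContDiffOn ℝ ∞ X Ω) (hY : ContDiffOn ℝ ∞ Y Ω) :
    ContDiffOn ℝ ∞ (fun y => H.G y (X y) (Y y)) Ω :=
  (H.contDiffOn_G.clm_apply hX).clm_apply hY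

namespace IsHopfSplit

variable (h : H.IsHopfSplit Λ l₁ l₂ U V) {x : E}
include h

theorem contDiffOn_b : ContDiffOn ℝ ∞ (fun y => H.G y (U y) (U y)) Ω :=
  contDiffOn_G_apply h.smooth_U h.smooth_U

theorem contDiffOn_A : ContDiffOn ℝ ∞ (fun y => H.φ y (U y)) Ω :=
  H.contDiffOn_φ.clm_apply h.smooth_U

variable (hx : x ∈ Ω)
include hx

theorem dA : DifferentiableAt ℝ (fun y => H.φ y (U y)) x :=
  H.differentiableAt_of_mem h.contDiffOn_A hx

theorem G_A_A : H.G x (H.φ x (U x)) (H.φ x (U x)) =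
    H.G x (U x) (U x) * (1 - H.G x (U x) (U x)) := by
  rw [H.φ_skew x hx, h.φ_φ_U hx]
  simp [h.G_U_V hx]
  ring

theorem G_A_A_pos : 0 < H.G x (H.φ x (U x)) (H.φ x (U x)) := by
  rw [h.G_A_A hx]
  exact mul_pos (h.b_pos hx) (sub_pos.2 (h.b_lt_one hx))

theorem ne_of_G_A_ne {κ : ℝ} {z : E} (hz : H.S x z = κ • z) (ha : H.G x (H.φ x (U x)) z ≠ 0) :
    κ ≠ l₁ ∧ κ ≠ l₂ := by
  constructor <;> rintro rfl
  · exact ha (h.G_φ_U_left hx hz)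
  · exact ha (h.G_φ_U_right hx hz)

/-- Not being orthogonal to `φ U` is an open condition on a principal curvature space. -/
theorem eventually_G_A_ne {κ : ℝ} {z : E} (hz : H.S x z = κ • z)
    (ha : H.G x (H.φ x (U x)) z ≠ 0) :
    ∀ᶠ y in nhds x, y ∈ Ω ∧ ∃ w, H.S y w = κ • w ∧ H.G y (H.φ y (U y)) w ≠ 0 := by
  have hκ : κ ∈ Λ := h.spec x hx z (by rintro rfl; simp at ha) κ hz
  have hc : ContinuousAt (fun y => H.G y (H.φ y (U y)) (H.proj Λ κ y z)) x :=
    (contDiffOn_G_apply h.contDiffOn_A ((contDiffOn_proj κ).clm_apply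
      contDiffOn_const)).continuousOn.continuousAt (H.isOpen.mem_nhds hx)
  have hne : ∀ᶠ y in nhds x, H.G y (H.φ y (U y)) (H.proj Λ κ y z) ≠ 0 :=
    hc.eventually_ne (by rwa [proj_of_eigen hκ hz])
  filter_upwards [hne, H.isOpen.mem_nhds hx] with y hy hyΩ
  exact ⟨hyΩ, _, S_proj h.spec hyΩ κ z, hy⟩

/-- The coefficient of b in `curvature_relation` is 3γ(l₂ - l₁)(l₁ + l₂ - 2κ). When it is nonzero, b
equals a fixed expression in the constants at all nearby points, because T_κ stays non-orthogonal to
φU there. -/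
theorem fderiv_b_of_ne {κ : ℝ} {z : E} (hz : H.S x z = κ • z)
    (ha : H.G x (H.φ x (U x)) z ≠ 0) (hκ : 2 * κ ≠ l₁ + l₂) (X : E) :
    fderiv ℝ (fun y => H.G y (U y) (U y)) x X = 0 := by
  obtain ⟨h1, h2⟩ := h.ne_of_G_A_ne hx hz ha
  have hc : 3 * γ * ((l₂ - κ) ^ 2 - (l₁ - κ) ^ 2) ≠ 0 := by
    have : (l₂ - κ) ^ 2 - (l₁ - κ) ^ 2 = (l₂ - l₁) * (l₁ + l₂ - 2 * κ) := by ring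
    rw [this]
    exact mul_ne_zero (mul_ne_zero three_ne_zero h.neg.ne)
      (mul_ne_zero (sub_ne_zero.2 h.ne.symm) (sub_ne_zero.2 hκ.symm))
  have : (fun y => H.G y (U y) (U y)) =ᶠ[nhds x] fun _ =>
      -((l₁ - κ) * (l₂ - κ) * (γ + (l₂ - κ) * l₁ + (l₁ - κ) * l₂) + 3 * γ * (l₁ - κ) ^ 2) /
        (3 * γ * ((l₂ - κ) ^ 2 - (l₁ - κ) ^ 2)) := by
    filter_upwards [h.eventually_G_A_ne hx hz ha] with y hy
    obtain ⟨hyΩ, w, hw, hwa⟩ := hy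
    rw [eq_div_iff hc]
    linear_combination h.curvature_relation hyΩ h1 h2 hw hwa
  rw [this.fderiv_eq]
  simp

/-- `φ U` lies in a single principal curvature space. -/
theorem exists_S_A : ∃ l₃ : ℝ, l₃ ≠ l₁ ∧ l₃ ≠ l₂ ∧ H.S x (H.φ x (U x)) = l₃ • H.φ x (U x) := by
  have hne : H.φ x (U x) ≠ 0 := by
    intro h0
    have := h.G_A_A_pos hx
    simp [h0] at this
  obtain ⟨κ, z, hz, ha⟩ : ∃ (κ : ℝ) (z : E), H.S x z = κ • z ∧ H.G x (H.φ x (U x)) z ≠ 0 := by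
    by_contra! hcon
    exact hne (eq_zero_of_forall_eigen hx hcon)
  obtain ⟨h1, h2⟩ := h.ne_of_G_A_ne hx hz ha
  refine ⟨κ, h1, h2, eq_of_forall_eigen (H := H) hx fun ν w hw => ?_⟩
  rw [H.S_symm x hx, hw, map_smul, map_smul, smul_apply]
  by_cases hwa : H.G x (H.φ x (U x)) w = 0
  · simp [hwa]
  obtain ⟨h1', h2'⟩ := h.ne_of_G_A_ne hx hw hwa
  congr 1
  -- Only the midpoint of l₁ and l₂ escapes `fderiv_b_of_ne`. Two eigenvalues are either both the
  -- midpoint, hence equal, or one of them makes b stationary and `curvature_unique` applies.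
  by_cases e1 : 2 * κ = l₁ + l₂
  · by_cases e2 : 2 * ν = l₁ + l₂
    · linarith
    · exact h.curvature_unique hx h1' h2' hw h1 h2 hz hwa ha (h.fderiv_b_of_ne hx hw hwa e2)
  · exact h.curvature_unique hx h1' h2' hw h1 h2 hz hwa ha (h.fderiv_b_of_ne hx hz ha e1)

/-- Locally, `φ U` is an eigenfield with constant eigenvalue. -/
theorem exists_S_A_nhds : ∃ l₃ : ℝ, l₃ ≠ l₁ ∧ l₃ ≠ l₂ ∧ ∃ Ω' ⊆ Ω, IsOpen Ω' ∧ x ∈ Ω' ∧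
    ∀ y ∈ Ω', H.S y (H.φ y (U y)) = l₃ • H.φ y (U y) := by
  obtain ⟨κ, h1, h2, hκ⟩ := h.exists_S_A hx
  obtain ⟨Ω', hs, ho, hm⟩ := eventually_nhds_iff.1
    (h.eventually_G_A_ne hx hκ (h.G_A_A_pos hx).ne')
  refine ⟨κ, h1, h2, Ω', fun y hy => (hs y hy).1, ho, hm, fun y hy => ?_⟩
  obtain ⟨hyΩ, w, hw, hwa⟩ := hs y hy
  obtain ⟨κ', -, -, hκ'⟩ := h.exists_S_A hyΩ
  -- At `y` the vector φU is an eigenvector and is not orthogonal to T_κ, so no other eigenvalue is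
  -- possible.
  by_cases e : κ = κ'
  · rw [e, hκ']
  · exact absurd (G_eigen_ne (Ne.symm e) hyΩ hκ' hw) hwa

end IsHopfSplit

/-- A Hopf split such that `φ U` is an eigenfield of the shape operator. -/
structure IsHopfFrame (H : HypersurfaceChart γ Ω) (Λ : Finset ℝ) (l₁ l₂ l₃ : ℝ) (U V : E → E) :
    Prop extends H.IsHopfSplit Λ l₁ l₂ U V where
  ne₁ : l₃ ≠ l₁
  ne₂ : l₃ ≠ l₂
  S_A : ∀ x ∈ Ω, H.S x (H.φ x (U x)) = l₃ • H.φ x (U x)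

namespace IsHopfFrame

variable {l₃ : ℝ}

theorem swap (h : H.IsHopfFrame Λ l₁ l₂ l₃ U V) : H.IsHopfFrame Λ l₂ l₁ l₃ V U where
  toIsHopfSplit := h.toIsHopfSplit.swap
  ne₁ := h.ne₂
  ne₂ := h.ne₁
  S_A x hx := by
    rw [h.toIsHopfSplit.φ_V hx, map_neg, h.S_A x hx, smul_neg]

variable (h : H.IsHopfFrame Λ l₁ l₂ l₃ U V) {x : E} (hx : x ∈ Ω)
include h hx

/-- Each eigencomponent of ∇_U U is governed by the corresponding component of φU, and φU is now an
eigenvector, so only its own direction survives. -/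
theorem nab_U_U : H.nab U x (U x) =
    (3 * γ * H.G x (U x) (U x) / (l₁ - l₃)) • H.φ x (U x) := by
  refine eq_of_forall_eigen (H := H) hx fun ν z hz => ?_
  rw [G_smul_left]
  by_cases h1 : ν = l₁
  · subst h1
    rw [h.G_nab_U_U_left' hx hz, h.G_φ_U_left hx hz, mul_zero]
  by_cases h2 : ν = l₂
  · subst h2
    rw [h.G_nab_U_U_right' hx hz, h.G_φ_U_right hx hz, mul_zero]
  have e := h.G_nab_U_U hx h1 h2 hz
  by_cases h3 : ν = l₃
  · subst h3
    have := sub_ne_zero.2 h.ne₁.symm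
    field_simp
    linear_combination e
  · rw [G_eigen_ne (Ne.symm h3) hx (h.S_A x hx) hz, mul_zero] at e ⊢
    exact (mul_eq_zero.1 e).resolve_left (sub_ne_zero.2 (Ne.symm h1))

theorem nab_V_U : H.nab V x (U x) =
    (-l₁ - 3 * γ * H.G x (U x) (U x) / (l₁ - l₃)) • H.φ x (U x) := by
  have e := h.nab_add' hx (U x)
  rw [h.nab_U_U hx, h.S_U x hx, map_smul] at e
  rw [sub_smul, neg_smul, eq_sub_iff_add_eq, add_comm, e]

theorem nab_U_V : H.nab U x (V x) =
    (l₂ + 3 * γ * (1 - H.G x (U x) (U x)) / (l₂ - l₃)) • H.φ x (U x) := by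
  rw [h.swap.nab_V_U hx, h.φ_V hx, h.G_V_V hx, smul_neg, ← neg_smul]
  congr 1; ring

theorem fderiv_b_of_perp {κ : ℝ} {z : E} (hz : H.S x z = κ • z)
    (ha : H.G x (H.φ x (U x)) z = 0) : fderiv ℝ (fun y => H.G y (U y) (U y)) x z = 0 := by
  by_cases h1 : κ = l₁
  · subst h1; exact h.fderiv_b_left hx hz
  by_cases h2 : κ = l₂
  · subst h2; exact h.fderiv_b_right hx hz
  have e := h.codazzi_z_U_V hx h1 h2 hz
  rw [h.fderiv_b hx, h.G_nab_z_U hx hz, ha]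
  rw [h.nab_V_U hx, G_smul_left, ha] at e
  have : (l₁ - l₂) * H.G x (H.nab U x z) (V x) = 0 := by linear_combination e
  rw [(mul_eq_zero.1 this).resolve_left (sub_ne_zero.2 h.ne)]
  ring

/-- Eigenvectors orthogonal to φU already annihilate b. In T_{l₃}, subtracting the φU-component
reduces to that case. -/
theorem fderiv_b_of_A (hA : fderiv ℝ (fun y => H.G y (U y) (U y)) x (H.φ x (U x)) = 0) (X : E) :
    fderiv ℝ (fun y => H.G y (U y) (U y)) x X = 0 := by
  refine eigen_induction (H := H) hx
    (p := fun X => fderiv ℝ (fun y => H.G y (U y) (U y)) x X = 0) ?_ ?_ X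
  · intro ν z hz
    by_cases h3 : ν = l₃
    · subst h3
      have e := h.fderiv_b_of_perp hx (κ := ν)
        (z := z - (H.G x (H.φ x (U x)) z / H.G x (H.φ x (U x)) (H.φ x (U x))) • H.φ x (U x))
        (by rw [map_sub, map_smul, hz, h.S_A x hx, smul_sub, smul_comm])
        (by
          have := (h.G_A_A_pos hx).ne'
          rw [map_sub, map_smul, smul_eq_mul]
          field_simp
          ring)
      rwa [map_sub, map_smul, hA, smul_zero, sub_zero] at e
    · exact h.fderiv_b_of_perp hx hz (G_eigen_ne (Ne.symm h3) hx (h.S_A x hx) hz)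
  · intro v w hv hw
    rw [map_add, hv, hw, add_zero]

theorem fderiv_b_A : (l₁ - l₂) * fderiv ℝ (fun y => H.G y (U y) (U y)) x (H.φ x (U x)) =
    2 * H.G x (H.φ x (U x)) (H.φ x (U x)) * ((l₁ - l₂) * l₃ -
      (l₂ - l₃) * (l₁ + 3 * γ * H.G x (U x) (U x) / (l₁ - l₃)) -
      γ * (2 - 3 * H.G x (U x) (U x))) := by
  have e := h.codazzi_z_U_V hx h.ne₁ h.ne₂ (h.S_A x hx)
  rw [h.fderiv_b hx, h.G_nab_z_U hx (h.S_A x hx)]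
  rw [h.nab_V_U hx, G_smul_left] at e
  linear_combination 2 * e

/-- Both ∇_U V and ∇_V U are multiples of φU, hence so is [U, V]; and [U, V] annihilates b because U
and V do, identically on Ω. -/
theorem bracket_b : (l₁ + l₂ + 3 * γ * H.G x (U x) (U x) / (l₁ - l₃) +
    3 * γ * (1 - H.G x (U x) (U x)) / (l₂ - l₃)) *
      fderiv ℝ (fun y => H.G y (U y) (U y)) x (H.φ x (U x)) = 0 := by
  have e := fderiv_bracket (H := H) h.contDiffOn_b hx (h.dU hx) (h.dV hx)
  rw [H.fderiv_congr_of_mem (g := fun _ => (0 : ℝ)) (fun y hy => h.fderiv_b_right hy (h.S_V y hy)) hx,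
    H.fderiv_congr_of_mem (g := fun _ => (0 : ℝ)) (fun y hy => h.fderiv_b_left hy (h.S_U y hy)) hx,
    h.nab_V_U hx, h.nab_U_V hx, ← sub_smul, map_smul, smul_eq_mul] at e
  simp only [fderiv_fun_const, Pi.zero_apply, zero_apply] at e
  linear_combination -e

/-- The length of `U` is constant. -/
theorem fderiv_b_eq_zero (X : E) : fderiv ℝ (fun y => H.G y (U y) (U y)) x X = 0 := by
  by_cases hκ : 2 * l₃ = l₁ + l₂
  swap
  · exact h.fderiv_b_of_ne hx (h.S_A x hx) (h.G_A_A_pos hx).ne' hκ X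
  refine h.fderiv_b_of_A hx ?_ X
  -- Midpoint case: l₁ = l₃ - d and l₂ = l₃ + d. The b-terms of `curvature_relation` then cancel and
  -- leave γ = -d².
  obtain ⟨d, hd⟩ : ∃ d, d = l₂ - l₃ := ⟨_, rfl⟩
  have e2 : l₂ = l₃ + d := by rw [hd]; ring
  have e1 : l₁ = l₃ - d := by linarith
  have hd0 : d ≠ 0 := by rw [hd]; exact sub_ne_zero.2 h.ne₂.symm
  have hγ : γ = - d ^ 2 := by
    have e := h.curvature_relation hx h.ne₁ h.ne₂ (h.S_A x hx) (h.G_A_A_pos hx).ne'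
    rw [e1, e2] at e
    have : d ^ 2 * (2 * (γ + d ^ 2)) = 0 := by linear_combination e
    have := (mul_eq_zero.1 this).resolve_left (pow_ne_zero 2 hd0)
    linarith
  have hA : ∀ y ∈ Ω, fderiv ℝ (fun y => H.G y (U y) (U y)) y (H.φ y (U y)) =
      H.G y (H.φ y (U y)) (H.φ y (U y)) * (3 * l₃ + 3 * d * (2 * H.G y (U y) (U y) - 1)) := by
    intro y hy
    have e := h.fderiv_b_A hy
    rw [e1, e2] at e
    simp only [hγ] at e
    have : l₃ - d - (l₃ + d) = -2 * d := by ring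
    refine mul_left_cancel₀ (mul_ne_zero (show (-2 : ℝ) ≠ 0 by norm_num) hd0) ?_
    rw [this] at e
    rw [e, show l₃ - d - l₃ = -d by ring]
    field_simp
    ring
  -- With v = 3d(2b - 1), Codazzi gives Ab = |A|²(3l₃ + v), and `bracket_b` then becomes the
  -- pointwise equation (2l₃ + v)(3l₃ + v) = 0, which can itself be differentiated.
  have hP : ∀ y ∈ Ω, (2 * l₃ + 3 * d * (2 * H.G y (U y) (U y) - 1)) *
      (3 * l₃ + 3 * d * (2 * H.G y (U y) (U y) - 1)) = 0 := by
    intro y hy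
    have e := h.bracket_b hy
    rw [hA y hy, e1, e2, show l₃ - d - l₃ = -d by ring, show l₃ + d - l₃ = d by ring] at e
    simp only [hγ] at e
    refine mul_left_cancel₀ (h.G_A_A_pos hy).ne' ?_
    rw [mul_zero, ← e]
    field_simp
    ring
  have hdb := H.differentiableAt_of_mem h.contDiffOn_b hx
  have hD := H.fderiv_congr_of_mem hP hx
  have hv : HasFDerivAt (fun y => 3 * d * (2 * H.G y (U y) (U y) - 1))
      ((3 * d) • ((2 : ℝ) • fderiv ℝ (fun y => H.G y (U y) (U y)) x)) x :=
    ((hdb.hasFDerivAt.const_mul 2).sub_const 1).const_mul (3 * d)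
  rw [((hv.const_add (2 * l₃)).fun_mul (hv.const_add (3 * l₃))).fderiv] at hD
  have hD' := congrArg (fun L => L (H.φ x (U x))) hD
  simp only [fderiv_fun_const, Pi.zero_apply, zero_apply, add_apply, smul_apply, smul_eq_mul,
    hA x hx] at hD'
  rw [hA x hx]
  have ha := (h.G_A_A_pos hx).ne'
  by_contra hne
  have h3 := right_ne_zero_of_mul hne
  have h2 := (mul_eq_zero.1 (hP x hx)).resolve_right h3
  generalize H.G x (H.φ x (U x)) (H.φ x (U x)) = a at *
  generalize H.G x (U x) (U x) = b at *
  -- If Ab ≠ 0 then v = -2l₃. Differentiating the product along A leaves a nonzero multiple of 5l₃ +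
  -- 2v = l₃, so l₃ = 0 and v = 0, contradicting 3l₃ + v ≠ 0.
  have h5 : a * (6 * d) * (3 * l₃ + 3 * d * (2 * b - 1)) * l₃ = 0 := by
    linear_combination hD' - 2 * (a * (6 * d) * (3 * l₃ + 3 * d * (2 * b - 1))) * h2
  have h6 := (mul_eq_zero.1 h5).resolve_left
    (mul_ne_zero (mul_ne_zero ha (mul_ne_zero (by norm_num) hd0)) h3)
  rw [h6] at h2 h3
  exact h3 (by linear_combination h2)

end IsHopfFrame
end HypersurfaceChart
end CHn

/-! ### The connection on the frame U, V, φU, and l₁ + l₂ = 3l₃. -/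

namespace CHn
namespace HypersurfaceChart

variable {E : Type*} [NormedAddCommGroup E] [NormedSpace ℝ E] [FiniteDimensional ℝ E]
  {γ : ℝ} {Ω : Set E} {H : HypersurfaceChart γ Ω} {Λ : Finset ℝ} {l₁ l₂ l₃ : ℝ} {U V : E → E}

/-- The covariant derivative of the vector field `φ U`. -/
noncomputable def nabA (H : HypersurfaceChart γ Ω) (U : E → E) (x X : E) : E :=
  H.nab (fun y => H.φ y (U y)) x X

namespace IsHopfFrame

variable (h : H.IsHopfFrame Λ l₁ l₂ l₃ U V) {x : E} (hx : x ∈ Ω)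
include h hx

theorem φ_V' : H.φ x (V x) = - H.φ x (U x) := h.toIsHopfSplit.φ_V hx

theorem G_U_A : H.G x (U x) (H.φ x (U x)) = 0 := G_eigen_ne h.ne₁.symm hx (h.S_U x hx) (h.S_A x hx)

theorem G_V_A : H.G x (V x) (H.φ x (U x)) = 0 := G_eigen_ne h.ne₂.symm hx (h.S_V x hx) (h.S_A x hx)

theorem G_A_U : H.G x (H.φ x (U x)) (U x) = 0 := G_eigen_ne h.ne₁ hx (h.S_A x hx) (h.S_U x hx)

theorem G_A_V : H.G x (H.φ x (U x)) (V x) = 0 := G_eigen_ne h.ne₂ hx (h.S_A x hx) (h.S_V x hx)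

/-- A vector is determined by its inner products with `U`, `V`, `φ U` and with the eigenvectors
orthogonal to them. -/
theorem eq_of_frame {v w : E} (hU : H.G x v (U x) = H.G x w (U x))
    (hV : H.G x v (V x) = H.G x w (V x))
    (hA : H.G x v (H.φ x (U x)) = H.G x w (H.φ x (U x)))
    (hz : ∀ (ν : ℝ) (z : E), H.S x z = ν • z → H.G x (U x) z = 0 → H.G x (V x) z = 0 →
      H.G x (H.φ x (U x)) z = 0 → H.G x v z = H.G x w z) : v = w := by
  refine eq_of_forall_eigen (H := H) hx fun ν z hν => ?_
  have hb := (h.b_pos hx).ne'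
  have hV0 := (H.G_pos x hx _ (h.V_ne x hx)).ne'
  have ha := (h.G_A_A_pos hx).ne'
  -- Removing the component of z along an eigenvector stays inside T_ν: the component is zero unless
  -- that eigenvector also belongs to T_ν.
  have key : ∀ (κ : ℝ) (Y : E), H.S x Y = κ • Y → H.G x Y Y ≠ 0 →
      H.S x ((H.G x Y z / H.G x Y Y) • Y) = ν • (H.G x Y z / H.G x Y Y) • Y := by
    intro κ Y hY hY0
    by_cases hκ : κ = ν
    · rw [map_smul, hY, hκ, smul_comm]
    · rw [G_eigen_ne hκ hx hY hν]; simp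
  have e := hz ν (z - (H.G x (U x) z / H.G x (U x) (U x)) • U x
    - (H.G x (V x) z / H.G x (V x) (V x)) • V x
    - (H.G x (H.φ x (U x)) z / H.G x (H.φ x (U x)) (H.φ x (U x))) • H.φ x (U x))
    (by rw [map_sub, map_sub, map_sub, hν, key _ _ (h.S_U x hx) hb, key _ _ (h.S_V x hx) hV0,
      key _ _ (h.S_A x hx) ha]; simp only [smul_sub])
    (by simp [h.G_U_V hx, h.G_U_A hx, hb])
    (by simp [h.G_V_U hx, h.G_V_A hx, hV0])
    (by simp [h.G_A_U hx, h.G_A_V hx, ha])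
  simpa [hU, hV, hA] using e

theorem nabA_eq (X : E) : H.nabA U x X = H.φ x (H.nab U x X) + H.G x (H.S x X) (U x) • H.u x -
    H.G x (U x) (U x) • H.S x X := by
  rw [nabA, nab_φ hx (h.dU hx), h.G_u_U hx]

theorem nabA_U : H.nabA U x (U x) =
    (H.G x (U x) (U x) * (3 * γ * H.G x (U x) (U x) / (l₁ - l₃) + l₁)) • V x -
    (3 * γ * H.G x (U x) (U x) / (l₁ - l₃) * (1 - H.G x (U x) (U x))) • U x := by
  rw [h.nabA_eq hx, h.nab_U_U hx, map_smul, h.φ_φ_U hx, h.S_U x hx, ← h.add x hx, G_smul_left]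
  module

theorem nabA_swap (X : E) : H.nabA V x X = - H.nabA U x X := by
  rw [nabA, nabA, ← nab_neg]
  exact nab_congr (fun y hy => h.φ_V' hy) hx X

theorem nabA_V : H.nabA U x (V x) =
    (3 * γ * (1 - H.G x (U x) (U x)) / (l₂ - l₃) * H.G x (U x) (U x)) • V x -
    ((1 - H.G x (U x) (U x)) * (3 * γ * (1 - H.G x (U x) (U x)) / (l₂ - l₃) + l₂)) • U x := by
  have e := h.nabA_swap hx (V x)
  rw [h.swap.nabA_U hx, h.G_V_V hx] at e
  rw [← neg_neg (H.nabA U x (V x)), ← e]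
  module

theorem G_φ_A (z : E) : H.G x (H.φ x (H.φ x (U x))) z =
    H.G x (U x) (U x) * H.G x (V x) z - (1 - H.G x (U x) (U x)) * H.G x (U x) z := by
  rw [h.φ_φ_U hx]; simp

theorem G_dS_A (X : E) {κ : ℝ} {z : E} (hz : H.S x z = κ • z) :
    H.G x (H.dS x X (H.φ x (U x))) z = (l₃ - κ) * H.G x (H.nabA U x X) z :=
  G_dS_eigenfield h.S_A hx (h.dA hx) X hz

theorem G_u_perp {z : E} (hU : H.G x (U x) z = 0) (hV : H.G x (V x) z = 0) :
    H.G x (H.u x) z = 0 := by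
  rw [← h.add x hx, map_add, add_apply, hU, hV, add_zero]

theorem G_u_A : H.G x (H.u x) (H.φ x (U x)) = 0 := h.G_u_perp hx (h.G_U_A hx) (h.G_V_A hx)

theorem G_nab_A_perp_aux {ν : ℝ} {z : E} (hz : H.S x z = ν • z) (hU : H.G x (U x) z = 0)
    (hV : H.G x (V x) z = 0) :
    (l₁ - ν) * H.G x (H.nab U x (H.φ x (U x))) z = 0 := by
  rw [← h.G_dS_U hx _ hz, G_codazzi H hx, h.G_dS_A hx _ hz, h.nabA_U hx, h.G_φ_A hx, h.G_φ_A hx,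
    h.G_u_perp hx hU hV, h.G_u_A hx]
  simp [hU, hV]

theorem nab_add_A : H.nab U x (H.φ x (U x)) + H.nab V x (H.φ x (U x)) =
    (l₃ * (1 - H.G x (U x) (U x))) • U x - (l₃ * H.G x (U x) (U x)) • V x := by
  rw [h.nab_add' hx, h.S_A x hx, map_smul, h.φ_φ_U hx]
  module

/-- The auxiliary Codazzi identity decides every ν except l₁. There its mirror image for V applies,
since l₁ ≠ l₂, and `nab_add_A` carries the result back to U. -/
theorem G_nab_A_perp {ν : ℝ} {z : E} (hz : H.S x z = ν • z) (hU : H.G x (U x) z = 0)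
    (hV : H.G x (V x) z = 0) : H.G x (H.nab U x (H.φ x (U x))) z = 0 := by
  by_cases h1 : ν = l₁
  · have e := h.swap.G_nab_A_perp_aux hx hz hV hU
    rw [h.φ_V' hx, nab_neg_right, h1] at e
    have e2 := (mul_eq_zero.1 e).resolve_left (sub_ne_zero.2 h.ne.symm)
    rw [eq_sub_of_add_eq (h.nab_add_A hx)]
    simp only [map_neg, neg_apply, neg_eq_zero] at e2
    simp [hU, hV, e2]
  · exact (mul_eq_zero.1 (h.G_nab_A_perp_aux hx hz hU hV)).resolve_left
      (sub_ne_zero.2 (Ne.symm h1))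

theorem G_nab_U (X : E) : H.G x (H.nab U x X) (U x) = 0 := by
  have := h.fderiv_b hx X
  rw [h.fderiv_b_eq_zero hx] at this
  linarith

theorem nab_A : H.nab U x (H.φ x (U x)) = -(l₃ * H.G x (U x) (U x)) • V x := by
  refine h.eq_of_frame hx ?_ ?_ ?_ fun ν z hz hU hV _ => ?_
  · rw [h.G_nab_U hx, G_smul_left, h.G_V_U hx, mul_zero]
  · have e := h.G_nab_z_U hx (h.S_A x hx)
    rw [h.G_nab_U hx, h.G_A_A hx] at e
    rw [G_smul_left, h.G_V_V hx]
    linarith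
  · have e := h.G_dS_U hx (H.φ x (U x)) (h.S_A x hx)
    rw [G_codazzi H hx, dS_block h.spec hx (h.S_A x hx) (h.S_A x hx), G_φ_self hx, h.G_u_A hx] at e
    rw [G_smul_left, h.G_V_A hx, mul_zero]
    exact (mul_eq_zero.1 (by linear_combination -e : (l₁ - l₃) * _ = 0)).resolve_left
      (sub_ne_zero.2 h.ne₁.symm)
  · rw [h.G_nab_A_perp hx hz hU hV, G_smul_left, hV, mul_zero]

theorem nab_A' : H.nab V x (H.φ x (U x)) = (l₃ * (1 - H.G x (U x) (U x))) • U x := by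
  rw [eq_sub_of_add_eq' (h.nab_add_A hx), h.nab_A hx]; module

theorem nabA_A : H.nabA U x (H.φ x (U x)) = 0 := by
  rw [h.nabA_eq hx, h.nab_A hx, h.S_A x hx, map_smul, h.φ_V' hx, G_smul_left, h.G_A_U hx]
  module

theorem fderiv_comp_b {P : ℝ → ℝ} (hP : Differentiable ℝ P) (X : E) :
    fderiv ℝ (fun y => P (H.G y (U y) (U y))) x X = 0 := by
  have := fderiv_comp (g := P) (f := fun y => H.G y (U y) (U y)) x (hP _)
    (H.differentiableAt_of_mem h.contDiffOn_b hx)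
  simp only [Function.comp_def] at this
  rw [this]
  simp [h.fderiv_b_eq_zero hx]

theorem differentiableAt_comp_b {P : ℝ → ℝ} (hP : Differentiable ℝ P) :
    DifferentiableAt ℝ (fun y => P (H.G y (U y) (U y))) x :=
  (hP _).comp x (H.differentiableAt_of_mem h.contDiffOn_b hx)

/-- The curvature of `M` in the direction of `φ U`. -/
theorem ricci_A {W : E → E} (hW : ContDiffOn ℝ ∞ W Ω) :
    H.nab (fun y => H.nabA U y (W y)) x (H.φ x (U x))
      - H.nabA U x (H.nab W x (H.φ x (U x))) + H.nabA U x (H.nabA U x (W x)) =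
    γ • (H.G x (W x) (H.φ x (U x)) • H.φ x (U x)
      - H.G x (H.φ x (U x)) (H.φ x (U x)) • W x
      + (3 * H.G x (H.φ x (W x)) (H.φ x (U x))) • H.φ x (H.φ x (U x)))
      + (l₃ * H.G x (H.S x (W x)) (H.φ x (U x))) • H.φ x (U x)
      - (l₃ * H.G x (H.φ x (U x)) (H.φ x (U x))) • H.S x (W x) := by
  have e := ricci_identity (H := H) h.contDiffOn_A hW h.contDiffOn_A hx
  -- ∇_A A vanishes on all of Ω, so its derivative along W contributes nothing to the curvature.
  have e0 := nab_congr (H := H) (Z := fun _ => 0) (fun y hy => h.nabA_A hy) hx (W x)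
  rw [nab_const, map_zero] at e0
  simp only [nabA] at e0
  rw [e0, nab_sub_right, h.S_A x hx, G_φ_self hx, G_φ_comm hx (H.φ x (U x)) (W x), G_smul_left] at e
  simp only [nabA]
  rw [sub_zero] at e
  rw [sub_add, e]
  module

/-- This is `ricci_A` for W = U, tested on U. Since b is constant, the coefficients of ∇_U A are
too, so only the fields U and V get differentiated; the common factor b(1 - b) is then cancelled. -/
theorem curvature_A_U :
    let b := H.G x (U x) (U x)
    let α := 3 * γ * b / (l₁ - l₃)
    let β := 3 * γ * (1 - b) / (l₂ - l₃)
    b * ((α + l₁) * l₃ - l₃ * (β + l₂) - (α + l₁) * (β + l₂)) + α ^ 2 * (1 - b) =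
      -b * (γ * (4 - 3 * b) + l₁ * l₃) := by
  intro b α β
  have hP1 : Differentiable ℝ fun t : ℝ => t * (3 * γ * t / (l₁ - l₃) + l₁) := by fun_prop
  have hP2 : Differentiable ℝ fun t : ℝ => 3 * γ * t / (l₁ - l₃) * (1 - t) := by fun_prop
  have e := h.ricci_A hx h.smooth_U
  have e1 : H.nab (fun y => H.nabA U y (U y)) x (H.φ x (U x)) =
      (b * (α + l₁)) • H.nab V x (H.φ x (U x)) - (α * (1 - b)) • H.nab U x (H.φ x (U x)) := by
    rw [nab_congr (fun y hy => h.nabA_U hy) hx,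
      nab_sub ((h.differentiableAt_comp_b hx hP1).fun_smul (h.dV hx))
        ((h.differentiableAt_comp_b hx hP2).fun_smul (h.dU hx)),
      nab_smul (h.differentiableAt_comp_b hx hP1) (h.dV hx),
      nab_smul (h.differentiableAt_comp_b hx hP2) (h.dU hx),
      h.fderiv_comp_b hx hP1, h.fderiv_comp_b hx hP2]
    simp [b, α]
  rw [e1, h.nab_A hx, h.nab_A' hx, h.nabA_U hx] at e
  simp only [nabA, nab_smul_right, nab_sub_right] at e
  have eU := h.nabA_U hx
  have eV := h.nabA_V hx
  simp only [nabA] at eU eV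
  rw [eU, eV] at e
  have e2 := congrArg (fun Y => H.G x Y (U x)) e
  have ha := h.G_A_A hx
  simp only [map_add, map_sub, map_smul, add_apply, sub_apply, smul_apply, smul_eq_mul,
    h.G_V_U hx, h.G_U_A hx, h.S_U x hx, h.G_A_U hx, ha, h.G_φ_A hx] at e2
  have hb : b * (1 - b) ≠ 0 := mul_ne_zero (h.b_pos hx).ne' (sub_pos.2 (h.b_lt_one hx)).ne'
  refine mul_left_cancel₀ hb ?_
  simp only [b, α, β]
  simp only [b, α] at e2
  linear_combination e2

theorem relations :
    (l₁ - l₃) * (l₂ - l₃) = l₃ * (l₁ - l₃ + (l₂ - l₃)) + γ ∧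
    γ * H.G x (U x) (U x) * (l₂ - l₁) = (l₁ - l₃) ^ 2 * (l₃ - (l₂ - l₃)) :=
  h.curvature_relations_of_fderiv hx h.ne₁ h.ne₂ (h.S_A x hx) (h.G_A_A_pos hx).ne'
    (h.fderiv_b_eq_zero hx _)

/-- The stationary Codazzi relations express γ and γb through l₁, l₂, l₃; substituted into the Gauss
relation `curvature_A_U`, they leave a polynomial that factors completely. -/
theorem sum_eq : l₁ + l₂ = 3 * l₃ := by
  have e := h.curvature_A_U hx
  obtain ⟨F, B⟩ := h.relations hx
  obtain ⟨-, B'⟩ := h.swap.relations hx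
  rw [h.G_V_V hx] at B'
  have hb := (h.b_pos hx).ne'
  have hb1 := (sub_pos.2 (h.b_lt_one hx)).ne'
  have hp0 := sub_ne_zero.2 h.ne₁.symm
  have hq0 := sub_ne_zero.2 h.ne₂.symm
  have hne := sub_ne_zero.2 h.ne.symm
  have hγ := h.neg.ne
  clear h
  simp only at e
  generalize H.G x (U x) (U x) = b at *
  obtain ⟨p, hp⟩ : ∃ p, p = l₁ - l₃ := ⟨_, rfl⟩
  obtain ⟨q, hq⟩ : ∃ q, q = l₂ - l₃ := ⟨_, rfl⟩
  rw [← hp, ← hq] at e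
  rw [← hp, ← hq] at F B B'
  rw [← hp] at hp0
  rw [← hq] at hq0
  have e1 : l₁ = l₃ + p := by rw [hp]; ring
  have e2 : l₂ = l₃ + q := by rw [hq]; ring
  clear hp hq
  subst e1 e2
  have hd : q - p ≠ 0 := by contrapose! hne; linarith
  rw [show l₃ + q - (l₃ + p) = q - p by ring] at B
  rw [show l₃ + p - (l₃ + q) = -(q - p) by ring] at B'
  have hα : 3 * γ * b / p = 3 * p * (l₃ - q) / (q - p) := by
    rw [div_eq_div_iff hp0 hd]; linear_combination 3 * B
  have hβ : 3 * γ * (1 - b) / q = -3 * q * (l₃ - p) / (q - p) := by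
    rw [div_eq_div_iff hq0 hd]; linear_combination -3 * B'
  have hα0 : 3 * γ * b / p ≠ 0 := div_ne_zero (mul_ne_zero (mul_ne_zero three_ne_zero hγ) hb) hp0
  have hα1 : 3 * γ * b / p * p = 3 * γ * b := div_mul_cancel₀ _ hp0
  have hβ1 : 3 * γ * (1 - b) / q * q = 3 * γ * (1 - b) := div_mul_cancel₀ _ hq0
  generalize 3 * γ * b / p = α at *
  generalize 3 * γ * (1 - b) / q = β at *
  have K : p * ((α + (l₃ + p)) * l₃ - l₃ * (β + (l₃ + q)) - (α + (l₃ + p)) * (β + (l₃ + q))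
      + 4 * γ - α * p + (l₃ + p) * l₃) + α * β * q = 0 := by
    refine mul_left_cancel₀ hα0 ?_
    linear_combination 3 * γ * e + ((α + (l₃ + p)) * l₃ - l₃ * (β + (l₃ + q)) -
      (α + (l₃ + p)) * (β + (l₃ + q)) + 4 * γ + (l₃ + p) * l₃) * hα1 + α ^ 2 * hβ1
      - (α * p + 3 * γ * b) * hα1
  have hγ' : γ = p * q - l₃ * (p + q) := by linear_combination -F
  have hlp : l₃ - p ≠ 0 := by
    rintro h0
    rw [h0, mul_zero] at B'
    exact mul_ne_zero (mul_ne_zero hγ hb1) (neg_ne_zero.2 hd) B'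
  rw [hα, hβ, hγ'] at K
  field_simp at K
  -- Here p, q and q - p are nonzero by distinctness of the curvatures, and l₃ - p is nonzero
  -- because b ≠ 1 in `B'`. The last factor is l₃ - p - q = 3l₃ - l₁ - l₂.
  have : (p * q * (q - p) * (l₃ - p)) * (l₃ - p - q) = 0 := by
    linear_combination (-1 / 3 : ℝ) * K
  have := (mul_eq_zero.1 this).resolve_left
    (mul_ne_zero (mul_ne_zero (mul_ne_zero hp0 hq0) hd) hlp)
  linarith

end IsHopfFrame
end HypersurfaceChart
end CHn

/-! ### Principal vectors orthogonal to U, V and φU. -/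

namespace CHn
namespace HypersurfaceChart

variable {E : Type*} [NormedAddCommGroup E] [NormedSpace ℝ E] [FiniteDimensional ℝ E]
  {γ : ℝ} {Ω : Set E} {H : HypersurfaceChart γ Ω} {Λ : Finset ℝ} {l₁ l₂ l₃ : ℝ} {U V : E → E}

/-- Orthogonality of a vector to `U`, `V` and `φ U`. -/
structure Perp (H : HypersurfaceChart γ Ω) (U V : E → E) (x z : E) : Prop where
  pU : H.G x (U x) z = 0
  pV : H.G x (V x) z = 0
  pA : H.G x (H.φ x (U x)) z = 0

@[simp] theorem nabA_add (x X Y : E) : H.nabA U x (X + Y) = H.nabA U x X + H.nabA U x Y :=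
  nab_add_right _ _ _ _

theorem nabA_sum {ι : Type*} (s : Finset ι) (x : E) (X : ι → E) :
    H.nabA U x (∑ i ∈ s, X i) = ∑ i ∈ s, H.nabA U x (X i) := by
  classical
  induction s using Finset.induction_on with
  | empty => simp [nabA]
  | insert i s hi ih => rw [Finset.sum_insert hi, Finset.sum_insert hi, nabA_add, ih]

namespace IsHopfFrame

section Constants

variable (h : H.IsHopfFrame Λ l₁ l₂ l₃ U V) {x : E} (hx : x ∈ Ω)
include h hx

theorem γ_eq : γ = (l₁ - l₃) * (l₂ - l₃) - l₃ ^ 2 := by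
  have := (h.relations hx).1
  linear_combination -this - l₃ * h.sum_eq hx

theorem γ_b : γ * H.G x (U x) (U x) * (l₂ - l₁) = (l₁ - l₃) ^ 3 := by
  have := (h.relations hx).2
  linear_combination this - (l₁ - l₃) ^ 2 * h.sum_eq hx

theorem γ_b' : γ * (1 - H.G x (U x) (U x)) * (l₂ - l₁) = -(l₂ - l₃) ^ 3 := by
  have := h.swap.γ_b hx
  rw [h.G_V_V hx] at this
  linear_combination -this

/-- Multiplying `γ_b` by `γ_b'` exhibits the cube of the product as -(γ(l₂ - l₁))² b(1 - b), and 0 <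
b < 1. -/
theorem mul_neg : (l₁ - l₃) * (l₂ - l₃) < 0 := by
  have h1 := h.γ_b hx
  have h2 := h.γ_b' hx
  have hγ := h.neg.ne
  have hne := sub_ne_zero.2 h.ne.symm
  have hb := h.b_pos hx
  have hb' := sub_pos.2 (h.b_lt_one hx)
  have h3 : ((l₁ - l₃) * (l₂ - l₃)) ^ 3 =
      -((γ * (l₂ - l₁)) ^ 2 * (H.G x (U x) (U x) * (1 - H.G x (U x) (U x)))) := by
    linear_combination (-(l₂ - l₃) ^ 3) * h1 + (γ * H.G x (U x) (U x) * (l₂ - l₁)) * h2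
  have h4 : 0 < (γ * (l₂ - l₁)) ^ 2 * (H.G x (U x) (U x) * (1 - H.G x (U x) (U x))) := by
    have := mul_ne_zero hγ hne
    positivity
  by_contra! hcon
  have := pow_nonneg hcon 3
  linarith

end Constants

section Perp

variable (h : H.IsHopfFrame Λ l₁ l₂ l₃ U V) {x : E} (hx : x ∈ Ω)
  {μ : ℝ} {w : E} (hw : H.S x w = μ • w) (hp : H.Perp U V x w)
include h hx hp

theorem perp_swap : H.Perp V U x w := ⟨hp.pV, hp.pU, by rw [h.φ_V' hx]; simp [hp.pA]⟩

theorem perp_φ : H.Perp U V x (H.φ x w) := by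
  have key : ∀ X, H.G x X (H.φ x w) = - H.G x (H.φ x X) w := fun X => by
    rw [H.φ_skew x hx]; simp
  refine ⟨by rw [key, hp.pA, neg_zero], by rw [key, h.φ_V' hx]; simp [hp.pA], ?_⟩
  rw [key, h.G_φ_A hx, hp.pU, hp.pV]; simp

/-- U, V and φU are themselves eigenvectors, so projecting onto T_ν cannot create a component along
them. -/
theorem perp_proj (ν : ℝ) : H.Perp U V x (H.proj Λ ν x w) := by
  have key : ∀ (κ : ℝ) (Y : E), H.S x Y = κ • Y → Y ≠ 0 → H.G x Y w = 0 →
      H.G x Y (H.proj Λ ν x w) = 0 := by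
    intro κ Y hY hY0 h0
    by_cases hκ : κ = ν
    · subst hκ
      rw [H.G_comm x hx, ← G_proj_of_eigen h.spec hx (h.spec x hx Y hY0 κ hY) hY,
        H.G_comm x hx, h0]
    · exact G_eigen_ne hκ hx hY (S_proj h.spec hx ν w)
  refine ⟨key _ _ (h.S_U x hx) (h.U_ne x hx) hp.pU, key _ _ (h.S_V x hx) (h.V_ne x hx) hp.pV,
    key _ _ (h.S_A x hx) ?_ hp.pA⟩
  intro h0
  have := h.G_A_A_pos hx
  simp [h0] at this

theorem G_φ_φ_perp (X : E) : H.G x (H.φ x X) (H.φ x w) = H.G x X w := by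
  rw [H.φ_skew x hx, H.φ_φ x hx, h.G_u_perp hx hp.pU hp.pV]; simp

include hw

theorem G_nab_V_perp : H.G x (H.nab U x w) (V x) = 0 := by
  by_cases h1 : μ = l₁
  · exact h.G_nab_U_V_left hx (h1 ▸ hw)
  by_cases h2 : μ = l₂
  · exact h.G_nab_U_V_right hx (h2 ▸ hw)
  have e := h.codazzi_z_U_V hx h1 h2 hw
  rw [hp.pA, h.nab_V_U hx, G_smul_left, hp.pA] at e
  exact (mul_eq_zero.1 (by linear_combination e : (l₁ - l₂) * _ = 0)).resolve_left
    (sub_ne_zero.2 h.ne)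

theorem nabA_perp_eq : H.nabA U x w = H.φ x (H.nab U x w) - (μ * H.G x (U x) (U x)) • w := by
  rw [h.nabA_eq hx, hw, G_smul_left, H.G_comm x hx w, hp.pU]
  module

/-- ∇_w U is orthogonal to u, so φ² acts on it as -1 and `nabA_perp_eq` can be inverted. From here
on ∇_w A is the only unknown. -/
theorem nab_perp : H.nab U x w =
    - H.φ x (H.nabA U x w) - (μ * H.G x (U x) (U x)) • H.φ x w := by
  have hu : H.G x (H.u x) (H.nab U x w) = 0 := by
    rw [H.G_comm x hx, ← h.add x hx, map_add, h.G_nab_U hx, h.G_nab_V_perp hx hw hp, add_zero]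
  rw [h.nabA_perp_eq hx hw hp, map_sub, H.φ_φ x hx, hu, map_smul]
  module

theorem nab_perp' : H.nab V x w =
    H.φ x (H.nabA U x w) - (μ * (1 - H.G x (U x) (U x))) • H.φ x w := by
  rw [h.swap.nab_perp hx hw (h.perp_swap hx hp), h.nabA_swap hx, h.G_V_V hx, map_neg, neg_neg]

theorem G_nabA_perp_U : H.G x (U x) (H.nabA U x w) = 0 := by
  have e := h.G_dS_U hx w (h.S_A x hx)
  rw [G_codazzi H hx, dS_symm hx, h.G_dS_A hx _ hw, h.nabA_U hx, G_φ_comm hx w (H.φ x (U x)),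
    G_φ_comm hx w (U x), hp.pA, h.G_φ_A hx, hp.pU, hp.pV, h.G_u_A hx, h.G_u_perp hx hp.pU hp.pV,
    h.G_A_A hx] at e
  have e2 : H.G x (H.nab U x w) (H.φ x (U x)) = 0 := by
    refine (mul_eq_zero.1 (?_ : (l₁ - l₃) * _ = 0)).resolve_left (sub_ne_zero.2 h.ne₁.symm)
    rw [← e]
    simp [hp.pU, hp.pV]
  rw [H.G_comm x hx, h.nabA_perp_eq hx hw hp, map_sub, sub_apply, H.φ_skew x hx, e2, G_smul_left,
    H.G_comm x hx w, hp.pU]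
  simp

theorem perp_nabA : H.Perp U V x (H.nabA U x w) := by
  refine ⟨h.G_nabA_perp_U hx hw hp, ?_, ?_⟩
  · have := h.swap.G_nabA_perp_U hx hw (h.perp_swap hx hp)
    rw [h.nabA_swap hx] at this
    simpa using this
  · have e := fderiv_G_apply (H := H) hx (h.dA hx) (h.dA hx) w
    have hP : Differentiable ℝ fun t : ℝ => t * (1 - t) := by fun_prop
    rw [H.fderiv_congr_of_mem (fun y hy => h.G_A_A hy) hx, h.fderiv_comp_b hx hP] at e
    have : H.G x (H.nabA U x w) (H.φ x (U x)) + H.G x (H.φ x (U x)) (H.nabA U x w) = 0 := e.symm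
    rw [H.G_comm x hx (H.nabA U x w)] at this
    linarith

variable {ν : ℝ} {z : E} (hz : H.S x z = ν • z) (hq : H.Perp U V x z)
include hz hq

theorem G_nabA_symm :
    (l₃ - ν) * H.G x (H.nabA U x w) z = (l₃ - μ) * H.G x (H.nabA U x z) w := by
  rw [← h.G_dS_A hx w hz, ← h.G_dS_A hx z hw, dS_symm hx, G_codazzi H hx,
    dS_symm hx z, h.G_u_perp hx hp.pU hp.pV, h.G_u_perp hx hq.pU hq.pV, h.G_u_A hx]
  ring

theorem G_dS_A_left :
    H.G x (H.dS x (H.φ x (U x)) w) z = (l₃ - ν) * H.G x (H.nabA U x w) z := by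
  rw [G_codazzi H hx, h.G_dS_A hx _ hz, h.G_u_perp hx hp.pU hp.pV, h.G_u_perp hx hq.pU hq.pV,
    h.G_u_A hx]
  ring

theorem codazzi_perp_U :
    (l₁ - ν) * H.G x (H.nab U x w) z - (l₁ - μ) * H.G x (H.nab U x z) w =
      2 * γ * H.G x (U x) (U x) * H.G x (H.φ x w) z := by
  rw [← h.G_dS_U hx w hz, ← h.G_dS_U hx z hw, dS_symm hx, G_codazzi H hx,
    dS_symm hx z, h.G_u_perp hx hp.pU hp.pV, h.G_u_perp hx hq.pU hq.pV, h.G_u_U hx]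
  ring

/-- The components of `φ ∇_w (φ U)`. -/
theorem G_φ_nabA :
    γ * (l₂ - l₁) * (μ - ν) * H.G x (H.φ x (H.nabA U x w)) z =
    H.G x (H.φ x w) z * ((μ - ν) * (-((l₁ - l₃) * (l₂ - l₃))) *
      (-((l₁ - l₃) * (l₂ - l₃)) - l₃ * (μ - l₃)) - 2 * γ * (μ - l₃) ^ 2 * (ν - l₃)) := by
  have e1 := h.codazzi_perp_U hx hw hp hz hq
  have e2 := h.swap.codazzi_perp_U hx hw (h.perp_swap hx hp) hz (h.perp_swap hx hq)
  rw [h.nab_perp hx hw hp, h.nab_perp hx hz hq] at e1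
  rw [h.nab_perp' hx hw hp, h.nab_perp' hx hz hq, h.G_V_V hx] at e2
  simp only [map_sub, map_neg, sub_apply, neg_apply, map_smul, smul_apply, smul_eq_mul,
    G_φ_comm hx z w] at e1 e2
  have hγ := h.γ_eq hx
  have hb := h.γ_b hx
  have hb' := h.γ_b' hx
  have hs : l₂ = 3 * l₃ - l₁ := by linarith [h.sum_eq hx]
  have hne := sub_ne_zero.2 h.ne.symm
  generalize H.G x (U x) (U x) = b at *
  generalize H.G x (H.φ x w) z = j at *
  generalize H.G x (H.φ x (H.nabA U x w)) z = τ at *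
  generalize H.G x (H.φ x (H.nabA U x z)) w = τ' at *
  refine mul_left_cancel₀ hne ?_
  -- The Codazzi equations for U and for V are linear in `τ` and `τ'`; this combination eliminates
  -- `τ'`. Then `γ_b` and `γ_b'` remove b.
  have e3 : γ * (l₂ - l₁) * ((l₂ - l₁) * (μ - ν) * τ) =
      -j * ((γ * b * (l₂ - l₁)) * (l₂ - μ) * (2 * γ + μ * (l₁ - ν) + ν * (l₁ - μ)) +
        (γ * (1 - b) * (l₂ - l₁)) * (l₁ - μ) * (2 * γ + μ * (l₂ - ν) + ν * (l₂ - μ))) := by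
    linear_combination (-γ * (l₂ - l₁) * (l₂ - μ)) * e1 - (γ * (l₂ - l₁) * (l₁ - μ)) * e2
  rw [hb, hb'] at e3
  have e4 : (l₂ - l₁) * (γ * (l₂ - l₁) * (μ - ν) * τ) = γ * (l₂ - l₁) * ((l₂ - l₁) * (μ - ν) * τ) :=
    by ring
  rw [e4, e3, hγ, hs]
  ring

end Perp

end IsHopfFrame
end HypersurfaceChart
end CHn

/-! ### Two spectral identities for vectors orthogonal to the frame. -/

namespace CHn
namespace HypersurfaceChart

variable {E : Type*} [NormedAddCommGroup E] [NormedSpace ℝ E] [FiniteDimensional ℝ E]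
  {γ : ℝ} {Ω : Set E} {H : HypersurfaceChart γ Ω} {Λ : Finset ℝ} {l₁ l₂ l₃ : ℝ} {U V : E → E}

namespace IsHopfFrame

variable (h : H.IsHopfFrame Λ l₁ l₂ l₃ U V) {x : E} (hx : x ∈ Ω)
include h hx

theorem G_proj_self (ν : ℝ) (hν : ν ∈ Λ) (v : E) :
    H.G x v (H.proj Λ ν x v) = H.G x (H.proj Λ ν x v) (H.proj Λ ν x v) :=
  G_proj_of_eigen h.spec hx hν (S_proj h.spec hx ν v) v

theorem G_self_nonneg (v : E) : 0 ≤ H.G x v v := by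
  rcases eq_or_ne v 0 with rfl | hv
  · simp
  · exact (H.G_pos x hx v hv).le

theorem eq_zero_of_G_self {v : E} (hv : H.G x v v = 0) : v = 0 := by
  by_contra hne
  exact (H.G_pos x hx v hne).ne' hv

variable {μ : ℝ} {w : E} (hμ : μ ≠ l₃) (hw : H.S x w = μ • w) (hp : H.Perp U V x w)
include hμ hw hp

theorem G_nabA_same {z : E} (hz : H.S x z = μ • z) (hq : H.Perp U V x z) :
    H.G x (H.nabA U x w) z = 0 := by
  have e := h.G_dS_A_left hx hw hp hz hq
  rw [dS_block h.spec hx hw hz] at e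
  exact (mul_eq_zero.1 e.symm).resolve_left (sub_ne_zero.2 hμ.symm)

/-- For ν = μ the left side of `G_φ_nabA` disappears, leaving 2γ(μ - l₃)³ times the pairing of φw
with T_μ. -/
theorem proj_φ_same (hμΛ : μ ∈ Λ) : H.proj Λ μ x (H.φ x w) = 0 := by
  have hpφ := h.perp_proj hx (h.perp_φ hx hp) μ
  have hS := S_proj h.spec hx μ (H.φ x w)
  have e := h.G_φ_nabA hx hw hp hS hpφ
  rw [sub_self] at e
  refine h.eq_zero_of_G_self hx ?_
  rw [← h.G_proj_self hx μ hμΛ]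
  have h3 : 2 * γ * (μ - l₃) ^ 3 ≠ 0 :=
    mul_ne_zero (mul_ne_zero two_ne_zero h.neg.ne) (pow_ne_zero 3 (sub_ne_zero.2 hμ))
  exact (mul_eq_zero.1 (by linear_combination e : 2 * γ * (μ - l₃) ^ 3 * _ = 0)).resolve_left h3

/-- The spectral decomposition of `φ w`. -/
theorem sum_φ (hμΛ : μ ∈ Λ) : -((l₁ - l₃) * (l₂ - l₃)) *
    (-((l₁ - l₃) * (l₂ - l₃)) - l₃ * (μ - l₃)) * H.G x w w =
    -2 * γ * (μ - l₃) ^ 2 * ∑ ν ∈ Λ, H.G x (H.proj Λ ν x (H.φ x w)) (H.proj Λ ν x (H.φ x w)) *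
      ((ν - l₃) / (ν - μ)) := by
  -- φ is isometric on the complement of the frame, and ∇_w A has no component in T_μ. Expanding
  -- this zero over the eigencomponents of φw, with `G_φ_nabA` in each, gives the claim.
  have e0 : H.G x (H.φ x (H.nabA U x w)) (H.φ x w) = 0 := by
    rw [h.G_φ_φ_perp hx hp, h.G_nabA_same hx hμ hw hp hw hp]
  rw [G_eq_sum_proj h.spec hx] at e0
  have e1 : H.G x w w = ∑ ν ∈ Λ, H.G x (H.proj Λ ν x (H.φ x w)) (H.proj Λ ν x (H.φ x w)) := by
    rw [← h.G_φ_φ_perp hx hp, G_eq_sum_proj h.spec hx]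
    exact Finset.sum_congr rfl fun ν hν => h.G_proj_self hx ν hν _
  rw [e1, ← sub_eq_zero, Finset.mul_sum, Finset.mul_sum, ← Finset.sum_sub_distrib,
    ← mul_zero (γ * (l₂ - l₁)), ← e0, Finset.mul_sum]
  refine Finset.sum_congr rfl fun ν hν => ?_
  by_cases hνμ : ν = μ
  · rw [hνμ, h.proj_φ_same hx hμ hw hp hμΛ]; simp
  have e := h.G_φ_nabA hx hw hp (S_proj h.spec hx ν (H.φ x w)) (h.perp_proj hx (h.perp_φ hx hp) ν)
  rw [h.G_proj_self hx ν hν] at e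
  have hd := sub_ne_zero.2 hνμ
  refine mul_left_cancel₀ hd ?_
  field_simp
  linear_combination e

omit hμ in
/-- A principal vector orthogonal to `U`, `V`, `φ U` extends to such a vector field. -/
theorem exists_perp_field (hμΛ : μ ∈ Λ) : ∃ W : E → E, ContDiffOn ℝ ∞ W Ω ∧ W x = w ∧
    ∀ y ∈ Ω, H.S y (W y) = μ • W y ∧ H.Perp U V y (W y) := by
  have sU := h.smooth_U
  have sV := h.smooth_V
  have sA := h.contDiffOn_A
  have sw : ContDiffOn ℝ ∞ (fun _ : E => w) Ω := contDiffOn_const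
  have term : ∀ Y : E → E, ContDiffOn ℝ ∞ Y Ω → (∀ y ∈ Ω, H.G y (Y y) (Y y) ≠ 0) →
      ContDiffOn ℝ ∞ (fun y => (H.G y (Y y) w / H.G y (Y y) (Y y)) • Y y) Ω := fun Y hY h0 =>
    ((contDiffOn_G_apply hY sw).div (contDiffOn_G_apply hY hY) h0).smul hY
  have hb : ∀ y ∈ Ω, H.G y (U y) (U y) ≠ 0 := fun y hy => (h.b_pos hy).ne'
  have hV0 : ∀ y ∈ Ω, H.G y (V y) (V y) ≠ 0 := fun y hy => (H.G_pos y hy _ (h.V_ne y hy)).ne'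
  have ha : ∀ y ∈ Ω, H.G y (H.φ y (U y)) (H.φ y (U y)) ≠ 0 := fun y hy => (h.G_A_A_pos hy).ne'
  refine ⟨fun y => H.proj Λ μ y (w - (H.G y (U y) w / H.G y (U y) (U y)) • U y
    - (H.G y (V y) w / H.G y (V y) (V y)) • V y
    - (H.G y (H.φ y (U y)) w / H.G y (H.φ y (U y)) (H.φ y (U y))) • H.φ y (U y)), ?_, ?_, ?_⟩
  · exact (contDiffOn_proj μ).clm_apply
      (((sw.sub (term U sU hb)).sub (term V sV hV0)).sub (term _ sA ha))
  · simp [hp.pU, hp.pV, hp.pA, proj_of_eigen hμΛ hw]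
  · intro y hy
    refine ⟨S_proj h.spec hy μ _, h.perp_proj hy ⟨?_, ?_, ?_⟩ μ⟩
    · simp [h.G_U_V hy, h.G_U_A hy, hb y hy]
    · simp [h.G_V_U hy, h.G_V_A hy, hV0 y hy]
    · simp [h.G_A_U hy, h.G_A_V hy, ha y hy]

/-- The Gauss equation in the plane of `φ U` and `w`. -/
theorem sum_nabA (hμΛ : μ ∈ Λ) : H.G x (H.φ x (U x)) (H.φ x (U x)) *
    (-((l₁ - l₃) * (l₂ - l₃)) - l₃ * (μ - l₃)) * H.G x w w =
    -2 * ∑ ν ∈ Λ, H.G x (H.proj Λ ν x (H.nabA U x w)) (H.proj Λ ν x (H.nabA U x w)) *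
      ((ν - l₃) / (ν - μ)) := by
  obtain ⟨W, sW, rfl, hW⟩ := h.exists_perp_field hx hw hp hμΛ
  have dW := H.differentiableAt_of_mem sW hx
  obtain ⟨N, hN⟩ : ∃ N, N = H.nab W x (H.φ x (U x)) := ⟨_, rfl⟩
  -- Differentiating the orthogonality of W to U, V and φU along φU moves the derivative onto those
  -- fields, whose derivatives lie in their own span.
  have hpN : H.Perp U V x N := by
    have key : ∀ Y : E → E, DifferentiableAt ℝ Y x → (∀ y ∈ Ω, H.G y (Y y) (W y) = 0) →
        H.G x (Y x) N = - H.G x (H.nab Y x (H.φ x (U x))) (W x) := by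
      intro Y hY h0
      have e := fderiv_G_apply (H := H) hx hY dW (H.φ x (U x))
      rw [H.fderiv_congr_of_mem h0 hx] at e
      simp only [fderiv_fun_const, Pi.zero_apply, zero_apply] at e
      rw [hN]; linarith
    refine ⟨?_, ?_, ?_⟩
    · rw [key U (h.dU hx) fun y hy => (hW y hy).2.pU, h.nab_A hx, G_smul_left, hp.pV]; simp
    · rw [key V (h.dV hx) fun y hy => (hW y hy).2.pV, h.nab_A' hx, G_smul_left, hp.pU]; simp
    · rw [key _ (h.dA hx) fun y hy => (hW y hy).2.pA]
      have := h.nabA_A hx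
      rw [nabA] at this
      rw [this]; simp
  have hpC := h.perp_nabA hx hw hp
  have e := congrArg (fun Y => H.G x Y (W x)) (h.ricci_A hx sW)
  simp only [map_add, map_sub, map_smul, add_apply, sub_apply, smul_apply, smul_eq_mul, hp.pA,
    h.G_φ_A hx, hp.pU, hp.pV, hw, H.G_comm x hx (W x) (H.φ x (U x)), ← hN] at e
  have e1 : H.G x (H.nab (fun y => H.nabA U y (W y)) x (H.φ x (U x))) (W x) =
      - H.G x (H.nabA U x (W x)) N := by
    have sC : ContDiffOn ℝ ∞ (fun y => H.nabA U y (W y)) Ω := contDiffOn_nab sW h.contDiffOn_A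
    have e2 := fderiv_G_apply (H := H) hx (H.differentiableAt_of_mem sC hx) dW (H.φ x (U x))
    rw [H.fderiv_congr_of_mem (g := fun _ => (0 : ℝ)) (fun y hy => h.G_nabA_same hy hμ (hW y hy).1
      (hW y hy).2 (hW y hy).1 (hW y hy).2) hx] at e2
    simp only [fderiv_fun_const, Pi.zero_apply, zero_apply, ← hN] at e2
    linarith
  -- The Codazzi symmetry `G_nabA_symm`, applied to the eigencomponents of Y, writes ⟨∇_Y A, w⟩ in
  -- terms of ∇_w A. It is used for Y = N and Y = ∇_w A.
  have e3 : ∀ Y, H.Perp U V x Y → (μ - l₃) * H.G x (H.nabA U x Y) (W x) =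
      ∑ ν ∈ Λ, (ν - l₃) * H.G x Y (H.proj Λ ν x (H.nabA U x (W x))) := by
    intro Y hY
    conv_lhs => rw [← sum_proj h.spec hx Y, nabA_sum, map_sum, sum_apply, Finset.mul_sum]
    refine Finset.sum_congr rfl fun ν hν => ?_
    have hS := S_proj h.spec hx ν Y
    have e4 := h.G_nabA_symm hx hw hp hS (h.perp_proj hx hY ν)
    have e5 := G_proj_of_eigen h.spec hx hν hS (H.nabA U x (W x))
    have e6 := G_proj_of_eigen h.spec hx hν (S_proj h.spec hx ν (H.nabA U x (W x))) Y
    rw [H.G_comm x hx (H.proj Λ ν x Y)] at e6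
    rw [e6, ← e5]
    linear_combination e4
  have e7 := e3 N hpN
  have e8 := e3 _ hpC
  have e9 : (μ - l₃) * H.G x (H.nabA U x (W x)) N =
      ∑ ν ∈ Λ, (μ - l₃) * H.G x N (H.proj Λ ν x (H.nabA U x (W x))) := by
    rw [H.G_comm x hx, G_eq_sum_proj h.spec hx, Finset.mul_sum]
  have hγ := h.γ_eq hx
  refine mul_left_cancel₀ (sub_ne_zero.2 hμ) ?_
  have e10 : (μ - l₃) * (H.G x (H.φ x (U x)) (H.φ x (U x)) *
    (-((l₁ - l₃) * (l₂ - l₃)) - l₃ * (μ - l₃)) * H.G x (W x) (W x)) =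
    ∑ ν ∈ Λ, (-((μ - l₃) * H.G x N (H.proj Λ ν x (H.nabA U x (W x)))) -
      (ν - l₃) * H.G x N (H.proj Λ ν x (H.nabA U x (W x))) +
      (ν - l₃) * H.G x (H.nabA U x (W x)) (H.proj Λ ν x (H.nabA U x (W x)))) := by
    rw [Finset.sum_add_distrib, Finset.sum_sub_distrib, Finset.sum_neg_distrib, ← e7, ← e8, ← e9]
    rw [e1] at e
    linear_combination (-(μ - l₃)) * e +
      (μ - l₃) * H.G x (H.φ x (U x)) (H.φ x (U x)) * H.G x (W x) (W x) * hγ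
  rw [e10, Finset.mul_sum, Finset.mul_sum]
  refine Finset.sum_congr rfl fun ν hν => ?_
  have hS := S_proj h.spec hx ν (H.nabA U x (W x))
  rw [h.G_proj_self hx ν hν]
  by_cases hνμ : ν = μ
  · subst hνμ
    have : H.proj Λ ν x (H.nabA U x (W x)) = 0 := by
      refine h.eq_zero_of_G_self hx ?_
      rw [← h.G_proj_self hx ν hν]
      exact h.G_nabA_same hx hμ hw hp hS (h.perp_proj hx hpC ν)
    rw [this]; simp
  -- The T_ν-component of (∇_A S)w has two expressions: (μ - ν) times that of N = ∇_A W, and (l₃ -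
  -- ν) times that of ∇_w A. This eliminates N.
  have f1 := h.G_dS_A_left hx hw hp hS (h.perp_proj hx hpC ν)
  rw [G_dS_eigenfield (fun y hy => (hW y hy).1) hx dW _ hS, ← hN, h.G_proj_self hx ν hν] at f1
  have hd := sub_ne_zero.2 hνμ
  refine mul_left_cancel₀ hd ?_
  field_simp
  linear_combination (μ + ν - 2 * l₃) * f1

end IsHopfFrame
end HypersurfaceChart
end CHn

/-! ### The extremal argument for the remaining principal curvature. -/

namespace CHn
namespace HypersurfaceChart

variable {E : Type*} [NormedAddCommGroup E] [NormedSpace ℝ E] [FiniteDimensional ℝ E]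
  {γ : ℝ} {Ω : Set E} {H : HypersurfaceChart γ Ω} {Λ : Finset ℝ} {l₁ l₂ l₃ : ℝ} {U V : E → E}

/-- `ν ≠ l₃` has a principal vector orthogonal to `U`, `V`, `φ U`. -/
def PerpSpec (H : HypersurfaceChart γ Ω) (l₃ : ℝ) (U V : E → E) (x : E) (ν : ℝ) : Prop :=
  ν ≠ l₃ ∧ ∃ w, w ≠ 0 ∧ H.S x w = ν • w ∧ H.Perp U V x w

/-- For nonzero y ≠ x the weight is ε(1/x - 1/y) times a square. If y = 0 or y = x it is zero, the
latter by the convention for division by zero, which matches the absent diagonal term. -/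
theorem weight_nonneg {ε x y : ℝ} (hx : x ≠ 0) (h : y ≠ 0 → 0 ≤ ε * (1 / x - 1 / y)) :
    0 ≤ ε / x * (y / (y - x)) := by
  rcases eq_or_ne y 0 with rfl | hy
  · simp
  rcases eq_or_ne (y - x) 0 with h0 | h0
  · simp [h0]
  have e : ε / x * (y / (y - x)) = ε * (1 / x - 1 / y) * (y / (y - x)) ^ 2 := by
    field_simp
  rw [e]
  exact mul_nonneg (h hy) (sq_nonneg _)

namespace IsHopfFrame

variable (h : H.IsHopfFrame Λ l₁ l₂ l₃ U V) {x : E} (hx : x ∈ Ω)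
include h hx

/-- Extremality of 1/(μ - l₃) gives both spectral sums the same weak sign. In `sum_φ` the factor
-(l₁ - l₃)(l₂ - l₃) - l₃(μ - l₃) is a positive multiple of its sum, in `sum_nabA` a negative one, so
it must be zero. The number ε = ±1 treats maximum and minimum at once. -/
theorem eq_of_extremal {μ ε : ℝ} (hε : ε ≠ 0) (hμ : H.PerpSpec l₃ U V x μ)
    (hext : ∀ ν, H.PerpSpec l₃ U V x ν → 0 ≤ ε * (1 / (μ - l₃) - 1 / (ν - l₃))) :
    -((l₁ - l₃) * (l₂ - l₃)) = l₃ * (μ - l₃) := by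
  obtain ⟨hμ3, w, hw0, hw, hp⟩ := hμ
  have hx0 := sub_ne_zero.2 hμ3
  have hμΛ : μ ∈ Λ := h.spec x hx w hw0 μ hw
  have hG := H.G_pos x hx w hw0
  have hA := h.G_A_A_pos hx
  have hk := h.mul_neg hx
  have hγ := h.neg
  have s1 := h.sum_φ hx hμ3 hw hp hμΛ
  have s2 := h.sum_nabA hx hμ3 hw hp hμΛ
  have pos : ∀ Z, H.Perp U V x Z → 0 ≤ ε / (μ - l₃) *
      ∑ ν ∈ Λ, H.G x (H.proj Λ ν x Z) (H.proj Λ ν x Z) * ((ν - l₃) / (ν - μ)) := by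
    intro Z hZ
    rw [Finset.mul_sum]
    refine Finset.sum_nonneg fun ν _ => ?_
    rcases eq_or_ne (H.proj Λ ν x Z) 0 with h0 | h0
    · simp [h0]
    have := weight_nonneg (ε := ε) (y := ν - l₃) hx0 fun hy => hext ν
      ⟨sub_ne_zero.1 hy, _, h0, S_proj h.spec hx ν Z, h.perp_proj hx hZ ν⟩
    rw [sub_sub_sub_cancel_right] at this
    have h3 := mul_nonneg (h.G_self_nonneg hx (H.proj Λ ν x Z)) this
    linarith
  have p1 := pos _ (h.perp_φ hx hp)
  have p2 := pos _ (h.perp_nabA hx hw hp)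
  obtain ⟨q, hq⟩ : ∃ q, q = ε / (μ - l₃) * (-((l₁ - l₃) * (l₂ - l₃)) - l₃ * (μ - l₃)) := ⟨_, rfl⟩
  have q1 : 0 ≤ q * (-((l₁ - l₃) * (l₂ - l₃)) * H.G x w w) := by
    have e : q * (-((l₁ - l₃) * (l₂ - l₃)) * H.G x w w) = (-2 * γ * (μ - l₃) ^ 2) *
      (ε / (μ - l₃) * ∑ ν ∈ Λ, H.G x (H.proj Λ ν x (H.φ x w)) (H.proj Λ ν x (H.φ x w)) *
        ((ν - l₃) / (ν - μ))) := by
      rw [hq]; linear_combination ε / (μ - l₃) * s1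
    rw [e]
    exact mul_nonneg (mul_nonneg (by linarith) (sq_nonneg _)) p1
  have q2 : q * (H.G x (H.φ x (U x)) (H.φ x (U x)) * H.G x w w) ≤ 0 := by
    have : q * (H.G x (H.φ x (U x)) (H.φ x (U x)) * H.G x w w) = -2 *
        (ε / (μ - l₃) * ∑ ν ∈ Λ, H.G x (H.proj Λ ν x (H.nabA U x w))
          (H.proj Λ ν x (H.nabA U x w)) * ((ν - l₃) / (ν - μ))) := by
      rw [hq]; linear_combination ε / (μ - l₃) * s2
    linarith
  have hq0 : q = 0 := le_antisymm (nonpos_of_mul_nonpos_left q2 (mul_pos hA hG))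
    (nonneg_of_mul_nonneg_left q1 (mul_pos (neg_pos.2 hk) hG))
  rw [hq0] at hq
  exact sub_eq_zero.1 ((mul_eq_zero.1 hq.symm).resolve_left (div_ne_zero hε hx0))

/-- The principal curvatures on the orthogonal complement of `U`, `V`, `φ U`. -/
theorem mul_eq_of_perpSpec {μ : ℝ} (hμ : H.PerpSpec l₃ U V x μ) : l₃ * μ = -γ := by
  classical
  obtain ⟨s, hs⟩ : ∃ s : Finset ℝ, ∀ ν, ν ∈ s ↔ H.PerpSpec l₃ U V x ν := by
    refine ⟨Λ.filter (H.PerpSpec l₃ U V x), fun ν => ?_⟩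
    rw [Finset.mem_filter, and_iff_right_iff_imp]
    rintro ⟨_, w, hw0, hw, _⟩
    exact h.spec x hx w hw0 ν hw
  have hne : s.Nonempty := ⟨μ, (hs μ).2 hμ⟩
  -- Both the minimum and the maximum of 1/(ν - l₃) solve the same equation, which has one solution
  -- because l₃ ≠ 0; hence every admissible ν coincides with it.
  obtain ⟨m, hm, hmin⟩ := s.exists_min_image (fun ν => 1 / (ν - l₃)) hne
  obtain ⟨m', hm', hmax⟩ := s.exists_max_image (fun ν => 1 / (ν - l₃)) hne
  have e1 := h.eq_of_extremal hx (ε := -1) (by norm_num) ((hs m).1 hm)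
    fun ν hν => by linarith [hmin ν ((hs ν).2 hν)]
  have e2 := h.eq_of_extremal hx (ε := 1) (by norm_num) ((hs m').1 hm')
    fun ν hν => by linarith [hmax ν ((hs ν).2 hν)]
  have hk := h.mul_neg hx
  have hl : l₃ ≠ 0 := by
    rintro rfl
    rw [zero_mul, neg_eq_zero] at e1
    exact hk.ne e1
  have hmm : m = m' := by
    have := mul_left_cancel₀ hl (e1.symm.trans e2)
    linarith
  subst hmm
  have e3 : 1 / (μ - l₃) = 1 / (m - l₃) :=
    le_antisymm (hmax μ ((hs μ).2 hμ)) (hmin μ ((hs μ).2 hμ))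
  have e4 : μ = m := by
    rw [one_div, one_div, inv_inj] at e3
    linarith
  rw [e4]
  linear_combination -e1 + h.γ_eq hx

/-- Any principal curvature besides `l₁`, `l₂`, `l₃` is `-γ / l₃`. -/
theorem mul_eq_of_ne {κ : ℝ} {w : E} (hw0 : w ≠ 0) (hw : H.S x w = κ • w) (h₁ : κ ≠ l₁)
    (h₂ : κ ≠ l₂) (h₃ : κ ≠ l₃) : l₃ * κ = -γ :=
  h.mul_eq_of_perpSpec hx ⟨h₃, w, hw0, hw, G_eigen_ne h₁.symm hx (h.S_U x hx) hw,
    G_eigen_ne h₂.symm hx (h.S_V x hx) hw, G_eigen_ne h₃.symm hx (h.S_A x hx) hw⟩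

theorem mul_eq_of_not_simple {w : E} (hw0 : w ≠ 0) (hw : H.S x w = l₂ • w)
    (hV : H.G x (V x) w = 0) : l₃ * l₂ = -γ :=
  h.mul_eq_of_perpSpec hx ⟨h.ne₂.symm, w, hw0, hw, G_eigen_ne h.ne hx (h.S_U x hx) hw,
    hV, G_eigen_ne h.ne₂ hx (h.S_A x hx) hw⟩

/-- Substituting l₁ = 3l₃ - l₂ into the formula for γ gives (l₂ - l₃)(l₂ - 3l₃) = 0, and l₂ ≠ l₃. -/
theorem eq_of_mul_eq (e : l₃ * l₂ = -γ) : l₁ = 0 ∧ l₂ = 3 * l₃ ∧ 3 * l₃ ^ 2 = -γ := by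
  have h1 := h.γ_eq hx
  have h2 := h.sum_eq hx
  have h3 : (l₂ - l₃) * (l₂ - 3 * l₃) = 0 := by
    have : l₁ = 3 * l₃ - l₂ := by linarith
    subst this
    linear_combination h1 - e
  have h4 := (mul_eq_zero.1 h3).resolve_left (sub_ne_zero.2 h.ne₂.symm)
  refine ⟨by linarith, by linarith, ?_⟩
  have h5 : l₂ = 3 * l₃ := by linarith
  rw [h5] at e
  linear_combination e

end IsHopfFrame
end HypersurfaceChart
end CHn

/-! ### The Bergman metric: derivatives and curvature. -/

namespace CHn

section Ambient

variable {n : ℕ} {c : ℝ}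

/-- The Bergman metric as a Hermitian form. -/
noncomputable def hermitian (c : ℝ) (z v w : Coord n) : ℂ :=
  ((rho c z : ℂ) * inner ℂ v w - (c / 4 : ℝ) * (inner ℂ v z * inner ℂ z w)) / (rho c z : ℂ) ^ 2

theorem metric_eq_re (z v w : Coord n) : metric c z v w = (hermitian c z v w).re := by
  rw [metric, hermitian, ← Complex.ofReal_pow, Complex.div_ofReal_re]

theorem hermitian_add_left (z v v' w : Coord n) :
    hermitian c z (v + v') w = hermitian c z v w + hermitian c z v' w := by
  simp only [hermitian, inner_add_left]; ring

theorem hermitian_add_right (z v w w' : Coord n) :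
    hermitian c z v (w + w') = hermitian c z v w + hermitian c z v w' := by
  simp only [hermitian, inner_add_right]; ring

theorem hermitian_smul_left (z v w : Coord n) (t : ℂ) :
    hermitian c z (t • v) w = starRingEnd ℂ t * hermitian c z v w := by
  simp only [hermitian, inner_smul_left]; ring

theorem hermitian_smul_right (z v w : Coord n) (t : ℂ) :
    hermitian c z v (t • w) = t * hermitian c z v w := by
  simp only [hermitian, inner_smul_right]; ring

theorem hermitian_conj (z v w : Coord n) :
    starRingEnd ℂ (hermitian c z v w) = hermitian c z w v := by
  simp only [hermitian, map_div₀, map_sub, map_mul, map_pow, Complex.conj_ofReal, inner_conj_symm]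
  ring

theorem metric_comm (z v w : Coord n) : metric c z v w = metric c z w v := by
  rw [metric_eq_re, metric_eq_re, ← hermitian_conj, Complex.conj_re]

theorem metric_smul_left (z v w : Coord n) (t : ℝ) :
    metric c z (t • v) w = t * metric c z v w := by
  rw [metric_eq_re, metric_eq_re, ← Complex.coe_smul t v, hermitian_smul_left,
    Complex.conj_ofReal, Complex.re_ofReal_mul]

theorem metric_I_left (z v w : Coord n) :
    metric c z (Complex.I • v) w = (hermitian c z v w).im := by
  simp [metric_eq_re, hermitian_smul_left]

theorem metric_I_right (z v w : Coord n) :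
    metric c z v (Complex.I • w) = - metric c z (Complex.I • v) w := by
  rw [metric_I_left, metric_eq_re, hermitian_smul_right]; simp

theorem metric_I_I (z v w : Coord n) :
    metric c z (Complex.I • v) (Complex.I • w) = metric c z v w := by
  rw [metric_I_right, smul_smul, Complex.I_mul_I, neg_one_smul, ← neg_one_smul ℂ v, metric_eq_re,
    hermitian_smul_left, metric_eq_re]
  simp

theorem metric_I_self (z v : Coord n) : metric c z (Complex.I • v) v = 0 := by
  have := metric_I_right (c := c) z v v
  rw [metric_comm] at this
  linarith

theorem metric_pos (hc : c < 0) {z : Coord n} (hz : z ∈ space n c) {v : Coord n} (hv : v ≠ 0) :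
    0 < metric c z v v := by
  have hr : 0 < rho c z := hz
  rw [metric]
  refine div_pos ?_ (by positivity)
  have e1 : (inner ℂ v v : ℂ) = ((‖v‖ ^ 2 : ℝ) : ℂ) := by
    rw [inner_self_eq_norm_sq_to_K]; norm_cast
  have e2 : (inner ℂ v z * inner ℂ z v : ℂ) = ((‖(inner ℂ z v : ℂ)‖ ^ 2 : ℝ) : ℂ) := by
    rw [← inner_conj_symm v z, Complex.conj_mul', Complex.ofReal_pow]
  rw [e1, e2, ← Complex.ofReal_mul, ← Complex.ofReal_mul, ← Complex.ofReal_sub, Complex.ofReal_re]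
  have : 0 < ‖v‖ := norm_pos_iff.2 hv
  have h1 : 0 < rho c z * ‖v‖ ^ 2 := by positivity
  have h2 : c / 4 * ‖(inner ℂ z v : ℂ)‖ ^ 2 ≤ 0 :=
    mul_nonpos_of_nonpos_of_nonneg (by linarith) (sq_nonneg _)
  linarith

/-- The Bergman metric as a continuous bilinear form. -/
noncomputable def metricL (c : ℝ) (z : Coord n) : Coord n →L[ℝ] Coord n →L[ℝ] ℝ :=
  LinearMap.toContinuousLinearMap ((LinearMap.toContinuousLinearMap :
    (Coord n →ₗ[ℝ] ℝ) ≃ₗ[ℝ] (Coord n →L[ℝ] ℝ)).toLinearMap ∘ₗ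
    LinearMap.mk₂ ℝ (metric c z)
      (fun v v' w => by simp only [metric_eq_re, hermitian_add_left, Complex.add_re])
      (fun t v w => metric_smul_left z v w t)
      (fun v w w' => by simp only [metric_eq_re, hermitian_add_right, Complex.add_re])
      (fun t v w => by
        rw [metric_comm, metric_smul_left, metric_comm, smul_eq_mul]))

@[simp] theorem metricL_apply (z v w : Coord n) : metricL c z v w = metric c z v w := rfl

/-- The Christoffel symbols as a continuous bilinear map. -/
noncomputable def christoffelL (c : ℝ) (z : Coord n) : Coord n →L[ℝ] Coord n →L[ℝ] Coord n :=
  LinearMap.toContinuousLinearMap ((LinearMap.toContinuousLinearMap :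
    (Coord n →ₗ[ℝ] Coord n) ≃ₗ[ℝ] (Coord n →L[ℝ] Coord n)).toLinearMap ∘ₗ
    LinearMap.mk₂ ℝ (christoffel c z)
      (christoffel_add_left c z)
      (fun t v w => christoffel_smul_left c z v w t)
      (fun v w w' => by
        rw [christoffel_comm, christoffel_add_left, christoffel_comm c z w,
          christoffel_comm c z w'])
      (fun t v w => by
        rw [christoffel_comm, christoffel_smul_left, christoffel_comm]))

@[simp] theorem christoffelL_apply (z v w : Coord n) :
    christoffelL c z v w = christoffel c z v w := rfl

theorem christoffel_I_right (z v w : Coord n) :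
    christoffel c z v (Complex.I • w) = Complex.I • christoffel c z v w := by
  simp only [christoffel, inner_smul_right, smul_add, smul_smul]
  congr 2 <;> ring

theorem hasDerivAt_rho_comp {z : ℝ → Coord n} {z' : Coord n} {t : ℝ} (hz : HasDerivAt z z' t) :
    HasDerivAt (fun s => (rho c (z s) : ℂ))
      ((c / 4 : ℝ) * (inner ℂ (z t) z' + inner ℂ z' (z t))) t := by
  have e : (fun s => (rho c (z s) : ℂ)) = fun s => 1 + ((c / 4 : ℝ) : ℂ) * inner ℂ (z s) (z s) := by
    funext s
    rw [inner_self_eq_norm_sq_to_K, rho]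
    push_cast
    rfl
  rw [e]
  exact ((hz.inner ℂ hz).const_mul _).const_add 1

/-- The derivative of the Christoffel symbols in the direction `a`. -/
noncomputable def dchristoffel (c : ℝ) (z a v w : Coord n) : Coord n :=
  (((c / 4 : ℝ) : ℂ) ^ 2 * (inner ℂ z a + inner ℂ a z) / (rho c z : ℂ) ^ 2) •
    ((inner ℂ z v : ℂ) • w + (inner ℂ z w : ℂ) • v) +
  ((((-(c / 4) / rho c z : ℝ) : ℂ) * inner ℂ a v) • w +
    (((-(c / 4) / rho c z : ℝ) : ℂ) * inner ℂ a w) • v)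

theorem hasDerivAt_christoffel_comp {z v w : ℝ → Coord n} {z' v' w' : Coord n} {t : ℝ}
    (hr : rho c (z t) ≠ 0)
    (hz : HasDerivAt z z' t) (hv : HasDerivAt v v' t) (hw : HasDerivAt w w' t) :
    HasDerivAt (fun s => christoffel c (z s) (v s) (w s))
      (dchristoffel c (z t) z' (v t) (w t) + christoffel c (z t) v' (w t) +
        christoffel c (z t) (v t) w') t := by
  have hρ := hasDerivAt_rho_comp (c := c) hz
  have hr' : (rho c (z t) : ℂ) ≠ 0 := Complex.ofReal_ne_zero.2 hr
  have hκ := hρ.inv hr'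
  have h1 := ((hκ.const_mul (-(c / 4 : ℝ) : ℂ)).mul (hz.inner ℂ hv)).smul hw
  have h2 := ((hκ.const_mul (-(c / 4 : ℝ) : ℂ)).mul (hz.inner ℂ hw)).smul hv
  have h := h1.add h2
  refine (h.congr_of_eventuallyEq (Filter.Eventually.of_forall fun s => ?_)).congr_deriv ?_
  · simp only [christoffel, Pi.add_apply, Pi.smul_apply', Pi.mul_apply, Pi.inv_apply]
    push_cast
    rfl
  · ext i
    simp only [dchristoffel, christoffel, PiLp.add_apply, PiLp.smul_apply, smul_eq_mul, Pi.mul_apply,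
      Pi.inv_apply]
    push_cast
    field_simp
    ring

theorem hasDerivAt_metric_comp {z v w : ℝ → Coord n} {z' v' w' : Coord n} {t : ℝ}
    (hr : rho c (z t) ≠ 0)
    (hz : HasDerivAt z z' t) (hv : HasDerivAt v v' t) (hw : HasDerivAt w w' t) :
    HasDerivAt (fun s => metric c (z s) (v s) (w s))
      (metric c (z t) (v' + christoffel c (z t) z' (v t)) (w t) +
        metric c (z t) (v t) (w' + christoffel c (z t) z' (w t))) t := by
  have hρ := hasDerivAt_rho_comp (c := c) hz
  have hr' : (rho c (z t) : ℂ) ≠ 0 := Complex.ofReal_ne_zero.2 hr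
  have h := ((hρ.mul (hv.inner ℂ hw)).sub (((hv.inner ℂ hz).mul (hz.inner ℂ hw)).const_mul
    ((c / 4 : ℝ) : ℂ))).div (hρ.pow 2) (pow_ne_zero 2 hr')
  have h3 := Complex.reCLM.hasFDerivAt.comp_hasDerivAt t h
  refine (h3.congr_of_eventuallyEq (Filter.Eventually.of_forall fun s => ?_)).congr_deriv ?_
  · rw [metric_eq_re]; rfl
  · rw [metric_eq_re, metric_eq_re, ← Complex.add_re, Complex.reCLM_apply]
    congr 1
    have c1 : ∀ a : Coord n, (inner ℂ (z t) a : ℂ) = starRingEnd ℂ (inner ℂ a (z t)) :=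
      fun a => (inner_conj_symm _ _).symm
    have hN : (rho c (z t) : ℂ) = 1 + ((c / 4 : ℝ) : ℂ) * inner ℂ (z t) (z t) := by
      rw [inner_self_eq_norm_sq_to_K, rho]; push_cast; rfl
    simp only [hermitian, christoffel, inner_add_left, inner_add_right, inner_smul_left,
      inner_smul_right, map_mul, Complex.conj_ofReal, inner_conj_symm, Pi.mul_apply, Pi.sub_apply,
      Pi.pow_apply]
    push_cast at *
    generalize (rho c (z t) : ℂ) = r at *
    field_simp
    rw [hN]
    ring

/-- The curvature tensor of the Bergman metric. -/
noncomputable def curvature (c : ℝ) (z a b v : Coord n) : Coord n :=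
  (c / 4) • (metric c z b v • a - metric c z a v • b
    + metric c z (Complex.I • b) v • Complex.I • a - metric c z (Complex.I • a) v • Complex.I • b
    - (2 * metric c z (Complex.I • a) b) • Complex.I • v)

/-- A real metric term together with its J-twin makes one complex coefficient. In this form
`curvature_eq` becomes a coordinatewise identity of rational functions of complex inner products. -/
theorem curvature_eq_hermitian (z a b v : Coord n) : curvature c z a b v =
    ((c / 4 : ℝ) : ℂ) • (hermitian c z b v • a - hermitian c z a v • b
      - (hermitian c z a b - hermitian c z b a) • v) := by
  have e : ∀ a b : Coord n, hermitian c z a b =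
      metric c z a b + metric c z (Complex.I • a) b * Complex.I := fun a b => by
    rw [metric_I_left, metric_eq_re, Complex.re_add_im]
  have e1 : metric c z (Complex.I • b) a = - metric c z (Complex.I • a) b := by
    rw [metric_comm, metric_I_right]
  rw [curvature, e b v, e a v, e a b, e b a, e1, metric_comm z b a]
  ext i
  simp only [PiLp.smul_apply, PiLp.sub_apply, PiLp.add_apply, smul_eq_mul, Complex.real_smul]
  push_cast
  ring

theorem curvature_eq (z a b v : Coord n) (hr : rho c z ≠ 0) :
    dchristoffel c z a b v + christoffel c z a (christoffel c z b v) -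
      (dchristoffel c z b a v + christoffel c z b (christoffel c z a v)) = curvature c z a b v := by
  rw [curvature_eq_hermitian]
  have hr' : (rho c z : ℂ) ≠ 0 := Complex.ofReal_ne_zero.2 hr
  ext i
  simp only [dchristoffel, christoffel, hermitian, PiLp.smul_apply, PiLp.sub_apply, PiLp.add_apply,
    smul_eq_mul, inner_add_right, inner_smul_right]
  push_cast
  field_simp
  ring

end Ambient
end CHn

/-! ### Immersions in a chart: pulled-back connection and tangential projection. -/

namespace CHn

variable {n : ℕ} {c : ℝ} {E : Type*} [NormedAddCommGroup E] [NormedSpace ℝ E]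
  [FiniteDimensional ℝ E] {Ω : Set E} {F N V W : E → Coord n} {x : E}

theorem _root_.DifferentiableAt.hasDerivAt_line {E' : Type*} [NormedAddCommGroup E']
    [NormedSpace ℝ E'] {f : E → E'} (hf : DifferentiableAt ℝ f x) (X : E) :
    HasDerivAt (fun t : ℝ => f (x + t • X)) (fderiv ℝ f x X) 0 := by
  have h1 : HasDerivAt (fun t : ℝ => x + t • X) X 0 := by
    simpa using ((hasDerivAt_id (0 : ℝ)).smul_const X).const_add x
  exact HasFDerivAt.comp_hasDerivAt_of_eq 0 hf.hasFDerivAt h1 (by simp)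

theorem fderiv_eq_of_line {E' : Type*} [NormedAddCommGroup E']
    [NormedSpace ℝ E'] {f : E → E'} (hf : DifferentiableAt ℝ f x) {X : E} {d : E'}
    (h : HasDerivAt (fun t : ℝ => f (x + t • X)) d 0) : fderiv ℝ f x X = d :=
  (hf.hasDerivAt_line X).unique h

section Smooth

variable {s : Set E}

theorem contDiffOn_rho_comp (hF : ContDiffOn ℝ ∞ F s) :
    ContDiffOn ℝ ∞ (fun y => rho c (F y)) s :=
  contDiffOn_const.add (contDiffOn_const.mul (hF.norm_sq ℂ))

theorem contDiffOn_metric_comp (hr : ∀ y ∈ s, rho c (F y) ≠ 0) (hF : ContDiffOn ℝ ∞ F s)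
    (hV : ContDiffOn ℝ ∞ V s) (hW : ContDiffOn ℝ ∞ W s) :
    ContDiffOn ℝ ∞ (fun y => metric c (F y) (V y) (W y)) s := by
  have h1 := contDiffOn_rho_comp (c := c) hF
  have h2 : ContDiffOn ℝ ∞ (fun y => (rho c (F y) : ℂ)) s := Complex.ofRealCLM.contDiff.comp_contDiffOn h1
  have h3 := (h2.mul (hV.inner ℂ hW)).sub ((contDiffOn_const (c := ((c / 4 : ℝ) : ℂ))).mul
    ((hV.inner ℂ hF).mul (hF.inner ℂ hW)))
  exact (Complex.reCLM.contDiff.comp_contDiffOn h3).div (h1.pow 2) fun y hy => pow_ne_zero 2 (hr y hy)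

theorem contDiffOn_christoffel_comp (hr : ∀ y ∈ s, rho c (F y) ≠ 0) (hF : ContDiffOn ℝ ∞ F s)
    (hV : ContDiffOn ℝ ∞ V s) (hW : ContDiffOn ℝ ∞ W s) :
    ContDiffOn ℝ ∞ (fun y => christoffel c (F y) (V y) (W y)) s := by
  have h1 := contDiffOn_rho_comp (c := c) hF
  have h2 : ContDiffOn ℝ ∞ (fun y => ((-(c / 4) / rho c (F y) : ℝ) : ℂ)) s :=
    Complex.ofRealCLM.contDiff.comp_contDiffOn (contDiffOn_const.div h1 hr)
  exact ((h2.mul (hF.inner ℂ hV)).smul hW).add ((h2.mul (hF.inner ℂ hW)).smul hV)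

end Smooth

/-- The covariant derivative of a vector field along a map `F`. -/
noncomputable def covAlong (c : ℝ) (F V : E → Coord n) (x X : E) : Coord n :=
  fderiv ℝ V x X + christoffel c (F x) (fderiv ℝ F x X) (V x)

theorem covAlong_add (hV : DifferentiableAt ℝ V x) (hW : DifferentiableAt ℝ W x) (X : E) :
    covAlong c F (fun y => V y + W y) x X = covAlong c F V x X + covAlong c F W x X := by
  have := map_add (christoffelL c (F x) (fderiv ℝ F x X)) (V x) (W x)
  simp only [christoffelL_apply] at this
  simp only [covAlong, fderiv_fun_add hV hW, add_apply, this]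
  abel

theorem covAlong_smul {f : E → ℝ} (hf : DifferentiableAt ℝ f x) (hV : DifferentiableAt ℝ V x)
    (X : E) : covAlong c F (fun y => f y • V y) x X =
      fderiv ℝ f x X • V x + f x • covAlong c F V x X := by
  have := map_smul (christoffelL c (F x) (fderiv ℝ F x X)) (f x) (V x)
  simp only [christoffelL_apply] at this
  simp only [covAlong, fderiv_fun_smul hf hV, add_apply, this, smul_apply,
    ContinuousLinearMap.smulRight_apply, smul_add]
  abel

theorem covAlong_I (hV : DifferentiableAt ℝ V x) (X : E) :
    covAlong c F (fun y => Complex.I • V y) x X = Complex.I • covAlong c F V x X := by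
  simp only [covAlong, fderiv_fun_const_smul hV, smul_apply, christoffel_I_right, smul_add]

/-- An immersed hypersurface of the complex hyperbolic space with a unit normal field, in a chart
domain `Ω`. -/
structure IsHypersurfaceOn (c : ℝ) (Ω : Set E) (F N : E → Coord n) : Prop where
  neg : c < 0
  isOpen : IsOpen Ω
  smooth_F : ContDiffOn ℝ ∞ F Ω
  smooth_N : ContDiffOn ℝ ∞ N Ω
  mem_space : ∀ x ∈ Ω, F x ∈ space n c
  injective : ∀ x ∈ Ω, Function.Injective (fderiv ℝ F x)
  unit : ∀ x ∈ Ω, metric c (F x) (N x) (N x) = 1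
  normal : ∀ x ∈ Ω, ∀ X, metric c (F x) (fderiv ℝ F x X) (N x) = 0
  finrank : Module.finrank ℝ E + 1 = 2 * n

/-- The frame `(X, t) ↦ dF X + t N`. -/
noncomputable def frameL (F N : E → Coord n) (x : E) : E × ℝ →L[ℝ] Coord n :=
  (fderiv ℝ F x).coprod (ContinuousLinearMap.toSpanSingleton ℝ (N x))

@[simp] theorem frameL_apply (F N : E → Coord n) (x X : E) (t : ℝ) :
    frameL F N x (X, t) = fderiv ℝ F x X + t • N x := by
  simp [frameL]

/-- The tangential component, as a tangent vector of the chart domain. -/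
noncomputable def tang (F N : E → Coord n) (x : E) : Coord n →L[ℝ] E :=
  (ContinuousLinearMap.fst ℝ E ℝ).comp (frameL F N x).inverse

namespace IsHypersurfaceOn

variable (h : IsHypersurfaceOn c Ω F N)
include h

theorem rho_ne {y : E} (hy : y ∈ Ω) : rho c (F y) ≠ 0 := (h.mem_space y hy).ne'

theorem differentiableAt {E' : Type*} [NormedAddCommGroup E'] [NormedSpace ℝ E'] {f : E → E'}
    (hf : ContDiffOn ℝ ∞ f Ω) {x : E} (hx : x ∈ Ω) : DifferentiableAt ℝ f x :=
  (hf.contDiffAt (h.isOpen.mem_nhds hx)).differentiableAt (by simp)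

theorem fderiv_congr {E' : Type*} [NormedAddCommGroup E'] [NormedSpace ℝ E'] {f g : E → E'}
    (hfg : ∀ y ∈ Ω, f y = g y) {x : E} (hx : x ∈ Ω) : fderiv ℝ f x = fderiv ℝ g x :=
  Filter.EventuallyEq.fderiv_eq (Filter.eventuallyEq_of_mem (h.isOpen.mem_nhds hx) hfg)

theorem covAlong_congr (hVW : ∀ y ∈ Ω, V y = W y) {x : E} (hx : x ∈ Ω) (X : E) :
    covAlong c F V x X = covAlong c F W x X := by
  rw [covAlong, covAlong, h.fderiv_congr hVW hx, hVW x hx]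

theorem smooth_dF : ContDiffOn ℝ ∞ (fderiv ℝ F) Ω := h.smooth_F.fderiv_of_isOpen h.isOpen (by simp)

theorem smooth_dF_apply {Y : E → E} (hY : ContDiffOn ℝ ∞ Y Ω) :
    ContDiffOn ℝ ∞ (fun y => fderiv ℝ F y (Y y)) Ω := h.smooth_dF.clm_apply hY

theorem smooth_cov (hV : ContDiffOn ℝ ∞ V Ω) {X : E → E} (hX : ContDiffOn ℝ ∞ X Ω) :
    ContDiffOn ℝ ∞ (fun y => covAlong c F V y (X y)) Ω :=
  ((hV.fderiv_of_isOpen h.isOpen (by simp) : ContDiffOn ℝ ∞ (fderiv ℝ V) Ω).clm_apply hX).add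
    (contDiffOn_christoffel_comp (fun _ => h.rho_ne) h.smooth_F (h.smooth_dF_apply hX) hV)

theorem fderiv_metric (hV : ContDiffOn ℝ ∞ V Ω) (hW : ContDiffOn ℝ ∞ W Ω) {x : E} (hx : x ∈ Ω)
    (X : E) : fderiv ℝ (fun y => metric c (F y) (V y) (W y)) x X =
      metric c (F x) (covAlong c F V x X) (W x) + metric c (F x) (V x) (covAlong c F W x X) := by
  have hm := contDiffOn_metric_comp (fun _ => h.rho_ne) h.smooth_F hV hW
  refine fderiv_eq_of_line (h.differentiableAt hm hx) ?_
  have := hasDerivAt_metric_comp (c := c) (t := 0) (by simpa using h.rho_ne hx)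
    ((h.differentiableAt h.smooth_F hx).hasDerivAt_line X)
    ((h.differentiableAt hV hx).hasDerivAt_line X) ((h.differentiableAt hW hx).hasDerivAt_line X)
  simpa [covAlong] using this

theorem fderiv_christoffel (hV : ContDiffOn ℝ ∞ V Ω) (hW : ContDiffOn ℝ ∞ W Ω) {x : E}
    (hx : x ∈ Ω) (X : E) : fderiv ℝ (fun y => christoffel c (F y) (V y) (W y)) x X =
      dchristoffel c (F x) (fderiv ℝ F x X) (V x) (W x) +
        christoffel c (F x) (fderiv ℝ V x X) (W x) +
        christoffel c (F x) (V x) (fderiv ℝ W x X) := by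
  have hm := contDiffOn_christoffel_comp (fun _ => h.rho_ne) h.smooth_F hV hW
  refine fderiv_eq_of_line (h.differentiableAt hm hx) ?_
  have := hasDerivAt_christoffel_comp (c := c) (t := 0) (by simpa using h.rho_ne hx)
    ((h.differentiableAt h.smooth_F hx).hasDerivAt_line X)
    ((h.differentiableAt hV hx).hasDerivAt_line X) ((h.differentiableAt hW hx).hasDerivAt_line X)
  simpa using this

theorem symm_fderiv {V : E → Coord n} (hV : ContDiffOn ℝ ∞ V Ω) {x : E} (hx : x ∈ Ω) (X Y : E) :
    fderiv ℝ (fderiv ℝ V) x X Y = fderiv ℝ (fderiv ℝ V) x Y X := by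
  have hs : IsSymmSndFDerivAt ℝ V x :=
    (hV.contDiffAt (h.isOpen.mem_nhds hx)).isSymmSndFDerivAt (by simpa using two_le_infty)
  exact hs.eq X Y

/-- The curvature of the pulled back connection. -/
theorem cov_cov (hV : ContDiffOn ℝ ∞ V Ω) {x : E} (hx : x ∈ Ω) (X Y : E) :
    covAlong c F (fun y => covAlong c F V y Y) x X - covAlong c F (fun y => covAlong c F V y X) x Y
      = curvature c (F x) (fderiv ℝ F x X) (fderiv ℝ F x Y) (V x) := by
  have sV : ContDiffOn ℝ ∞ (fderiv ℝ V) Ω := hV.fderiv_of_isOpen h.isOpen (by simp)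
  have dV := h.differentiableAt sV hx
  have dF := h.differentiableAt h.smooth_dF hx
  have key : ∀ X Y, covAlong c F (fun y => covAlong c F V y Y) x X =
      fderiv ℝ (fderiv ℝ V) x X Y + (dchristoffel c (F x) (fderiv ℝ F x X) (fderiv ℝ F x Y) (V x) +
        christoffel c (F x) (fderiv ℝ (fderiv ℝ F) x X Y) (V x) +
        christoffel c (F x) (fderiv ℝ F x Y) (fderiv ℝ V x X)) +
      (christoffel c (F x) (fderiv ℝ F x X) (fderiv ℝ V x Y) +
        christoffel c (F x) (fderiv ℝ F x X) (christoffel c (F x) (fderiv ℝ F x Y) (V x))) := by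
    intro X Y
    have sY : ContDiffOn ℝ ∞ (fun y => fderiv ℝ F y Y) Ω := h.smooth_dF_apply contDiffOn_const
    have := map_add (christoffelL c (F x) (fderiv ℝ F x X)) (fderiv ℝ V x Y)
      (christoffel c (F x) (fderiv ℝ F x Y) (V x))
    simp only [christoffelL_apply] at this
    rw [covAlong]
    simp only [covAlong]
    rw [this, fderiv_fun_add (dV.clm_apply (differentiableAt_const _))
      (h.differentiableAt (contDiffOn_christoffel_comp (fun _ => h.rho_ne) h.smooth_F sY hV) hx),
      add_apply, h.fderiv_christoffel sY hV hx,
      fderiv_clm_apply dV (differentiableAt_const _), fderiv_clm_apply dF (differentiableAt_const _)]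
    simp
  rw [key, key, ← curvature_eq _ _ _ _ (h.rho_ne hx), h.symm_fderiv hV hx X Y,
    h.symm_fderiv h.smooth_F hx X Y]
  abel

variable {x : E} (hx : x ∈ Ω)
include hx

theorem frameL_injective : Function.Injective (frameL F N x) := by
  rw [injective_iff_map_eq_zero]
  rintro ⟨X, t⟩ e
  rw [frameL_apply] at e
  have e1 := congrArg (fun v => metricL c (F x) v (N x)) e
  simp only [map_add, map_smul, add_apply, smul_apply, metricL_apply, h.normal x hx, h.unit x hx,
    map_zero, zero_apply, smul_eq_mul, mul_one, zero_add] at e1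
  subst e1
  rw [zero_smul, add_zero] at e
  rw [(injective_iff_map_eq_zero _).1 (h.injective x hx) X e]
  rfl

/-- An injective map between spaces of equal real dimension: dim E + 1 = 2n. -/
theorem exists_equiv : ∃ e : (E × ℝ) ≃L[ℝ] Coord n, (e : E × ℝ →L[ℝ] Coord n) = frameL F N x := by
  have hd : Module.finrank ℝ (E × ℝ) = Module.finrank ℝ (Coord n) := by
    rw [Module.finrank_prod, Module.finrank_self, h.finrank, ← Module.finrank_mul_finrank ℝ ℂ,
      Complex.finrank_real_complex, finrank_euclideanSpace_fin]
  refine ⟨(LinearEquiv.ofInjectiveOfFinrankEq (frameL F N x : E × ℝ →ₗ[ℝ] Coord n)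
    (h.frameL_injective hx) hd).toContinuousLinearEquiv, ?_⟩
  ext v <;> rfl

theorem tang_frame (X : E) (t : ℝ) : tang F N x (fderiv ℝ F x X + t • N x) = X := by
  obtain ⟨e, he⟩ := h.exists_equiv hx
  rw [← frameL_apply, ← he, tang, ← he, ContinuousLinearMap.inverse_equiv]
  simp

theorem tang_dF (X : E) : tang F N x (fderiv ℝ F x X) = X := by
  simpa using h.tang_frame hx X 0

theorem tang_N : tang F N x (N x) = 0 := by
  simpa using h.tang_frame hx 0 1

/-- The decomposition of an ambient vector into its tangential and normal components. -/
theorem dF_tang (v : Coord n) :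
    v = fderiv ℝ F x (tang F N x v) + metric c (F x) v (N x) • N x := by
  obtain ⟨e, he⟩ := h.exists_equiv hx
  obtain ⟨⟨X, t⟩, rfl⟩ := e.surjective v
  have e1 : e (X, t) = fderiv ℝ F x X + t • N x := by
    rw [← frameL_apply, ← he]; rfl
  have e2 : metric c (F x) (fderiv ℝ F x X + t • N x) (N x) = t := by
    rw [← metricL_apply, map_add, map_smul, add_apply, smul_apply, metricL_apply, metricL_apply,
      h.normal x hx, h.unit x hx, smul_eq_mul, mul_one, zero_add]
  rw [e1, h.tang_frame hx, e2]

/-- Inversion of operators is smooth at an invertible one, and the frame operator depends smoothly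
on the point. -/
theorem contDiffAt_tang : ContDiffAt ℝ ∞ (tang F N) x := by
  obtain ⟨e, he⟩ := h.exists_equiv hx
  have h1 : ContDiffOn ℝ ∞ (frameL F N) Ω := by
    rw [contDiffOn_clm_apply]
    rintro ⟨X, t⟩
    simp only [frameL_apply]
    exact (h.smooth_dF_apply contDiffOn_const).add ((contDiffOn_const (c := t)).fun_smul h.smooth_N)
  have h2 := (contDiffAt_map_inverse (n := ∞) e)
  rw [he] at h2
  exact contDiffAt_const.clm_comp (h2.comp x (h1.contDiffAt (h.isOpen.mem_nhds hx)))

omit hx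

theorem smooth_tang : ContDiffOn ℝ ∞ (tang F N) Ω :=
  fun _ hx => (h.contDiffAt_tang hx).contDiffWithinAt

end IsHypersurfaceOn
end CHn

/-! ### Gauss and Weingarten formulas, and the structure equations. -/

namespace CHn

variable {n : ℕ} {c : ℝ} {E : Type*} [NormedAddCommGroup E] [NormedSpace ℝ E]
  [FiniteDimensional ℝ E] {Ω : Set E} {F N V W : E → Coord n} {x : E}

/-- Multiplication by `I`. -/
noncomputable def mulI (n : ℕ) : Coord n →L[ℝ] Coord n :=
  Complex.I • ContinuousLinearMap.id ℝ (Coord n)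

/-- The first fundamental form. -/
noncomputable def firstForm (c : ℝ) (F : E → Coord n) (x : E) : E →L[ℝ] E →L[ℝ] ℝ :=
  (metricL c (F x)).bilinearComp (fderiv ℝ F x) (fderiv ℝ F x)

/-- The induced connection. -/
noncomputable def inducedConn (c : ℝ) (F N : E → Coord n) (x : E) : E →L[ℝ] E →L[ℝ] E :=
  (ContinuousLinearMap.compL ℝ E (Coord n) E (tang F N x)).comp
    (fderiv ℝ (fderiv ℝ F) x +
      (christoffelL c (F x)).bilinearComp (fderiv ℝ F x) (fderiv ℝ F x))

/-- The shape operator. -/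
noncomputable def shapeOp (c : ℝ) (F N : E → Coord n) (x : E) : E →L[ℝ] E :=
  -(tang F N x).comp (fderiv ℝ N x + ((christoffelL c (F x)).flip (N x)).comp (fderiv ℝ F x))

/-- The tangential part of the complex structure. -/
noncomputable def tangI (F N : E → Coord n) (x : E) : E →L[ℝ] E :=
  (tang F N x).comp ((mulI n).comp (fderiv ℝ F x))

/-- The Hopf vector field. -/
noncomputable def hopfField (F N : E → Coord n) (x : E) : E := tang F N x (Complex.I • N x)

@[simp] theorem firstForm_apply (x X Y : E) :
    firstForm c F x X Y = metric c (F x) (fderiv ℝ F x X) (fderiv ℝ F x Y) := rfl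

theorem inducedConn_apply (x X Y : E) : inducedConn c F N x X Y = tang F N x
    (fderiv ℝ (fderiv ℝ F) x X Y + christoffel c (F x) (fderiv ℝ F x X) (fderiv ℝ F x Y)) := rfl

theorem shapeOp_apply (x X : E) : shapeOp c F N x X = -tang F N x (covAlong c F N x X) := rfl

theorem tangI_apply (x X : E) : tangI F N x X = tang F N x (Complex.I • fderiv ℝ F x X) := rfl

theorem metric_add_left (z v v' w : Coord n) :
    metric c z (v + v') w = metric c z v w + metric c z v' w := by
  simp only [metric_eq_re, hermitian_add_left, Complex.add_re]

theorem metric_neg_left (z v w : Coord n) : metric c z (-v) w = - metric c z v w := by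
  simpa using metric_smul_left (c := c) z v w (-1)

namespace IsHypersurfaceOn

variable (h : IsHypersurfaceOn c Ω F N)
include h

theorem smooth_tang_apply (hV : ContDiffOn ℝ ∞ V Ω) :
    ContDiffOn ℝ ∞ (fun y => tang F N y (V y)) Ω := h.smooth_tang.clm_apply hV

theorem smooth_I (hV : ContDiffOn ℝ ∞ V Ω) : ContDiffOn ℝ ∞ (fun y => Complex.I • V y) Ω :=
  (mulI n).contDiff.comp_contDiffOn hV

theorem smooth_firstForm : ContDiffOn ℝ ∞ (firstForm c F) Ω := by
  refine contDiffOn_clm_apply.2 fun X => contDiffOn_clm_apply.2 fun Y => ?_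
  exact contDiffOn_metric_comp (fun _ => h.rho_ne) h.smooth_F (h.smooth_dF_apply contDiffOn_const)
    (h.smooth_dF_apply contDiffOn_const)

theorem smooth_inducedConn : ContDiffOn ℝ ∞ (inducedConn c F N) Ω := by
  refine contDiffOn_clm_apply.2 fun X => contDiffOn_clm_apply.2 fun Y => ?_
  have h2 : ContDiffOn ℝ ∞ (fderiv ℝ (fderiv ℝ F)) Ω :=
    h.smooth_dF.fderiv_of_isOpen h.isOpen (by simp)
  exact h.smooth_tang_apply (((h2.clm_apply contDiffOn_const).clm_apply contDiffOn_const).add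
    (contDiffOn_christoffel_comp (fun _ => h.rho_ne) h.smooth_F
      (h.smooth_dF_apply contDiffOn_const) (h.smooth_dF_apply contDiffOn_const)))

theorem smooth_shapeOp : ContDiffOn ℝ ∞ (shapeOp c F N) Ω :=
  contDiffOn_clm_apply.2 fun _ =>
    (h.smooth_tang_apply (h.smooth_cov h.smooth_N contDiffOn_const)).neg

theorem smooth_tangI : ContDiffOn ℝ ∞ (tangI F N) Ω :=
  contDiffOn_clm_apply.2 fun _ =>
    h.smooth_tang_apply (h.smooth_I (h.smooth_dF_apply contDiffOn_const))

theorem smooth_hopfField : ContDiffOn ℝ ∞ (hopfField F N) Ω :=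
  h.smooth_tang_apply (h.smooth_I h.smooth_N)

variable {x : E} (hx : x ∈ Ω)
include hx

theorem eq_of_frame {X Y : E} {s t : ℝ}
    (e : fderiv ℝ F x X + s • N x = fderiv ℝ F x Y + t • N x) : X = Y := by
  rw [← h.tang_frame hx X s, e, h.tang_frame hx]

theorem eq_dF_tang {v : Coord n} (hv : metric c (F x) v (N x) = 0) :
    fderiv ℝ F x (tang F N x v) = v := by
  conv_rhs => rw [h.dF_tang hx v, hv, zero_smul, add_zero]

/-- The Weingarten formula. -/
theorem cov_N (X : E) : covAlong c F N x X = -fderiv ℝ F x (shapeOp c F N x X) := by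
  have e := h.fderiv_metric h.smooth_N h.smooth_N hx X
  rw [h.fderiv_congr h.unit hx, metric_comm (F x) (N x)] at e
  simp only [fderiv_fun_const, Pi.zero_apply, zero_apply] at e
  rw [shapeOp_apply, map_neg, neg_neg, h.eq_dF_tang hx (by linarith)]

/-- The Gauss formula. -/
theorem cov_dF {Y : E → E} (hY : ContDiffOn ℝ ∞ Y Ω) (X : E) :
    covAlong c F (fun y => fderiv ℝ F y (Y y)) x X =
      fderiv ℝ F x (fderiv ℝ Y x X + inducedConn c F N x X (Y x)) +
      firstForm c F x (shapeOp c F N x X) (Y x) • N x := by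
  have e := h.fderiv_metric (h.smooth_dF_apply hY) h.smooth_N hx X
  rw [h.fderiv_congr (fun y hy => h.normal y hy (Y y)) hx, h.cov_N hx] at e
  simp only [fderiv_fun_const, Pi.zero_apply, zero_apply] at e
  rw [metric_comm _ _ (-_), metric_neg_left] at e
  conv_lhs => rw [h.dF_tang hx (covAlong c F (fun y => fderiv ℝ F y (Y y)) x X)]
  congr 2
  · rw [inducedConn_apply, covAlong, fderiv_clm_apply (h.differentiableAt h.smooth_dF hx)
      (h.differentiableAt hY hx)]
    simp only [add_apply, ContinuousLinearMap.comp_apply, ContinuousLinearMap.flip_apply, map_add,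
      h.tang_dF hx]
    abel
  · rw [firstForm_apply]; linarith

theorem cov_dF_const (X Y : E) : covAlong c F (fun y => fderiv ℝ F y Y) x X =
    fderiv ℝ F x (inducedConn c F N x X Y) + firstForm c F x (shapeOp c F N x X) Y • N x := by
  simpa using h.cov_dF hx (Y := fun _ => Y) contDiffOn_const X

theorem conn_comm (X Y : E) : inducedConn c F N x X Y = inducedConn c F N x Y X := by
  rw [inducedConn_apply, inducedConn_apply, h.symm_fderiv h.smooth_F hx, christoffel_comm]

theorem shape_symm (X Y : E) : firstForm c F x (shapeOp c F N x X) Y =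
    firstForm c F x X (shapeOp c F N x Y) := by
  have e : covAlong c F (fun y => fderiv ℝ F y Y) x X =
      covAlong c F (fun y => fderiv ℝ F y X) x Y := by
    simp only [covAlong]
    rw [fderiv_clm_apply (h.differentiableAt h.smooth_dF hx) (differentiableAt_const _),
      fderiv_clm_apply (h.differentiableAt h.smooth_dF hx) (differentiableAt_const _),
      christoffel_comm]
    simp [h.symm_fderiv h.smooth_F hx X Y]
  have hN : N x ≠ 0 := fun h0 => by
    have := h.unit x hx
    rw [h0, ← metricL_apply] at this
    simp at this
  rw [h.cov_dF_const hx, h.cov_dF_const hx, h.conn_comm hx] at e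
  have := smul_left_injective ℝ hN (add_left_cancel e)
  rw [this, firstForm_apply, firstForm_apply, metric_comm]

theorem I_N : Complex.I • N x = fderiv ℝ F x (hopfField F N x) :=
  (h.eq_dF_tang hx (metric_I_self _ _)).symm

theorem metric_I_dF_N (X : E) :
    metric c (F x) (Complex.I • fderiv ℝ F x X) (N x) = -firstForm c F x (hopfField F N x) X := by
  rw [firstForm_apply, ← h.I_N hx, metric_comm _ (Complex.I • N x), metric_I_right, neg_neg]

theorem I_dF (X : E) : Complex.I • fderiv ℝ F x X =
    fderiv ℝ F x (tangI F N x X) + (-firstForm c F x (hopfField F N x) X) • N x := by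
  rw [← h.metric_I_dF_N hx, tangI_apply]
  exact h.dF_tang hx _

theorem firstForm_tangI (X Y : E) :
    firstForm c F x (tangI F N x X) Y = metric c (F x) (Complex.I • fderiv ℝ F x X)
      (fderiv ℝ F x Y) := by
  rw [h.I_dF hx, metric_add_left, metric_smul_left, metric_comm _ (N x), h.normal x hx]
  simp

theorem tang_curvature (X Y : E) (v : Coord n) :
    tang F N x (curvature c (F x) (fderiv ℝ F x X) (fderiv ℝ F x Y) v) = (c / 4) •
      (metric c (F x) (fderiv ℝ F x Y) v • X - metric c (F x) (fderiv ℝ F x X) v • Y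
        + metric c (F x) (Complex.I • fderiv ℝ F x Y) v • tangI F N x X
        - metric c (F x) (Complex.I • fderiv ℝ F x X) v • tangI F N x Y
        - (2 * firstForm c F x (tangI F N x X) Y) • tang F N x (Complex.I • v)) := by
  rw [curvature, h.firstForm_tangI hx]
  simp only [map_smul, map_sub, map_add, h.tang_dF hx, tangI_apply]

/-- J is parallel, so differentiating Jξ = dF(u) and applying the Weingarten formula on one side and
the Gauss formula on the other leaves this tangential part. -/
theorem nabla_hopfField (X : E) :
    fderiv ℝ (hopfField F N) x X + inducedConn c F N x X (hopfField F N x) =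
      -tangI F N x (shapeOp c F N x X) := by
  have e := h.cov_dF hx h.smooth_hopfField X
  rw [← h.covAlong_congr (fun y hy => h.I_N hy) hx, covAlong_I (h.differentiableAt h.smooth_N hx),
    h.cov_N hx, smul_neg, ← smul_neg, ← map_neg, h.I_dF hx, map_neg] at e
  exact (h.eq_of_frame hx e).symm

theorem nabla_tangI (X Y : E) :
    fderiv ℝ (tangI F N) x X Y + inducedConn c F N x X (tangI F N x Y) -
      tangI F N x (inducedConn c F N x X Y) =
    firstForm c F x (shapeOp c F N x X) Y • hopfField F N x -
      firstForm c F x (hopfField F N x) Y • shapeOp c F N x X := by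
  have sY : ContDiffOn ℝ ∞ (fun y => fderiv ℝ F y Y) Ω := h.smooth_dF_apply contDiffOn_const
  have sφ : ContDiffOn ℝ ∞ (fun y => tangI F N y Y) Ω := h.smooth_tangI.clm_apply contDiffOn_const
  have sG : ContDiffOn ℝ ∞ (fun y => -firstForm c F y (hopfField F N y) Y) Ω :=
    ((h.smooth_firstForm.clm_apply h.smooth_hopfField).clm_apply contDiffOn_const).neg
  have e := covAlong_I (c := c) (F := F) (h.differentiableAt sY hx) X
  rw [h.covAlong_congr (fun y hy => h.I_dF hy Y) hx,
    covAlong_add (h.differentiableAt (h.smooth_dF_apply sφ) hx)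
      ((h.differentiableAt sG hx).fun_smul (h.differentiableAt h.smooth_N hx)),
    covAlong_smul (h.differentiableAt sG hx) (h.differentiableAt h.smooth_N hx), h.cov_dF hx sφ,
    h.cov_N hx, h.cov_dF_const hx, smul_add, smul_comm Complex.I, h.I_N hx, h.I_dF hx,
    fderiv_clm_apply (h.differentiableAt h.smooth_tangI hx) (differentiableAt_const _)] at e
  have e2 := congrArg (tang F N x) e
  simp only [map_add, map_smul, map_neg, h.tang_dF hx, h.tang_N hx, smul_zero, add_zero, smul_neg,
    neg_smul, neg_neg] at e2
  simp only [fderiv_fun_const, Pi.zero_apply, ContinuousLinearMap.comp_zero, zero_add,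
    ContinuousLinearMap.flip_apply] at e2
  rw [sub_eq_sub_iff_add_eq_add, e2, neg_zero, add_zero, add_comm]

/-- This is the tangential part of the ambient curvature applied to the unit normal, with the
Weingarten formula inserted twice. -/
theorem nabla_shapeOp (X Y : E) :
    (fderiv ℝ (shapeOp c F N) x X Y + inducedConn c F N x X (shapeOp c F N x Y) -
      shapeOp c F N x (inducedConn c F N x X Y)) -
    (fderiv ℝ (shapeOp c F N) x Y X + inducedConn c F N x Y (shapeOp c F N x X) -
      shapeOp c F N x (inducedConn c F N x Y X)) =
    (c / 4) • (firstForm c F x (hopfField F N x) Y • tangI F N x X -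
      firstForm c F x (hopfField F N x) X • tangI F N x Y +
      (2 * firstForm c F x (tangI F N x X) Y) • hopfField F N x) := by
  have key : ∀ X Y : E, tang F N x (covAlong c F (fun y => covAlong c F N y Y) x X) =
      -(fderiv ℝ (shapeOp c F N) x X Y + inducedConn c F N x X (shapeOp c F N x Y)) := by
    intro X Y
    have sS : ContDiffOn ℝ ∞ (fun y => -shapeOp c F N y Y) Ω :=
      (h.smooth_shapeOp.clm_apply contDiffOn_const).neg
    rw [h.covAlong_congr (W := fun y => fderiv ℝ F y (-shapeOp c F N y Y))
      (fun y hy => by rw [h.cov_N hy, map_neg]) hx, h.cov_dF hx sS, h.tang_frame hx,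
      fderiv_fun_neg, fderiv_clm_apply (h.differentiableAt h.smooth_shapeOp hx)
      (differentiableAt_const _)]
    simp
    abel
  have e := congrArg (tang F N x) (h.cov_cov h.smooth_N hx X Y)
  rw [map_sub, key, key, h.tang_curvature hx, h.normal x hx, h.normal x hx, h.metric_I_dF_N hx,
    h.metric_I_dF_N hx, ← hopfField] at e
  rw [h.conn_comm hx X Y, sub_sub_sub_cancel_right, ← neg_inj, ← smul_neg, neg_sub]
  rw [neg_sub_neg] at e
  rw [e]
  module

/-- This is the tangential part of the ambient curvature applied to dF(Z); the terms quadratic in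
the shape operator come from differentiating the normal in the Gauss formula. -/
theorem curv_inducedConn (X Y Z : E) :
    (fderiv ℝ (inducedConn c F N) x X Y Z + inducedConn c F N x X (inducedConn c F N x Y Z)) -
    (fderiv ℝ (inducedConn c F N) x Y X Z + inducedConn c F N x Y (inducedConn c F N x X Z)) =
    (c / 4) • (firstForm c F x Y Z • X - firstForm c F x X Z • Y
      + firstForm c F x (tangI F N x Y) Z • tangI F N x X
      - firstForm c F x (tangI F N x X) Z • tangI F N x Y
      - (2 * firstForm c F x (tangI F N x X) Y) • tangI F N x Z) +
    firstForm c F x (shapeOp c F N x Y) Z • shapeOp c F N x X -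
    firstForm c F x (shapeOp c F N x X) Z • shapeOp c F N x Y := by
  have sZ : ContDiffOn ℝ ∞ (fun y => fderiv ℝ F y Z) Ω := h.smooth_dF_apply contDiffOn_const
  have key : ∀ X Y : E, tang F N x (covAlong c F
      (fun y => covAlong c F (fun y => fderiv ℝ F y Z) y Y) x X) =
      fderiv ℝ (inducedConn c F N) x X Y Z + inducedConn c F N x X (inducedConn c F N x Y Z) -
      firstForm c F x (shapeOp c F N x Y) Z • shapeOp c F N x X := by
    intro X Y
    have dΓ := h.differentiableAt h.smooth_inducedConn hx
    have sΓ : ContDiffOn ℝ ∞ (fun y => inducedConn c F N y Y Z) Ω :=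
      (h.smooth_inducedConn.clm_apply contDiffOn_const).clm_apply contDiffOn_const
    have sG : ContDiffOn ℝ ∞ (fun y => firstForm c F y (shapeOp c F N y Y) Z) Ω :=
      (h.smooth_firstForm.clm_apply (h.smooth_shapeOp.clm_apply contDiffOn_const)).clm_apply
        contDiffOn_const
    rw [h.covAlong_congr (fun y hy => h.cov_dF_const hy Y Z) hx,
      covAlong_add (h.differentiableAt (h.smooth_dF_apply sΓ) hx)
      ((h.differentiableAt sG hx).fun_smul (h.differentiableAt h.smooth_N hx)),
      covAlong_smul (h.differentiableAt sG hx) (h.differentiableAt h.smooth_N hx), h.cov_dF hx sΓ,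
      h.cov_N hx, fderiv_clm_apply (dΓ.clm_apply (differentiableAt_const _))
      (differentiableAt_const _), fderiv_clm_apply dΓ (differentiableAt_const _)]
    simp only [map_add, map_smul, map_neg, h.tang_dF hx, h.tang_N hx, smul_zero]
    simp
    abel
  have e := congrArg (tang F N x) (h.cov_cov sZ hx X Y)
  rw [map_sub, key, key, h.tang_curvature hx, ← h.firstForm_tangI hx, ← h.firstForm_tangI hx,
    ← tangI_apply, ← firstForm_apply, ← firstForm_apply] at e
  rw [add_sub_assoc, ← e]
  abel

omit hx

theorem firstForm_pos (x : E) (hx : x ∈ Ω) (X : E) (hX : X ≠ 0) : 0 < firstForm c F x X X :=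
  metric_pos h.neg (h.mem_space x hx) fun h0 =>
    hX ((injective_iff_map_eq_zero _).1 (h.injective x hx) X h0)

theorem firstForm_hopfField {x : E} (hx : x ∈ Ω) :
    firstForm c F x (hopfField F N x) (hopfField F N x) = 1 := by
  rw [firstForm_apply, ← h.I_N hx, metric_I_I, h.unit x hx]

/-- The intrinsic data of an immersed hypersurface. -/
noncomputable def toChart : HypersurfaceChart (E := E) (c / 4) Ω where
  G := firstForm c F
  Γ := inducedConn c F N
  S := shapeOp c F N
  φ := tangI F N
  u := hopfField F N
  isOpen := h.isOpen
  contDiffOn_G := h.smooth_firstForm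
  contDiffOn_Γ := h.smooth_inducedConn
  contDiffOn_S := h.smooth_shapeOp
  contDiffOn_φ := h.smooth_tangI
  contDiffOn_u := h.smooth_hopfField
  G_comm x _ X Y := metric_comm _ _ _
  G_pos := h.firstForm_pos
  fderiv_G x hx X Y Z := by
    have e := h.fderiv_metric (V := fun y => fderiv ℝ F y Y) (W := fun y => fderiv ℝ F y Z)
      (h.smooth_dF_apply contDiffOn_const) (h.smooth_dF_apply contDiffOn_const) hx X
    have dG := h.differentiableAt h.smooth_firstForm hx
    rw [show (fun y => metric c (F y) (fderiv ℝ F y Y) (fderiv ℝ F y Z)) =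
      fun y => firstForm c F y Y Z from rfl,
      fderiv_clm_apply (dG.clm_apply (differentiableAt_const _)) (differentiableAt_const _),
      fderiv_clm_apply dG (differentiableAt_const _), h.cov_dF_const hx, h.cov_dF_const hx,
      metric_add_left, metric_smul_left, metric_comm _ (N x), h.normal x hx,
      metric_comm _ (fderiv ℝ F x Y), metric_add_left, metric_smul_left, metric_comm _ (N x),
      h.normal x hx, metric_comm _ _ (fderiv ℝ F x Y)] at e
    simpa using e
  Γ_comm x hx X Y := h.conn_comm hx X Y
  S_symm x hx X Y := h.shape_symm hx X Y
  φ_skew x hx X Y := by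
    rw [h.firstForm_tangI hx, firstForm_apply, metric_comm _ _ (fderiv ℝ F x (tangI F N x Y)),
      ← firstForm_apply, h.firstForm_tangI hx, metric_comm, metric_I_right]
  φ_φ x hx X := by
    have e := congrArg (tang F N x) (congrArg (fun v => Complex.I • v) (h.I_dF hx X))
    rw [smul_smul, Complex.I_mul_I, smul_add, smul_comm Complex.I _ (N x)] at e
    simp only [neg_smul, one_smul, map_neg, map_add, map_smul, h.tang_dF hx,
      ← tangI_apply] at e
    rw [← hopfField] at e
    rw [e]
    abel
  φ_u x hx := by
    rw [tangI_apply, ← h.I_N hx, smul_smul, Complex.I_mul_I, neg_one_smul, map_neg, h.tang_N hx,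
      neg_zero]
  G_u_u x hx := h.firstForm_hopfField hx
  nabla_u x hx X := h.nabla_hopfField hx X
  nabla_φ x hx X Y := h.nabla_tangI hx X Y
  codazzi x hx X Y := h.nabla_shapeOp hx X Y
  gauss x hx X Y Z := h.curv_inducedConn hx X Y Z

end IsHypersurfaceOn
end CHn

/-! ### From the manifold to local models. -/

namespace CHn

variable {n : ℕ} {c : ℝ} {M : Type*} [TopologicalSpace M]
  [ChartedSpace (EuclideanSpace ℝ (Fin (2 * n - 1))) M]
  {f ξ : M → Coord n}

/-- The intrinsic data of a hypersurface near a point `p`, together with its identification with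
the objects on the manifold by a local parametrization `σ` with differential `T`. -/
structure HypersurfaceModel (c : ℝ) (f ξ : M → Coord n) (p : M) where
  Ω : Set (EuclideanSpace ℝ (Fin (2 * n - 1)))
  chart : HypersurfaceChart (c / 4) Ω
  σ : EuclideanSpace ℝ (Fin (2 * n - 1)) → M
  T : ∀ x, EuclideanSpace ℝ (Fin (2 * n - 1)) →L[ℝ] TangentSpace (𝓡 (2 * n - 1)) (σ x)
  pt : EuclideanSpace ℝ (Fin (2 * n - 1))
  pt_mem : pt ∈ Ω
  σ_pt : σ pt = p
  image_mem : ∀ Ω' ⊆ Ω, IsOpen Ω' → pt ∈ Ω' → σ '' Ω' ∈ nhds p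
  bijective : ∀ x ∈ Ω, Function.Bijective (T x)
  mem_principalSpace : ∀ x ∈ Ω, ∀ ν X,
    T x X ∈ principalSpace c f ξ (σ x) ν ↔ chart.S x X = ν • X
  metric_T : ∀ x ∈ Ω, ∀ X Y,
    metric c (f (σ x)) (diff f (σ x) (T x X)) (diff f (σ x) (T x Y)) = chart.G x X Y
  I_normal : ∀ x ∈ Ω, Complex.I • ξ (σ x) = diff f (σ x) (T x (chart.u x))
  I_T : ∀ x ∈ Ω, ∀ X, Complex.I • diff f (σ x) (T x X) =
    diff f (σ x) (T x (chart.φ x X)) - chart.G x (chart.u x) X • ξ (σ x)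

/-- The same model on a smaller open set. -/
noncomputable def HypersurfaceModel.restrict {p : M} (m : HypersurfaceModel c f ξ p)
    {Ω' : Set (EuclideanSpace ℝ (Fin (2 * n - 1)))} (ho : IsOpen Ω') (hs : Ω' ⊆ m.Ω)
    (hp : m.pt ∈ Ω') : HypersurfaceModel c f ξ p where
  Ω := Ω'
  chart := m.chart.restrict ho hs
  σ := m.σ
  T := m.T
  pt := m.pt
  pt_mem := hp
  σ_pt := m.σ_pt
  image_mem Ω'' h := m.image_mem Ω'' (h.trans hs)
  bijective x hx := m.bijective x (hs hx)
  mem_principalSpace x hx := m.mem_principalSpace x (hs hx)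
  metric_T x hx := m.metric_T x (hs hx)
  I_normal x hx := m.I_normal x (hs hx)
  I_T x hx := m.I_T x (hs hx)

variable [IsManifold (𝓡 (2 * n - 1)) ∞ M]

section Chart

/-- The differential of the inverse chart at `p`. -/
noncomputable def dsymm (p : M) (x : EuclideanSpace ℝ (Fin (2 * n - 1))) :
    EuclideanSpace ℝ (Fin (2 * n - 1)) →L[ℝ]
      TangentSpace (𝓡 (2 * n - 1)) ((extChartAt (𝓡 (2 * n - 1)) p).symm x) :=
  mfderiv 𝓘(ℝ, EuclideanSpace ℝ (Fin (2 * n - 1))) (𝓡 (2 * n - 1))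
    (extChartAt (𝓡 (2 * n - 1)) p).symm x

variable {p : M} {x : EuclideanSpace ℝ (Fin (2 * n - 1))}
  (hx : x ∈ (extChartAt (𝓡 (2 * n - 1)) p).target)
include hx

theorem bijective_dsymm : Function.Bijective (dsymm p x) := by
  have : IsManifold (𝓡 (2 * n - 1)) 1 M := IsManifold.of_le (n := ∞) (by simp)
  have := isInvertible_mfderivWithin_extChartAt_symm hx
  rw [ModelWithCorners.range_eq_univ, mfderivWithin_univ] at this
  obtain ⟨e, he⟩ := this
  have e1 : ∀ X, e X = dsymm p x X := fun X => congrArg (fun L => L X) he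
  exact (funext e1 : ⇑e = ⇑(dsymm p x)) ▸ e.bijective

theorem mdifferentiableAt_symm : MDifferentiableAt 𝓘(ℝ, EuclideanSpace ℝ (Fin (2 * n - 1)))
    (𝓡 (2 * n - 1)) (extChartAt (𝓡 (2 * n - 1)) p).symm x := by
  have : IsManifold (𝓡 (2 * n - 1)) 1 M := IsManifold.of_le (n := ∞) (by simp)
  exact mdifferentiableOn_extChartAt_symm.mdifferentiableAt
    ((isOpen_extChartAt_target p).mem_nhds hx)

theorem fderiv_comp_symm {V : M → Coord n}
    (hV : ContMDiff (𝓡 (2 * n - 1)) 𝓘(ℝ, Coord n) ∞ V)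
    (X : EuclideanSpace ℝ (Fin (2 * n - 1))) :
    fderiv ℝ (V ∘ (extChartAt (𝓡 (2 * n - 1)) p).symm) x X =
      diff V ((extChartAt (𝓡 (2 * n - 1)) p).symm x) (dsymm p x X) := by
  rw [← mfderiv_eq_fderiv, mfderiv_comp x (hV.mdifferentiableAt (by simp))
    (mdifferentiableAt_symm hx)]
  rfl

omit hx in
theorem contDiffOn_comp_symm (p : M) {V : M → Coord n}
    (hV : ContMDiff (𝓡 (2 * n - 1)) 𝓘(ℝ, Coord n) ∞ V) :
    ContDiffOn ℝ ∞ (V ∘ (extChartAt (𝓡 (2 * n - 1)) p).symm)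
      (extChartAt (𝓡 (2 * n - 1)) p).target := by
  rw [← contMDiffOn_iff_contDiffOn]
  exact hV.comp_contMDiffOn (contMDiffOn_extChartAt_symm p)

end Chart

theorem IsRealHypersurface.pos (hM : IsRealHypersurface c f ξ) (p : M) : 0 < n := by
  rcases Nat.eq_zero_or_pos n with rfl | h
  · have := hM.unit p
    rw [Subsingleton.elim (ξ p) 0, ← metricL_apply] at this
    simp at this
  · exact h

theorem IsRealHypersurface.isHypersurfaceOn (hc : c < 0) (hM : IsRealHypersurface c f ξ) (p : M) :
    IsHypersurfaceOn c (extChartAt (𝓡 (2 * n - 1)) p).target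
      (f ∘ (extChartAt (𝓡 (2 * n - 1)) p).symm) (ξ ∘ (extChartAt (𝓡 (2 * n - 1)) p).symm) where
  neg := hc
  isOpen := isOpen_extChartAt_target p
  smooth_F := contDiffOn_comp_symm p hM.contMDiff
  smooth_N := contDiffOn_comp_symm p hM.contMDiff_normal
  mem_space x _ := hM.mem_space _
  injective x hx X Y e := by
    rw [fderiv_comp_symm hx hM.contMDiff, fderiv_comp_symm hx hM.contMDiff] at e
    exact (bijective_dsymm hx).1 (hM.immersion _ e)
  unit x _ := hM.unit _
  normal x hx X := by
    rw [fderiv_comp_symm hx hM.contMDiff]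
    exact hM.normal _ _
  finrank := by
    have := hM.pos p
    rw [finrank_euclideanSpace_fin]
    omega

theorem IsRealHypersurface.exists_model (hc : c < 0) (hM : IsRealHypersurface c f ξ) (p : M) :
    Nonempty (HypersurfaceModel c f ξ p) := by
  have h := hM.isHypersurfaceOn hc p
  refine ⟨{
    Ω := (extChartAt (𝓡 (2 * n - 1)) p).target
    chart := h.toChart
    σ := (extChartAt (𝓡 (2 * n - 1)) p).symm
    T := dsymm p
    pt := extChartAt (𝓡 (2 * n - 1)) p p
    pt_mem := mem_extChartAt_target p
    σ_pt := extChartAt_to_inv p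
    image_mem := ?_
    bijective := fun x hx => bijective_dsymm hx
    mem_principalSpace := ?_
    metric_T := ?_
    I_normal := ?_
    I_T := ?_ }⟩
  · intro Ω' _ ho hp
    filter_upwards [extChartAt_source_mem_nhds (I := 𝓡 (2 * n - 1)) p,
      (continuousAt_extChartAt (I := 𝓡 (2 * n - 1)) p).preimage_mem_nhds (ho.mem_nhds hp)]
      with q hq hq'
    exact ⟨_, hq', (extChartAt (𝓡 (2 * n - 1)) p).left_inv hq⟩
  · intro x hx ν X
    have e := h.cov_N hx X
    rw [covAlong, fderiv_comp_symm hx hM.contMDiff_normal, fderiv_comp_symm hx hM.contMDiff] at e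
    change -covDeriv c f ξ _ _ = ν • diff f _ _ ↔ shapeOp c _ _ x X = ν • X
    rw [covDeriv, ← fderiv_comp_symm hx hM.contMDiff]
    constructor
    · intro e2
      refine h.injective x hx ?_
      rw [map_smul, ← e2, ← neg_inj, neg_neg, ← e, fderiv_comp_symm hx hM.contMDiff]
      rfl
    · intro e2
      rw [← map_smul, ← e2, ← neg_inj, neg_neg, ← e, fderiv_comp_symm hx hM.contMDiff]
      rfl
  · intro x hx X Y
    rw [← fderiv_comp_symm hx hM.contMDiff, ← fderiv_comp_symm hx hM.contMDiff]
    rfl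
  · intro x hx
    rw [← fderiv_comp_symm hx hM.contMDiff]
    exact h.I_N hx
  · intro x hx X
    rw [← fderiv_comp_symm hx hM.contMDiff, ← fderiv_comp_symm hx hM.contMDiff, h.I_dF hx,
      neg_smul, ← sub_eq_add_neg]
    rfl

end CHn

/-! ### Local constancy of the Hopf curvatures, and the adapted frame. -/

namespace CHn

variable {n : ℕ} {c : ℝ} {M : Type*} [TopologicalSpace M]
  [ChartedSpace (EuclideanSpace ℝ (Fin (2 * n - 1))) M]
  {f ξ : M → Coord n}

/-- The principal curvatures whose principal curvature spaces are not orthogonal to the Hopf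
vector. -/
def hopfSet (c : ℝ) (f ξ : M → Coord n) (p : M) : Set ℝ :=
  {ν : ℝ | ∃ X ∈ principalSpace c f ξ p ν, metric c (f p) (Complex.I • ξ p) (diff f p X) ≠ 0}

namespace HypersurfaceModel

variable {p : M} (m : HypersurfaceModel c f ξ p)
  {x : EuclideanSpace ℝ (Fin (2 * n - 1))} (hx : x ∈ m.Ω)
include hx

theorem metric_I_normal (X : EuclideanSpace ℝ (Fin (2 * n - 1))) :
    metric c (f (m.σ x)) (Complex.I • ξ (m.σ x)) (diff f (m.σ x) (m.T x X)) =
      m.chart.G x (m.chart.u x) X := by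
  rw [m.I_normal x hx, m.metric_T x hx]

theorem mem_hopfSet {ν : ℝ} : ν ∈ hopfSet c f ξ (m.σ x) ↔
    ∃ X, m.chart.S x X = ν • X ∧ m.chart.G x (m.chart.u x) X ≠ 0 := by
  constructor
  · rintro ⟨Y, hY, hne⟩
    obtain ⟨X, rfl⟩ := (m.bijective x hx).2 Y
    rw [m.metric_I_normal hx] at hne
    exact ⟨X, (m.mem_principalSpace x hx ν X).1 hY, hne⟩
  · rintro ⟨X, hX, hne⟩
    rw [← m.metric_I_normal hx] at hne
    exact ⟨_, (m.mem_principalSpace x hx ν X).2 hX, hne⟩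

theorem mem_principalCurvatures {ν : ℝ} : ν ∈ principalCurvatures c f ξ (m.σ x) ↔
    ∃ X, X ≠ 0 ∧ m.chart.S x X = ν • X := by
  have hb := m.bijective x hx
  rw [principalCurvatures, Set.mem_ofPred_eq, Submodule.ne_bot_iff]
  constructor
  · rintro ⟨Y, hY, hne⟩
    obtain ⟨X, rfl⟩ := hb.2 Y
    exact ⟨X, fun h0 => hne (by rw [h0, map_zero]), (m.mem_principalSpace x hx ν X).1 hY⟩
  · rintro ⟨X, hne, hX⟩
    exact ⟨_, (m.mem_principalSpace x hx ν X).2 hX,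
      fun h0 => hne ((injective_iff_map_eq_zero _).1 hb.1 X h0)⟩

omit hx

variable {Λ : Finset ℝ}

theorem spectrumIn (hΛ : ∀ q, principalCurvatures c f ξ q = Λ) : m.chart.SpectrumIn Λ := by
  intro x hx v hv ν hS
  have := (m.mem_principalCurvatures hx).2 ⟨v, hv, hS⟩
  rwa [hΛ, Finset.mem_coe] at this

theorem mem_hopfSet_iff_proj (hΛ : ∀ q, principalCurvatures c f ξ q = Λ) (hx : x ∈ m.Ω) {ν : ℝ}  :
    ν ∈ hopfSet c f ξ (m.σ x) ↔ m.chart.proj Λ ν x (m.chart.u x) ≠ 0 := by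
  have spec := m.spectrumIn hΛ
  rw [m.mem_hopfSet hx]
  constructor
  · rintro ⟨X, hX, hne⟩ h0
    have hX0 : X ≠ 0 := by rintro rfl; simp at hne
    rw [HypersurfaceChart.G_proj_of_eigen spec hx (spec x hx X hX0 ν hX) hX, h0] at hne
    simp at hne
  · intro hne
    have hS := HypersurfaceChart.S_proj spec hx ν (m.chart.u x)
    refine ⟨_, hS, ?_⟩
    rw [HypersurfaceChart.G_proj_of_eigen spec hx (spec x hx _ hne ν hS) hS]
    exact (m.chart.G_pos x hx _ hne).ne'

variable {l₁ l₂ l₃ : ℝ} {U V : EuclideanSpace ℝ (Fin (2 * n - 1)) → EuclideanSpace ℝ (Fin (2 * n - 1))}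

theorem hopfSet_eq (h : m.chart.IsHopfSplit Λ l₁ l₂ U V) (hx : x ∈ m.Ω) :
    hopfSet c f ξ (m.σ x) = {l₁, l₂} := by
  ext ν
  rw [m.mem_hopfSet hx]
  constructor
  · rintro ⟨X, hX, hne⟩
    by_contra hcon
    rw [Set.mem_insert_iff, Set.mem_singleton_iff, not_or] at hcon
    exact hne (h.G_u_of_eigen hx hcon.1 hcon.2 hX)
  · rintro (rfl | rfl)
    · exact ⟨U x, h.S_U x hx, by rw [h.G_u_U hx]; exact (h.b_pos hx).ne'⟩
    · exact ⟨V x, h.S_V x hx, by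
        rw [h.G_u_V hx]; exact (m.chart.G_pos x hx _ (h.V_ne x hx)).ne'⟩

end HypersurfaceModel

section Global

variable [IsManifold (𝓡 (2 * n - 1)) ∞ M] {Λ : Finset ℝ}
  (hc : c < 0) (hM : IsRealHypersurface c f ξ)
  (hΛ : ∀ q, principalCurvatures c f ξ q = Λ)
include hc hM hΛ

/-- The two projections of u that are nonzero at `p` remain nonzero nearby. Since exactly two are
nonzero at every point, no third one can appear, and the two add up to u. -/
theorem exists_hopfSplit (hh : ∀ q, hopfNumber c f ξ q = 2) (p : M) :
    ∃ (m : HypersurfaceModel c f ξ p) (l₁ l₂ : ℝ)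
      (U V : EuclideanSpace ℝ (Fin (2 * n - 1)) → EuclideanSpace ℝ (Fin (2 * n - 1))),
      m.chart.IsHopfSplit Λ l₁ l₂ U V := by
  obtain ⟨m⟩ := hM.exists_model hc p
  have hcard : ∀ q, (hopfSet c f ξ q).ncard = 2 := hh
  obtain ⟨a, b, hab, he⟩ := Set.ncard_eq_two.1 (hcard (m.σ m.pt))
  have spec := m.spectrumIn hΛ
  have smooth : ∀ ν, ContDiffOn ℝ ∞ (fun y => m.chart.proj Λ ν y (m.chart.u y)) m.Ω := fun ν =>
    (HypersurfaceChart.contDiffOn_proj ν).clm_apply m.chart.contDiffOn_u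
  have ho : ∀ ν, IsOpen (m.Ω ∩ {y | m.chart.proj Λ ν y (m.chart.u y) ≠ 0}) := fun ν =>
    (smooth ν).continuousOn.isOpen_inter_preimage m.chart.isOpen isOpen_ne
  have ho' := (ho a).inter (ho b)
  have hs : (m.Ω ∩ {y | m.chart.proj Λ a y (m.chart.u y) ≠ 0}) ∩
    (m.Ω ∩ {y | m.chart.proj Λ b y (m.chart.u y) ≠ 0}) ⊆ m.Ω := fun y hy => hy.1.1
  have ha := (m.mem_hopfSet_iff_proj hΛ m.pt_mem (ν := a)).1 (by rw [he]; simp)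
  have hb := (m.mem_hopfSet_iff_proj hΛ m.pt_mem (ν := b)).1 (by rw [he]; simp)
  refine ⟨m.restrict ho' hs ⟨⟨m.pt_mem, ha⟩, m.pt_mem, hb⟩, a, b,
    fun y => m.chart.proj Λ a y (m.chart.u y), fun y => m.chart.proj Λ b y (m.chart.u y), ?_⟩
  refine
    { spec := fun y hy => spec y (hs hy)
      neg := by linarith
      ne := hab
      smooth_U := (smooth a).mono hs
      smooth_V := (smooth b).mono hs
      S_U := fun y hy => HypersurfaceChart.S_proj spec (hs hy) a _
      S_V := fun y hy => HypersurfaceChart.S_proj spec (hs hy) b _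
      add := fun y hy => ?_
      U_ne := fun y hy => hy.1.2
      V_ne := fun y hy => hy.2.2 }
  have ha' := (m.mem_hopfSet_iff_proj hΛ (hs hy)).2 hy.1.2
  have hb' := (m.mem_hopfSet_iff_proj hΛ (hs hy)).2 hy.2.2
  have heq : {a, b} = hopfSet c f ξ (m.σ y) := by
    refine Set.eq_of_subset_of_ncard_le ?_ ?_ (Set.finite_of_ncard_ne_zero (by simp [hcard]))
    · rintro _ (rfl | rfl)
      · exact ha'
      · exact hb'
    · rw [hcard, Set.ncard_pair hab]
  have mem : ∀ ν, m.chart.proj Λ ν y (m.chart.u y) ≠ 0 → ν ∈ Λ := fun ν hν =>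
    spec y (hs hy) _ hν ν (HypersurfaceChart.S_proj spec (hs hy) ν _)
  change _ = m.chart.u y
  conv_rhs => rw [← HypersurfaceChart.sum_proj spec (hs hy) (m.chart.u y)]
  symm
  refine Finset.sum_eq_add a b hab ?_ ?_ ?_
  · rintro ν - ⟨h1, h2⟩
    by_contra hne
    have := (m.mem_hopfSet_iff_proj hΛ (hs hy)).2 hne
    rw [← heq] at this
    rcases this with h | h
    · exact h1 h
    · exact h2 h
  · exact fun h => absurd (mem a hy.1.2) h
  · exact fun h => absurd (mem b hy.2.2) h

theorem exists_hopfFrame (hh : ∀ q, hopfNumber c f ξ q = 2) (p : M) :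
    ∃ (m : HypersurfaceModel c f ξ p) (l₁ l₂ l₃ : ℝ)
      (U V : EuclideanSpace ℝ (Fin (2 * n - 1)) → EuclideanSpace ℝ (Fin (2 * n - 1))),
      m.chart.IsHopfFrame Λ l₁ l₂ l₃ U V := by
  obtain ⟨m, l₁, l₂, U, V, h⟩ := exists_hopfSplit hc hM hΛ hh p
  obtain ⟨l₃, h1, h2, Ω', hs, ho, hp, hA⟩ := h.exists_S_A_nhds m.pt_mem
  exact ⟨m.restrict ho hs hp, l₁, l₂, l₃, U, V,
    { toIsHopfSplit := h.restrict ho hs, ne₁ := h1, ne₂ := h2, S_A := hA }⟩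

/-- A local Hopf split keeps its two eigenvalues throughout its domain, so the pair is locally
constant and connectedness makes it global. -/
theorem exists_hopfSet_eq [ConnectedSpace M] (hh : ∀ q, hopfNumber c f ξ q = 2) :
    ∃ a b : ℝ, a < b ∧ ∀ p, hopfSet c f ξ p = {a, b} := by
  have hloc : IsLocallyConstant (hopfSet c f ξ) := by
    rw [IsLocallyConstant.iff_eventually_eq]
    intro p
    obtain ⟨m, l₁, l₂, U, V, h⟩ := exists_hopfSplit hc hM hΛ hh p
    have e := m.hopfSet_eq h m.pt_mem
    rw [m.σ_pt] at e
    filter_upwards [m.image_mem m.Ω subset_rfl m.chart.isOpen m.pt_mem] with q hq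
    obtain ⟨y, hy, rfl⟩ := hq
    rw [m.hopfSet_eq h hy, e]
  obtain ⟨p⟩ := (inferInstance : Nonempty M)
  obtain ⟨a, b, hab, he⟩ := Set.ncard_eq_two.1 (hh p)
  have hall : ∀ q, hopfSet c f ξ q = {a, b} := fun q =>
    (hloc.apply_eq_of_preconnectedSpace q p).trans he
  rcases lt_or_gt_of_ne hab with h | h
  · exact ⟨a, b, h, hall⟩
  · exact ⟨b, a, h, fun q => (hall q).trans (Set.pair_comm a b)⟩

theorem exists_hopfFrame_of_hopfSet {a b : ℝ} (hab : a ≠ b)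
    (he : ∀ q, hopfSet c f ξ q = {a, b}) (p : M) :
    ∃ (m : HypersurfaceModel c f ξ p)
      (U V : EuclideanSpace ℝ (Fin (2 * n - 1)) → EuclideanSpace ℝ (Fin (2 * n - 1))),
      m.chart.IsHopfFrame Λ a b ((a + b) / 3) U V := by
  have hh : ∀ q, hopfNumber c f ξ q = 2 := fun q => by
    change (hopfSet c f ξ q).ncard = 2
    rw [he q, Set.ncard_pair hab]
  obtain ⟨m, l₁, l₂, l₃, U, V, h⟩ := exists_hopfFrame hc hM hΛ hh p
  have e := m.hopfSet_eq h.toIsHopfSplit m.pt_mem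
  rw [he] at e
  have hs := h.sum_eq m.pt_mem
  rcases Set.pair_eq_pair_iff.1 e with ⟨rfl, rfl⟩ | ⟨rfl, rfl⟩
  · obtain rfl : l₃ = (a + b) / 3 := by linarith
    exact ⟨m, U, V, h⟩
  · obtain rfl : l₃ = (a + b) / 3 := by linarith
    exact ⟨m, V, U, h.swap⟩

end Global

section Frame

variable {p : M} (m : HypersurfaceModel c f ξ p) {Λ : Finset ℝ} {a b l : ℝ}
  {U V : EuclideanSpace ℝ (Fin (2 * n - 1)) → EuclideanSpace ℝ (Fin (2 * n - 1))}
  (h : m.chart.IsHopfFrame Λ a b l U V)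
  {x : EuclideanSpace ℝ (Fin (2 * n - 1))} (hx : x ∈ m.Ω)
include h hx

theorem HypersurfaceModel.spectrum_eq (hΛ : ∀ q, principalCurvatures c f ξ q = Λ) :
    Λ = {a, b, l} ∨ ∃ κ, κ ≠ a ∧ κ ≠ b ∧ κ ≠ l ∧ Λ = {a, b, l, κ} := by
  classical
  have ha : a ∈ Λ := h.spec x hx _ (h.U_ne x hx) a (h.S_U x hx)
  have hb : b ∈ Λ := h.spec x hx _ (h.V_ne x hx) b (h.S_V x hx)
  have hl : l ∈ Λ := by
    refine h.spec x hx _ (fun h0 => ?_) l (h.S_A x hx)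
    have := h.toIsHopfSplit.G_A_A_pos hx
    rw [h0] at this
    simp at this
  have key : ∀ κ ∈ Λ, κ ≠ a → κ ≠ b → κ ≠ l → l * κ = -(c / 4) := by
    intro κ hκ h1 h2 h3
    rw [← Finset.mem_coe, ← hΛ (m.σ x), m.mem_principalCurvatures hx] at hκ
    obtain ⟨w, hw0, hw⟩ := hκ
    exact h.mul_eq_of_ne hx hw0 hw h1 h2 h3
  by_cases hex : ∃ κ ∈ Λ, κ ≠ a ∧ κ ≠ b ∧ κ ≠ l
  · obtain ⟨κ, hκ, h1, h2, h3⟩ := hex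
    refine Or.inr ⟨κ, h1, h2, h3, ?_⟩
    have e := key κ hκ h1 h2 h3
    -- A fourth curvature κ satisfies lκ = -c/4 > 0. Hence l is nonzero and the equation determines
    -- κ, excluding a fifth one.
    have hl0 : l ≠ 0 := by
      rintro rfl
      have := h.neg
      linarith
    ext ν
    simp only [Finset.mem_insert, Finset.mem_singleton]
    constructor
    · intro hν
      by_contra! hcon
      obtain ⟨g1, g2, g3, g4⟩ := hcon
      exact g4 (mul_left_cancel₀ hl0 ((key ν hν g1 g2 g3).trans e.symm))
    · rintro (rfl | rfl | rfl | rfl) <;> assumption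
  · push Not at hex
    refine Or.inl ?_
    ext ν
    simp only [Finset.mem_insert, Finset.mem_singleton]
    constructor
    · intro hν
      by_contra! hcon
      exact hcon.2.2 (hex ν hν hcon.1 hcon.2.1)
    · rintro (rfl | rfl | rfl) <;> assumption

/-- The adapted orthonormal frame. -/
theorem HypersurfaceModel.exists_frame : ∃ U₁ ∈ principalSpace c f ξ (m.σ x) a,
    ∃ U₂ ∈ principalSpace c f ξ (m.σ x) b, ∃ A ∈ principalSpace c f ξ (m.σ x) l,
      ∃ b₁ b₂ : ℝ, 0 < b₁ ∧ 0 < b₂ ∧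
      metric c (f (m.σ x)) (diff f (m.σ x) U₁) (diff f (m.σ x) U₁) = 1 ∧
      metric c (f (m.σ x)) (diff f (m.σ x) U₂) (diff f (m.σ x) U₂) = 1 ∧
      metric c (f (m.σ x)) (diff f (m.σ x) A) (diff f (m.σ x) A) = 1 ∧
      Complex.I • ξ (m.σ x) = b₁ • diff f (m.σ x) U₁ + b₂ • diff f (m.σ x) U₂ ∧
      Complex.I • diff f (m.σ x) A = b₂ • diff f (m.σ x) U₁ - b₁ • diff f (m.σ x) U₂ := by
  have hU := h.b_pos hx
  have hV := m.chart.G_pos x hx _ (h.V_ne x hx)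
  have hVV := h.G_V_V hx
  have hAA := h.toIsHopfSplit.G_A_A hx
  obtain ⟨s, hs, hs2⟩ : ∃ s : ℝ, 0 < s ∧ s ^ 2 = m.chart.G x (U x) (U x) :=
    ⟨_, Real.sqrt_pos.2 hU, Real.sq_sqrt hU.le⟩
  obtain ⟨t, ht, ht2⟩ : ∃ t : ℝ, 0 < t ∧ t ^ 2 = m.chart.G x (V x) (V x) :=
    ⟨_, Real.sqrt_pos.2 hV, Real.sq_sqrt hV.le⟩
  have hst : t ^ 2 = 1 - s ^ 2 := by rw [ht2, hs2, hVV]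
  have hs0 := hs.ne'
  have ht0 := ht.ne'
  -- Here s = |U| and t = |V|, so |φU| = st. The minus sign in the third vector is dictated by φ²U =
  -- s²V - t²U and the required form of JA.
  refine ⟨m.T x (s⁻¹ • U x), (m.mem_principalSpace x hx _ _).2 ?_,
    m.T x (t⁻¹ • V x), (m.mem_principalSpace x hx _ _).2 ?_,
    m.T x (-(s * t)⁻¹ • m.chart.φ x (U x)), (m.mem_principalSpace x hx _ _).2 ?_,
    s, t, hs, ht, ?_, ?_, ?_, ?_, ?_⟩
  · rw [map_smul, h.S_U x hx, smul_comm]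
  · rw [map_smul, h.S_V x hx, smul_comm]
  · rw [map_smul, h.S_A x hx, smul_comm]
  · rw [m.metric_T x hx]
    simp only [map_smul, smul_apply, smul_eq_mul, ← hs2]
    field_simp
  · rw [m.metric_T x hx]
    simp only [map_smul, smul_apply, smul_eq_mul, ← ht2]
    field_simp
  · rw [m.metric_T x hx]
    simp only [map_smul, smul_apply, smul_eq_mul, hAA, ← hs2, ← hst]
    field_simp
  · rw [m.I_normal x hx, ← h.add x hx]
    simp only [map_smul, map_add, smul_smul, mul_inv_cancel₀ hs0, mul_inv_cancel₀ ht0, one_smul]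
  · rw [m.I_T x hx, map_smul, h.toIsHopfSplit.φ_φ_U hx]
    have e0 : m.chart.G x (m.chart.u x) (-(s * t)⁻¹ • m.chart.φ x (U x)) = 0 := by
      rw [map_smul, h.toIsHopfSplit.G_u_of_eigen hx h.ne₁ h.ne₂ (h.S_A x hx), smul_zero]
    rw [e0, zero_smul, sub_zero, ← hs2, ← hst]
    simp only [smul_sub, smul_smul]
    have e1 : -(s * t)⁻¹ * s ^ 2 = -(s * t⁻¹) := by field_simp
    have e2 : -(s * t)⁻¹ * t ^ 2 = -(t * s⁻¹) := by field_simp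
    rw [e1, e2]
    simp only [map_sub, map_smul]
    module

end Frame
end CHn

/-! ### Change of normal, labellings and multiplicities. -/

namespace CHn

variable {n : ℕ} {c : ℝ} {M : Type*} [TopologicalSpace M]
  [ChartedSpace (EuclideanSpace ℝ (Fin (2 * n - 1))) M]
  {f ξ : M → Coord n}

section Neg

theorem diff_neg (ξ : M → Coord n) (p : M) : diff (-ξ) p = -diff ξ p := mfderiv_neg

theorem principalSpace_neg (p : M) (ν : ℝ) :
    principalSpace c f (-ξ) p ν = principalSpace c f ξ p (-ν) := by
  ext X
  have := map_neg (christoffelL c (f p) (diff f p X)) (ξ p)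
  simp only [christoffelL_apply] at this
  change -covDeriv c f (-ξ) p X = ν • diff f p X ↔ -covDeriv c f ξ p X = (-ν) • diff f p X
  rw [covDeriv, diff_neg, Pi.neg_apply, this, ← neg_inj, neg_smul]
  simp only [covDeriv]
  rw [show (-diff ξ p) X = -(diff ξ p X) from rfl, ← neg_add, neg_neg]

theorem hopfSet_neg (p : M) : hopfSet c f (-ξ) p = Neg.neg '' hopfSet c f ξ p := by
  have key : ∀ X, metric c (f p) (Complex.I • (-ξ) p) (diff f p X) =
      -metric c (f p) (Complex.I • ξ p) (diff f p X) := fun X => by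
    rw [Pi.neg_apply, smul_neg, metric_neg_left]
  ext ν
  simp only [hopfSet, principalSpace_neg, key, Set.image_neg_eq_neg, Set.mem_neg, Set.mem_ofPred_eq,
    neg_ne_zero]

theorem hopfNumber_neg (p : M) : hopfNumber c f (-ξ) p = hopfNumber c f ξ p := by
  change (hopfSet c f (-ξ) p).ncard = (hopfSet c f ξ p).ncard
  rw [hopfSet_neg, Set.ncard_image_of_injective _ neg_injective]

theorem IsRealHypersurface.neg (hM : IsRealHypersurface c f ξ) : IsRealHypersurface c f (-ξ) where
  mem_space := hM.mem_space
  contMDiff := hM.contMDiff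
  immersion := hM.immersion
  contMDiff_normal :=
    (contDiff_neg (𝕜 := ℝ) (n := ∞) (F := Coord n)).contMDiff.comp hM.contMDiff_normal
  unit p := by
    rw [Pi.neg_apply, metric_neg_left, metric_comm, metric_neg_left, neg_neg, hM.unit]
  normal p X := by
    rw [Pi.neg_apply, metric_comm, metric_neg_left, metric_comm, hM.normal, neg_zero]

theorem HasConstantPrincipalCurvatures.neg {g : ℕ} {mu : ℕ → ℝ}
    (h : HasConstantPrincipalCurvatures c f ξ g mu) :
    HasConstantPrincipalCurvatures c f (-ξ) g (-mu) where
  injOn i hi j hj e := h.injOn hi hj (neg_injective e)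
  eq_image p := by
    have : principalCurvatures c f (-ξ) p = Neg.neg '' principalCurvatures c f ξ p := by
      ext ν
      simp only [principalCurvatures, principalSpace_neg, Set.image_neg_eq_neg, Set.mem_neg,
        Set.mem_ofPred_eq]
    rw [this, h.eq_image, Set.image_image]
    rfl

end Neg

theorem HasConstantPrincipalCurvatures.exists_finset {g : ℕ} {mu : ℕ → ℝ}
    (h : HasConstantPrincipalCurvatures c f ξ g mu) :
    ∃ Λ : Finset ℝ, Λ.card = g ∧ (Λ : Set ℝ) = mu '' Set.Icc 1 g ∧
      ∀ q, principalCurvatures c f ξ q = Λ := by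
  classical
  have e : (((Finset.Icc 1 g).image mu : Finset ℝ) : Set ℝ) = mu '' Set.Icc 1 g := by
    rw [Finset.coe_image, Finset.coe_Icc]
  refine ⟨(Finset.Icc 1 g).image mu, ?_, e, fun q => ?_⟩
  · rw [Finset.card_image_of_injOn (by rw [Finset.coe_Icc]; exact h.injOn), Nat.card_Icc]
    omega
  · rw [h.eq_image, e]

variable [IsManifold (𝓡 (2 * n - 1)) ∞ M]

theorem card_principalCurvatures [ConnectedSpace M] (hc : c < 0) (hM : IsRealHypersurface c f ξ)
    {Λ : Finset ℝ} (hΛ : ∀ q, principalCurvatures c f ξ q = Λ) {a b : ℝ} (hab : a ≠ b)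
    (he : ∀ q, hopfSet c f ξ q = {a, b}) :
    ((a + b) / 3 ≠ a ∧ (a + b) / 3 ≠ b) ∧ (Λ = {a, b, (a + b) / 3} ∧ Λ.card = 3 ∨
      ∃ κ, κ ≠ a ∧ κ ≠ b ∧ κ ≠ (a + b) / 3 ∧ Λ = {a, b, (a + b) / 3, κ} ∧ Λ.card = 4) := by
  obtain ⟨p⟩ := (inferInstance : Nonempty M)
  obtain ⟨m, U, V, h⟩ := exists_hopfFrame_of_hopfSet hc hM hΛ hab he p
  have h1 := h.ne₁
  have h2 := h.ne₂
  refine ⟨⟨h1, h2⟩, ?_⟩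
  rcases m.spectrum_eq h m.pt_mem hΛ with e | ⟨κ, g1, g2, g3, e⟩
  · refine Or.inl ⟨e, ?_⟩
    rw [e, Finset.card_eq_three]
    exact ⟨_, _, _, hab, h1.symm, h2.symm, rfl⟩
  · refine Or.inr ⟨κ, g1, g2, g3, e, ?_⟩
    rw [e, Finset.card_insert_of_notMem, Finset.card_insert_of_notMem, Finset.card_pair g3.symm]
    · simp [h2.symm, g2.symm]
    · simp [hab, h1.symm, g1.symm]

theorem exists_adaptedLabelling [ConnectedSpace M] (hc : c < 0) (hM : IsRealHypersurface c f ξ)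
    {g : ℕ} {mu : ℕ → ℝ} (hmu : HasConstantPrincipalCurvatures c f ξ g mu) {a b : ℝ} (hab : a < b)
    (h0 : 0 ≤ a + b) (he : ∀ q, hopfSet c f ξ q = {a, b}) :
    ∃ lam : ℕ → ℝ, IsAdaptedLabelling c f ξ g lam := by
  obtain ⟨Λ, hg, -, hΛ⟩ := hmu.exists_finset
  obtain ⟨⟨h1, h2⟩, hcase⟩ := card_principalCurvatures hc hM hΛ hab.ne he
  have frame : ∀ p, ∃ U₁ ∈ principalSpace c f ξ p a, ∃ U₂ ∈ principalSpace c f ξ p b,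
      ∃ A ∈ principalSpace c f ξ p ((a + b) / 3), ∃ b₁ b₂ : ℝ, 0 < b₁ ∧ 0 < b₂ ∧
      metric c (f p) (diff f p U₁) (diff f p U₁) = 1 ∧
      metric c (f p) (diff f p U₂) (diff f p U₂) = 1 ∧
      metric c (f p) (diff f p A) (diff f p A) = 1 ∧
      Complex.I • ξ p = b₁ • diff f p U₁ + b₂ • diff f p U₂ ∧
      Complex.I • diff f p A = b₂ • diff f p U₁ - b₁ • diff f p U₂ := by
    intro p
    obtain ⟨m, U, V, h⟩ := exists_hopfFrame_of_hopfSet hc hM hΛ hab.ne he p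
    have := m.exists_frame h m.pt_mem
    rwa [m.σ_pt] at this
  rcases hcase with ⟨e, hcard⟩ | ⟨κ, g1, g2, g3, e, hcard⟩
  · obtain rfl : g = 3 := hg.symm.trans hcard
    refine ⟨fun i => if i = 1 then a else if i = 2 then b else (a + b) / 3,
      { injOn := ?_, eq_image := ?_, three_le := le_rfl, lt := hab,
        nonneg := by simp; positivity, frame := frame }⟩
    · rintro i ⟨hi, hi'⟩ j ⟨hj, hj'⟩ hij
      interval_cases i <;> interval_cases j <;>
        simp [hab.ne, hab.ne.symm, h1, h2, h1.symm, h2.symm] at hij ⊢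
    · intro p
      have hI : Set.Icc 1 3 = ({1, 2, 3} : Set ℕ) := by ext i; simp; omega
      rw [hΛ, e, hI]
      simp [Set.image_insert_eq]
  · obtain rfl : g = 4 := hg.symm.trans hcard
    refine ⟨fun i => if i = 1 then a else if i = 2 then b else if i = 3 then (a + b) / 3 else κ,
      { injOn := ?_, eq_image := ?_, three_le := by norm_num, lt := hab,
        nonneg := by simp; positivity, frame := frame }⟩
    · rintro i ⟨hi, hi'⟩ j ⟨hj, hj'⟩ hij
      interval_cases i <;> interval_cases j <;>
        simp [hab.ne, hab.ne.symm, h1, h2, h1.symm, h2.symm, g1, g2, g3, g1.symm, g2.symm,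
          g3.symm] at hij ⊢
    · intro p
      have hI : Set.Icc 1 4 = ({1, 2, 3, 4} : Set ℕ) := by ext i; simp; omega
      rw [hΛ, e, hI]
      simp [Set.image_insert_eq]

namespace IsAdaptedLabelling

variable {g : ℕ} {lam : ℕ → ℝ} (hl : IsAdaptedLabelling c f ξ g lam)
include hl

theorem lam_ne {i j : ℕ} (hi : i ∈ Set.Icc 1 g) (hj : j ∈ Set.Icc 1 g) (hij : i ≠ j) :
    lam i ≠ lam j := fun e => hij (hl.injOn hi hj e)

/-- The frame of an adapted labelling, in a model. -/
theorem frame_model {p : M} (m : HypersurfaceModel c f ξ p) (hM : IsRealHypersurface c f ξ)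
    {x : EuclideanSpace ℝ (Fin (2 * n - 1))} (hx : x ∈ m.Ω) :
    ∃ X₁ X₂ X₃ b₁ b₂, 0 < b₁ ∧ 0 < b₂ ∧ m.chart.S x X₁ = lam 1 • X₁ ∧ m.chart.S x X₂ = lam 2 • X₂ ∧
      m.chart.S x X₃ = lam 3 • X₃ ∧ m.chart.G x X₁ X₁ = 1 ∧ m.chart.G x X₂ X₂ = 1 ∧
      m.chart.u x = b₁ • X₁ + b₂ • X₂ ∧ ∀ Y, m.chart.G x (m.chart.φ x X₃) Y =
        b₂ * m.chart.G x X₁ Y - b₁ * m.chart.G x X₂ Y := by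
  obtain ⟨U₁, hU₁, U₂, hU₂, A, hA, b₁, b₂, hb₁, hb₂, e1, e2, -, e4, e5⟩ := hl.frame (m.σ x)
  have hb := m.bijective x hx
  obtain ⟨X₁, rfl⟩ := hb.2 U₁
  obtain ⟨X₂, rfl⟩ := hb.2 U₂
  obtain ⟨X₃, rfl⟩ := hb.2 A
  rw [m.metric_T x hx] at e1 e2
  rw [m.mem_principalSpace x hx] at hU₁ hU₂ hA
  refine ⟨X₁, X₂, X₃, b₁, b₂, hb₁, hb₂, hU₁, hU₂, hA, e1, e2, ?_, fun Y => ?_⟩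
  · refine hb.1 (hM.immersion _ ?_)
    rw [← m.I_normal x hx, e4]
    simp only [map_add, map_smul]
  · rw [m.I_T x hx] at e5
    have e6 := congrArg (fun v => metricL c (f (m.σ x)) v (diff f (m.σ x) (m.T x Y))) e5
    simp only [map_sub, map_smul, sub_apply, smul_apply, metricL_apply, m.metric_T x hx,
      smul_eq_mul] at e6
    rw [metric_comm _ (ξ _), hM.normal, mul_zero, sub_zero] at e6
    exact e6

theorem hopfSet_eq (hc : c < 0) (hM : IsRealHypersurface c f ξ)
    (hh : ∀ q, hopfNumber c f ξ q = 2) (p : M) : hopfSet c f ξ p = {lam 1, lam 2} := by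
  obtain ⟨m⟩ := hM.exists_model hc p
  obtain ⟨X₁, X₂, X₃, b₁, b₂, hb₁, hb₂, h1, h2, -, e1, e2, eu, -⟩ := hl.frame_model m hM m.pt_mem
  have h12 := HypersurfaceChart.G_eigen_ne hl.lt.ne m.pt_mem h1 h2
  have h21 := HypersurfaceChart.G_eigen_ne hl.lt.ne.symm m.pt_mem h2 h1
  have hcard : (hopfSet c f ξ p).ncard = 2 := hh p
  refine (Set.eq_of_subset_of_ncard_le ?_ ?_ (Set.finite_of_ncard_ne_zero (by simp [hcard]))).symm
  · rw [← m.σ_pt]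
    rintro _ (rfl | rfl)
    · refine (m.mem_hopfSet m.pt_mem).2 ⟨X₁, h1, ?_⟩
      rw [eu]
      simp [e1, h21, hb₁.ne']
    · refine (m.mem_hopfSet m.pt_mem).2 ⟨X₂, h2, ?_⟩
      rw [eu]
      simp [e2, h12, hb₂.ne']
  · rw [hcard, Set.ncard_pair hl.lt.ne]

/-- It has to be seen that the labelled third curvature is the eigenvalue (λ₁ + λ₂)/3 of φU.
Otherwise the given A is orthogonal to φU, and pairing JA with U yields b₁b₂ = 0. -/
theorem exists_hopfFrame (hc : c < 0) (hM : IsRealHypersurface c f ξ)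
    (hh : ∀ q, hopfNumber c f ξ q = 2) {Λ : Finset ℝ}
    (hΛ : ∀ q, principalCurvatures c f ξ q = Λ) (p : M) :
    ∃ (m : HypersurfaceModel c f ξ p)
      (U V : EuclideanSpace ℝ (Fin (2 * n - 1)) → EuclideanSpace ℝ (Fin (2 * n - 1))),
      m.chart.IsHopfFrame Λ (lam 1) (lam 2) (lam 3) U V := by
  obtain ⟨m, U, V, h⟩ := exists_hopfFrame_of_hopfSet hc hM hΛ hl.lt.ne (hl.hopfSet_eq hc hM hh) p
  have hx := m.pt_mem
  obtain ⟨X₁, X₂, X₃, b₁, b₂, hb₁, hb₂, h1, h2, h3, e1, e2, eu, eA⟩ := hl.frame_model m hM hx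
  have e : lam 3 = (lam 1 + lam 2) / 3 := by
    by_contra hne
    have h0 := HypersurfaceChart.G_eigen_ne hne hx h3 (h.S_A _ hx)
    have h4 := eA (U m.pt)
    rw [m.chart.φ_skew _ hx, h0, m.chart.G_comm _ hx X₁, ← h.toIsHopfSplit.G_u_of_eigen_left hx h1,
      HypersurfaceChart.G_eigen_ne hl.lt.ne.symm hx h2 (h.S_U _ hx), eu] at h4
    have h21 := HypersurfaceChart.G_eigen_ne hl.lt.ne.symm hx h2 h1
    simp [e1, h21, hb₁.ne', hb₂.ne'] at h4
  rw [e]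
  exact ⟨m, U, V, h⟩

end IsAdaptedLabelling

/-- A linear functional on a space of dimension greater than one has a nontrivial kernel. -/
theorem exists_mem_metric_eq_zero (p : M) (ν : ℝ) (v : Coord n)
    (h : 1 < Module.finrank ℝ (principalSpace c f ξ p ν)) :
    ∃ X ∈ principalSpace c f ξ p ν, X ≠ 0 ∧ metric c (f p) v (diff f p X) = 0 := by
  let L : principalSpace c f ξ p ν →ₗ[ℝ] ℝ :=
    ((metricL c (f p) v : Coord n →ₗ[ℝ] ℝ) ∘ₗ (diff f p).toLinearMap) ∘ₗ Submodule.subtype _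
  have hL : ¬ Function.Injective L := fun hinj => by
    have := LinearMap.finrank_le_finrank_of_injective hinj
    rw [Module.finrank_self] at this
    omega
  rw [← LinearMap.ker_eq_bot, ← ne_eq, Submodule.ne_bot_iff] at hL
  obtain ⟨X, hX, hne⟩ := hL
  exact ⟨X, X.2, fun h0 => hne (Subtype.ext h0), hX⟩

theorem mul_eq_of_one_lt_finrank {p : M} (m : HypersurfaceModel c f ξ p) {Λ : Finset ℝ}
    {a b l : ℝ} {U V : EuclideanSpace ℝ (Fin (2 * n - 1)) → EuclideanSpace ℝ (Fin (2 * n - 1))}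
    (h : m.chart.IsHopfFrame Λ a b l U V)
    (hf : 1 < Module.finrank ℝ (principalSpace c f ξ p b)) : l * b = -(c / 4) := by
  have hx := m.pt_mem
  rw [← m.σ_pt] at hf
  obtain ⟨Y, hY, hne, h0⟩ := exists_mem_metric_eq_zero _ _ (diff f _ (m.T _ (V m.pt))) hf
  obtain ⟨X, rfl⟩ := (m.bijective _ hx).2 Y
  rw [m.metric_T _ hx] at h0
  exact h.mul_eq_of_not_simple hx (fun e => hne (by rw [e, map_zero]))
    ((m.mem_principalSpace _ hx _ _).1 hY) h0

theorem finrank_principalSpace_pos {p : M} {ν : ℝ} (h : ν ∈ principalCurvatures c f ξ p) :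
    0 < Module.finrank ℝ (principalSpace c f ξ p ν) := by
  have : FiniteDimensional ℝ (TangentSpace (𝓡 (2 * n - 1)) p) :=
    inferInstanceAs (FiniteDimensional ℝ (EuclideanSpace ℝ (Fin (2 * n - 1))))
  exact Submodule.one_le_finrank_iff.2 h

end CHn

/-! ### Assembly of the classification. -/

theorem mainTheorem3 (n : ℕ) (c : ℝ) (hc : c < 0)
    {M : Type*} [TopologicalSpace M] [ConnectedSpace M]
    [ChartedSpace (EuclideanSpace ℝ (Fin (2 * n - 1))) M]
    [IsManifold (𝓡 (2 * n - 1)) ∞ M]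
    (f ξ : M → CHn.Coord n) (hM : CHn.IsRealHypersurface c f ξ)
    (g : ℕ) (mu : ℕ → ℝ) (hmu : CHn.HasConstantPrincipalCurvatures c f ξ g mu)
    (hh : ∀ p, CHn.hopfNumber c f ξ p = 2) :
    (g = 3 ∨ g = 4) ∧
    (∃ η : M → CHn.Coord n, (η = ξ ∨ η = -ξ) ∧
      ∃ lam : ℕ → ℝ, CHn.IsAdaptedLabelling c f η g lam) ∧
    ∀ η : M → CHn.Coord n, (η = ξ ∨ η = -ξ) →
      ∀ lam : ℕ → ℝ, CHn.IsAdaptedLabelling c f η g lam →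
        (g = 3 → (∃ p, 1 < Module.finrank ℝ (CHn.principalSpace c f η p (lam 2))) →
          lam 1 = 0 ∧ lam 2 = √(-3 * c) / 2 ∧ lam 3 = √(-c) / (2 * √3)) ∧
        (g = 4 →
          (∀ p, Module.finrank ℝ (CHn.principalSpace c f η p (lam 2)) = 1) ∧
          lam 3 ≠ 0 ∧ lam 3 ≠ √(-c) / (2 * √3) ∧ lam 4 = -c / (4 * lam 3)) := by
  obtain ⟨Λ, hg, -, hΛ⟩ := hmu.exists_finset
  obtain ⟨a, b, hab, he⟩ := CHn.exists_hopfSet_eq hc hM hΛ hh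
  have hs3 : (√3) ^ 2 = 3 := Real.sq_sqrt (by norm_num)
  have hs3' : 0 < √3 := Real.sqrt_pos.2 (by norm_num)
  have hsc : (√(-c)) ^ 2 = -c := Real.sq_sqrt (by linarith)
  refine ⟨?_, ?_, ?_⟩
  · rcases (CHn.card_principalCurvatures hc hM hΛ hab.ne he).2 with ⟨-, h⟩ | ⟨-, -, -, -, -, h⟩
    · exact Or.inl (hg.symm.trans h)
    · exact Or.inr (hg.symm.trans h)
  · rcases le_or_gt 0 (a + b) with h0 | h0
    · exact ⟨ξ, Or.inl rfl, CHn.exists_adaptedLabelling hc hM hmu hab h0 he⟩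
    · refine ⟨-ξ, Or.inr rfl, CHn.exists_adaptedLabelling (a := -b) (b := -a) hc hM.neg hmu.neg
        (by linarith) (by linarith) fun q => ?_⟩
      rw [CHn.hopfSet_neg, he, Set.image_pair, Set.pair_comm]
  · intro η hη lam hl
    have hM' : CHn.IsRealHypersurface c f η := by
      rcases hη with rfl | rfl
      · exact hM
      · exact hM.neg
    have hh' : ∀ p, CHn.hopfNumber c f η p = 2 := by
      rcases hη with rfl | rfl
      · exact hh
      · exact fun p => (CHn.hopfNumber_neg p).trans (hh p)
    obtain ⟨Λ', -, -, hΛ'⟩ := hl.toHasConstantPrincipalCurvatures.exists_finset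
    have hfr := hl.exists_hopfFrame hc hM' hh' hΛ'
    -- The equivalence depends on the normalization λ₃ ≥ 0, which selects the positive root.
    have hsqrt : 3 * lam 3 ^ 2 = -(c / 4) ↔ lam 3 = √(-c) / (2 * √3) := by
      rw [← sq_eq_sq₀ hl.nonneg (by positivity), div_pow, mul_pow, hs3, hsc]
      constructor <;> intro h <;> linarith
    constructor
    · rintro - ⟨p, hp⟩
      obtain ⟨m, U, V, h⟩ := hfr p
      obtain ⟨h1, h2, h3⟩ := h.eq_of_mul_eq m.pt_mem (CHn.mul_eq_of_one_lt_finrank m h hp)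
      refine ⟨h1, ?_, hsqrt.1 h3⟩
      have hn := hl.nonneg
      rw [← sq_eq_sq₀ (by linarith) (by positivity), div_pow, Real.sq_sqrt (by linarith), h2]
      linarith
    · rintro rfl
      have ne : ∀ i ∈ Set.Icc 1 3, lam 4 ≠ lam i := fun i hi =>
        hl.lam_ne (by simp) ⟨hi.1, hi.2.trans (by norm_num)⟩ (by have := hi.2; omega)
      have mem : ∀ p, ∀ i ∈ Set.Icc 1 4, lam i ∈ CHn.principalCurvatures c f η p := fun p i hi => by
        rw [hl.eq_image]; exact ⟨i, hi, rfl⟩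
      obtain ⟨p⟩ := (inferInstance : Nonempty M)
      obtain ⟨m, U, V, h⟩ := hfr p
      have h4 : lam 3 * lam 4 = -(c / 4) := by
        obtain ⟨w, hw0, hw⟩ := (m.mem_principalCurvatures m.pt_mem).1 (mem (m.σ m.pt) 4 (by simp))
        exact h.mul_eq_of_ne m.pt_mem hw0 hw (ne 1 (by simp)) (ne 2 (by simp)) (ne 3 (by simp))
      have h3 : lam 3 ≠ 0 := fun h0 => by rw [h0] at h4; linarith
      -- λ₄ already solves λ₃t = -c/4, so a second solution λ₂ would coincide with it. This excludes
      -- both a multiple λ₂ and the special value of λ₃.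
      have h2 : lam 3 * lam 2 ≠ -(c / 4) := fun e =>
        ne 2 (by simp) (mul_left_cancel₀ h3 (h4.trans e.symm))
      refine ⟨fun q => ?_, h3, fun e => ?_, ?_⟩
      · have h5 := CHn.finrank_principalSpace_pos (mem q 2 (by simp))
        obtain ⟨m', U', V', h'⟩ := hfr q
        by_contra hne
        exact h2 (CHn.mul_eq_of_one_lt_finrank m' h' (by omega))
      · have e3 := hsqrt.2 e
        have hγ := h.γ_eq m.pt_mem
        have hsum := h.sum_eq m.pt_mem
        -- In general λ₁λ₂ = γ + 3λ₃², which vanishes at the special value. If λ₁ = 0 then λ₂ = 3λ₃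
        -- would equal λ₄; if λ₂ = 0 then λ₁ < 0 contradicts λ₁ + λ₂ = 3λ₃ ≥ 0.
        have hprod : lam 1 * lam 2 = 0 := by linear_combination e3 - hγ + lam 3 * hsum
        have hlt := hl.lt
        have hn := hl.nonneg
        rcases mul_eq_zero.1 hprod with h1 | h1
        · refine h2 ?_
          rw [show lam 2 = 3 * lam 3 by linarith]
          linarith
        · linarith
      · rw [eq_div_iff (by positivity)]
        linarith
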